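/- **Setting.** A (bounded-error) quantum algorithm is a single program for a classically controlled random access machine with an unlimited supply of qubits initialised to $|0\rangle$. In one time step the machine performs one elementary classical operation on registers and memory (constants, copying, successor, predecessor, indirect load and store, branching), applies one of the gates $X, H, T, \mathrm{CNOT}, \mathrm{TOFFOLI}$, or measures one qubit. It solves a problem in $O(f(n))$ time if, for some constant $K$, on every instance with parameter $n$ it halts within $K f(n)$ steps and outputs the correct answer with probability at least $2/3$. For a CNF formula $\phi$ on $n$ variables (a list of clauses, each clause a set of literals) let $|\phi|$ be its number of satisfying assignments. \#CNFSAT asks for $|\phi|$ in binary; maj-CNFSAT asks whether $|\phi|\ge 2^n/2$. *\#QSETH* (respectively *Majority-QSETH*) is the hypothesis that for each constant $\delta>0$ there is $c>0$ such that no bounded-error quantum algorithm solves \#CNFSAT (respectively maj-CNFSAT), restricted to formulas with at most $cn^2$ clauses, in $O(2^{n(1-\delta)})$ time. The *strong simulation problem with $p$-bit precision*: given a quantum circuit $C$ on $n$ qubits (a list of the gates above) and $x\in\{0,1\}^n$, output the first $p$ binary digits $C_0.C_1\ldots C_{p-1}$ of $|\langle x|C|0^n\rangle|$, i.e. the digits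 of $\lfloor 2^{p-1}|\langle x|C|0^n\rangle|\rfloor$. **Theorem.** 1. If \#QSETH holds, then for each constant $\delta>0$ there is no bounded-error quantum algorithm that solves the strong simulation problem with $(n+1)$-bit precision in $O(2^{n(1-\delta)})$ time; this holds even restricted to circuits with at most $c\,n^c$ gates, for some $c\in\mathbb N$ depending on $\delta$. 2. If Majority-QSETH holds, then for each constant $\delta>0$ there is no bounded-error quantum algorithm that solves the strong simulation problem with $2$-bit precision in $O(2^{n(1-\delta)})$ time; this holds even restricted to circuits with at most $c\,n^c$ gates, for some $c\in\mathbb N$ depending on $\delta$. 3. Let $\phi$ be a CNF formula with $n$ variables and $m$ clauses, and put $d=\lceil\log_2 n\rceil+\lceil\log_2 m\rceil$ (with $\lceil\log_2 0\rceil$ read as $0$). There is a circuit $R$ of at most $8\cdot 3^{d}$ gates from $\{X,\mathrm{CNOT},\mathrm{TOFFOLI}\}$ on $k=n+w+1\le n+\max(1,2d)$ wires that computes $\phi$ reversibly and tidily, $R|x,0^w,b\rangle=|x,0^w,b\oplus\phi(x)\rangle$ for all $x\in\{0,1\}^n$, $b\in\{0,1\}$, and such that the circuit $C_\phi$ consisting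 of Hadamard gates on the first $n$ wires, then $R$, then Hadamard gates on the first $n$ wires, then $X$ on the last wire, satisfies $\langle 0^k|C_\phi|0^k\rangle=|\phi|/2^n$. -/

import Mathlib

namespace QFine

/-! ## Quantum states, gates and circuits -/

/-- Amplitudes of a register of qubits labelled by `ι`, in the computational basis. For infinite
`ι` only finitely supported vectors ever occur below. -/
abbrev QState (ι : Type) : Type := (ι → Bool) → ℂ

/-- The elementary gates. The last argument of `CNOT` and of `TOFFOLI` is the target. -/
inductive Gate (ι : Type) : Type where
  | X (q : ι)
  | H (q : ι)
  | T (q : ι)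
  | CNOT (a t : ι)
  | TOFFOLI (a b t : ι)

/-- Relabelling the qubits of a gate. -/
def Gate.map {ι κ : Type} (f : ι → κ) : Gate ι → Gate κ
  | .X q => .X (f q)
  | .H q => .H (f q)
  | .T q => .T (f q)
  | .CNOT a t => .CNOT (f a) (f t)
  | .TOFFOLI a b t => .TOFFOLI (f a) (f b) (f t)

open Classical in
/-- The computational basis state `|x⟩`. -/
noncomputable def ket {ι : Type} (x : ι → Bool) : QState ι := fun y => if y = x then 1 else 0

/-- The action of a gate on a state. A controlled gate whose target is also one of its controls is
read as the identity, so that every gate acts unitarily. -/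
noncomputable def Gate.apply {ι : Type} [DecidableEq ι] : Gate ι → QState ι → QState ι
  | .X q, ψ => fun x => ψ (Function.update x q (!x q))
  | .H q, ψ => fun x =>
      (ψ (Function.update x q false) + (if x q then -1 else 1) * ψ (Function.update x q true))
        / (Real.sqrt 2 : ℂ)
  | .T q, ψ => fun x => (if x q then Complex.exp (Complex.I * Real.pi / 4) else 1) * ψ x
  | .CNOT a t, ψ =>
      if a = t then ψ else fun x => ψ (if x a then Function.update x t (!x t) else x)
  | .TOFFOLI a b t, ψ =>
      if a = t ∨ b = t then ψ
      else fun x => ψ (if x a && x b then Function.update x t (!x t) else x)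

/-- A quantum circuit on `n` qubits: its gates in order of application. Its size is its length. -/
abbrev Circuit (n : ℕ) : Type := List (Gate (Fin n))

/-- Applying the gates of a circuit one after the other. -/
noncomputable def Circuit.run {n : ℕ} (C : Circuit n) (ψ : QState (Fin n)) : QState (Fin n) :=
  C.foldl (fun φ g => g.apply φ) ψ

/-- The amplitude `⟨x|C|0^n⟩`. -/
noncomputable def Circuit.amplitude {n : ℕ} (C : Circuit n) (x : Fin n → Bool) : ℂ :=
  C.run (ket fun _ => false) x

/-! ## CNF formulas -/

/-- A literal: the variable `i` (as `(i, true)`) or its negation (as `(i, false)`). -/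
abbrev Literal (n : ℕ) : Type := Fin n × Bool

/-- A clause: the disjunction of a set of literals. -/
abbrev Clause (n : ℕ) : Type := Finset (Literal n)

/-- A CNF formula on `n` variables: the conjunction of a list of clauses. -/
abbrev CNF (n : ℕ) : Type := List (Clause n)

/-- The truth value of a formula under an assignment. -/
def CNF.eval {n : ℕ} (φ : CNF n) (x : Fin n → Bool) : Bool :=
  decide (∀ C ∈ φ, ∃ l ∈ C, x l.1 = l.2)

/-- The number `|φ|` of satisfying assignments. -/
def CNF.count {n : ℕ} (φ : CNF n) : ℕ :=
  (Finset.univ.filter fun x : Fin n → Bool => φ.eval x = true).card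

/-! ## Quantum algorithms

A quantum algorithm is a program for a random access machine with classical control: it has
registers and a memory holding natural numbers, an unlimited supply of qubits initialised to `0`,
and in one step it performs one elementary classical operation (arithmetic is limited to
successor and predecessor, so that cell contents stay of logarithmic bit length), applies one
elementary gate to qubits whose addresses are in registers, or measures one qubit. -/

/-- Programs. Arguments `r`, `s` are names of registers; in `gate g` the labels of `g` are
names of registers which hold the addresses of the qubits that are acted on. -/
inductive Prog : Type where
  | skip
  | const (r v : ℕ)
  | copy (r s : ℕ)
  | succ (r : ℕ)
  | pred (r : ℕ)
  | load (r s : ℕ)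
  | store (r s : ℕ)
  | gate (g : Gate ℕ)
  | measure (r s : ℕ)
  | seq (P Q : Prog)
  | ite (r : ℕ) (P Q : Prog)
  | loop (r : ℕ) (P : Prog)

/-- A configuration: the commands still to be executed, the registers, the memory and the
unnormalised state of the qubits. The squared norm of the state is the probability of the
measurement outcomes that led to the configuration. -/
structure Config : Type where
  todo : List Prog
  reg : ℕ → ℕ
  mem : ℕ → ℕ
  state : QState ℕ

/-- The unnormalised state after the outcome `b` of measuring the qubit `q`. -/
noncomputable def project (q : ℕ) (b : Bool) (ψ : QState ℕ) : QState ℕ :=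
  fun x => if x q = b then ψ x else 0

/-- The possible configurations after one step: two for a measurement, one in all other cases.
A configuration with nothing left to do is halted. -/
noncomputable def Config.step (c : Config) : List Config :=
  match c.todo with
  | [] => [c]
  | .skip :: k => [{ c with todo := k }]
  | .const r v :: k => [{ c with todo := k, reg := Function.update c.reg r v }]
  | .copy r s :: k => [{ c with todo := k, reg := Function.update c.reg r (c.reg s) }]
  | .succ r :: k => [{ c with todo := k, reg := Function.update c.reg r (c.reg r + 1) }]
  | .pred r :: k => [{ c with todo := k, reg := Function.update c.reg r (c.reg r - 1) }]
  | .load r s :: k => [{ c with todo := k, reg := Function.update c.reg r (c.mem (c.reg s)) }]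
  | .store r s :: k => [{ c with todo := k, mem := Function.update c.mem (c.reg r) (c.reg s) }]
  | .gate g :: k => [{ c with todo := k, state := (g.map c.reg).apply c.state }]
  | .measure r s :: k =>
      [{ c with
          todo := k
          reg := Function.update c.reg r 0
          state := project (c.reg s) false c.state },
       { c with
          todo := k
          reg := Function.update c.reg r 1
          state := project (c.reg s) true c.state }]
  | .seq P Q :: k => [{ c with todo := P :: Q :: k }]
  | .ite r P Q :: k => [{ c with todo := (if c.reg r ≠ 0 then P else Q) :: k }]
  | .loop r P :: k => [{ c with todo := if c.reg r ≠ 0 then P :: .loop r P :: k else k }]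

/-- The output of a configuration: register `0` holds its length, the memory its entries. -/
def Config.output (c : Config) : List ℕ := (List.range (c.reg 0)).map c.mem

/-- The configuration in which `P` starts on the input `inp`: the input is written to the memory,
its length to register `0`, all other cells are `0`, and all qubits are in the state `0`. -/
noncomputable def Prog.start (P : Prog) (inp : List ℕ) : Config where
  todo := [P]
  reg := Function.update (fun _ => 0) 0 inp.length
  mem := fun i => inp.getD i 0
  state := ket fun _ => false

/-- On every sequence of measurement outcomes of positive probability, the machine halts within
`t` steps. -/
def HaltsWithin : ℕ → Config → Prop
  | 0, c => c.todo = []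
  | t + 1, c => ∀ d ∈ c.step, d.state ≠ 0 → HaltsWithin t d

open Classical in
/-- The probability to have halted after `t` steps with the output `out`. -/
noncomputable def outputProb (out : List ℕ) : ℕ → Config → ℝ
  | 0, c => if c.todo = [] ∧ c.output = out then ∑' x, ‖c.state x‖ ^ 2 else 0
  | t + 1, c => (c.step.map (outputProb out t)).sum

/-- Within `t` steps `P` halts on the input `inp`, and its output is `out` with probability at
least `2/3`. -/
def Prog.ComputesWithin (P : Prog) (t : ℕ) (inp out : List ℕ) : Prop :=
  HaltsWithin t (P.start inp) ∧ 2 / 3 ≤ outputProb out t (P.start inp)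

/-! ## Computational problems -/

/-- A computational problem: its instances, the parameter `n` in which running times are measured,
the encoding of the instances and the required output. -/
structure Problem : Type 1 where
  Inst : Type
  param : Inst → ℕ
  encode : Inst → List ℕ
  answer : Inst → List ℕ

/-- There is a bounded-error quantum algorithm that solves the problem in time `O(f(n))`. -/
def Problem.SolvableInTime (A : Problem) (f : ℕ → ℝ) : Prop :=
  ∃ (P : Prog) (K : ℝ), ∀ I : A.Inst, ∃ t : ℕ,
    (t : ℝ) ≤ K * f (A.param I) ∧ P.ComputesWithin t (A.encode I) (A.answer I)

/-- The `p` binary digits of `N < 2 ^ p`, the most significant digit first. -/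
def digits (p N : ℕ) : List ℕ := (List.range p).map fun i => N / 2 ^ (p - 1 - i) % 2

/-- A formula as a word: the number of variables, the number of clauses, and for each clause its
incidence vector on the literals. -/
def CNF.encode {n : ℕ} (φ : CNF n) : List ℕ :=
  n :: φ.length :: φ.flatMap fun C => (List.finRange n).flatMap fun i =>
    [if (i, true) ∈ C then 1 else 0, if (i, false) ∈ C then 1 else 0]

/-- Four numbers that describe a gate. -/
def Gate.encode {n : ℕ} : Gate (Fin n) → List ℕ
  | .X q => [0, q, 0, 0]
  | .H q => [1, q, 0, 0]
  | .T q => [2, q, 0, 0]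
  | .CNOT a t => [3, a, t, 0]
  | .TOFFOLI a b t => [4, a, b, t]

/-- A circuit and a basis state as a word: the number of qubits, the number of gates, the bits of
the basis state, the gates. -/
def Circuit.encode {n : ℕ} (C : Circuit n) (x : Fin n → Bool) : List ℕ :=
  n :: C.length :: ((List.finRange n).map fun i => (x i).toNat) ++ C.flatMap Gate.encode

/-- `#CNFSAT` for formulas with at most `c * n ^ 2` clauses: output `|φ|`, which is at most `2 ^ n`,
in binary. -/
def sharpCNFSAT (c : ℝ) : Problem where
  Inst := Σ n : ℕ, { φ : CNF n // (φ.length : ℝ) ≤ c * (n : ℝ) ^ 2 }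
  param I := I.1
  encode I := I.2.1.encode
  answer I := digits (I.1 + 1) I.2.1.count

/-- `maj-CNFSAT` for formulas with at most `c * n ^ 2` clauses: output `1` if `|φ| ≥ 2 ^ n / 2` and
`0` otherwise. -/
def majCNFSAT (c : ℝ) : Problem where
  Inst := Σ n : ℕ, { φ : CNF n // (φ.length : ℝ) ≤ c * (n : ℝ) ^ 2 }
  param I := I.1
  encode I := I.2.1.encode
  answer I := [if 2 ^ I.1 ≤ 2 * I.2.1.count then 1 else 0]

/-- The strong simulation problem with `p(n)`-bit precision, for circuits on `n` qubits with at most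
`c * n ^ c` gates: given `C` and `x`, output the first `p = p(n)` binary digits `C_0.C_1…C_{p-1}`
of `|⟨x|C|0^n⟩|`, that is the digits of `⌊2 ^ (p - 1) * |⟨x|C|0^n⟩|⌋`. -/
noncomputable def strongSimulation (p : ℕ → ℕ) (c : ℕ) : Problem where
  Inst := Σ n : ℕ, { C : Circuit n // C.length ≤ c * n ^ c } × (Fin n → Bool)
  param I := I.1
  encode I := I.2.1.1.encode I.2.2
  answer I := digits (p I.1) ⌊(2 : ℝ) ^ (p I.1 - 1) * ‖I.2.1.1.amplitude I.2.2‖⌋₊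

/-- The hypothesis `#QSETH`. -/
def SharpQSETH : Prop :=
  ∀ δ : ℝ, 0 < δ → ∃ c : ℝ, 0 < c ∧
    ¬ (sharpCNFSAT c).SolvableInTime fun n => (2 : ℝ) ^ ((n : ℝ) * (1 - δ))

/-- The hypothesis Majority-QSETH (for the non-strict majority). -/
def MajorityQSETH : Prop :=
  ∀ δ : ℝ, 0 < δ → ∃ c : ℝ, 0 < c ∧
    ¬ (majCNFSAT c).SolvableInTime fun n => (2 : ℝ) ^ ((n : ℝ) * (1 - δ))

/-! ## Reversible circuits for formulas -/

/-- The classical reversible gates. -/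
def Gate.IsReversible {ι : Type} : Gate ι → Prop
  | .X _ => True
  | .CNOT _ _ => True
  | .TOFFOLI _ _ _ => True
  | .H _ => False
  | .T _ => False

/-- The bits `(x, a, b)` on `n` input wires, `w` work wires and one output wire. -/
def wires {n w : ℕ} (x : Fin n → Bool) (a : Fin w → Bool) (b : Bool) : Fin (n + w + 1) → Bool :=
  Fin.snoc (α := fun _ => Bool) (Fin.append x a) b

/-- The circuit `R` is made of classical reversible gates and computes `f` tidily:
`(x, 0^w, b)` is mapped to `(x, 0^w, b ⊕ f(x))`. -/
def TidilyComputes {n w : ℕ} (R : Circuit (n + w + 1)) (f : (Fin n → Bool) → Bool) : Prop :=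
  (∀ g ∈ R, g.IsReversible) ∧
  ∀ (x : Fin n → Bool) (b : Bool),
    R.run (ket (wires x (fun _ => false) b)) = ket (wires x (fun _ => false) (xor b (f x)))

/-- A Hadamard gate on each of the `n` input wires. -/
def hadamards (n w : ℕ) : Circuit (n + w + 1) :=
  (List.finRange n).map fun i => Gate.H (Fin.castAdd w i).castSucc

/-- The circuit `R` between two layers of Hadamard gates on the input wires, and a final negation of
the output wire. -/
def sandwich {n w : ℕ} (R : Circuit (n + w + 1)) : Circuit (n + w + 1) :=
  hadamards n w ++ R ++ hadamards n w ++ [Gate.X (Fin.last (n + w))]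

end QFine

/-!
Both lower bounds come from one reduction: a formula `φ` in `n` variables is turned into a circuit
on `k = n + O(log n)` wires whose amplitude at zero is `|φ| / 2 ^ n`, and the circuit is handed to
an algorithm for strong simulation.

*The circuit.* A tidy reversible circuit for `φ` between two layers of Hadamard gates has the
amplitude `|φ| / 2 ^ n`: the first layer prepares the uniform superposition of all assignments, and
the second one sums up the amplitudes (`amplitude_sandwich`). What matters is that the circuit needs
only logarithmically many work wires. A conjunction of `2 ^ j` terms is computed by a tree with one
work wire for each level: the first half of the terms is computed into the work wire, which then
controls the second half, and the first half is computed once more to clean the work wire. This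
makes three recursive calls and hence `3 ^ j` leaves, which is polynomial in the number of terms
(`tree`, `actList_tree`). A formula is a tree of clauses, and a clause is the negation of a tree of
negated literals (`formulaGates`, `conj_clauseVal`); `CNF.exists_tidy_circuit` is the result.

*The program.* The hypotheses are about programs for a machine without arithmetic beyond successor
and predecessor, so the reduction has to be written out. To keep it short, it uses trees of a common
depth `D`, the bit length of the encoding of `φ`, and a work wire that holds the constant one and
serves as the outermost control (`CNF.uniformCircuit`). The leaves of a tree are enumerated by the
numbers below `3 ^ D`: the ternary digits of a number tell which of the three calls is followed at
each level, and from them the index, the control and the target of the leaf are read off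
(`tree_eq_flatMap`, `runs_decode`). Classical programs are described by their action on named
registers and the memory (`Runs`), and `runs_reduction` says that the program `reduction` replaces
the encoding of `φ` by the encoding of its circuit, in polynomial time.

*The composition.* An algorithm for strong simulation is run on the result. It may overwrite the
whole memory, so `n` is carried past it in a register that it does not use (`computesWithin_seq`).
From its output the answer for `φ` is read off: with `k + 1` digits the amplitude is known exactly,
and its first `n + 1` digits are those of `|φ|`; with two digits it is known whether the amplitude
is at least `1 / 2` (`evaluates_count`, `evaluates_majority`). As `2 ^ k` exceeds `2 ^ n` only by a
polynomial factor, a simulation in time `O(2 ^ (k * (1 - δ)))` gives an algorithm for formulas in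
time `O(2 ^ (n * (1 - δ')))` for small `δ'` (`exists_time_bound`, `strongSimulation_hard`).
-/

namespace QFine

/-! ### Reversible gates as permutations of basis states -/

section Reversible

variable {ι : Type} [DecidableEq ι]

/-- The action of a reversible gate on bit strings. The gates `H` and `T`, which do not permute the
basis states up to sign and phase, are given the trivial action. -/
def Gate.act : Gate ι → (ι → Bool) → (ι → Bool)
  | .X q, x => Function.update x q (!x q)
  | .CNOT a t, x => if a = t then x else if x a then Function.update x t (!x t) else x
  | .TOFFOLI a b t, x =>
      if a = t ∨ b = t then x else if x a && x b then Function.update x t (!x t) else x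
  | .H _, x => x
  | .T _, x => x

/-- The action of a list of gates on bit strings, the first gate acting first. -/
def actList (C : List (Gate ι)) (x : ι → Bool) : ι → Bool :=
  C.foldl (fun y g => g.act y) x

@[simp] lemma actList_nil (x : ι → Bool) : actList [] x = x := rfl

@[simp] lemma actList_cons (g : Gate ι) (C : List (Gate ι)) (x : ι → Bool) :
    actList (g :: C) x = actList C (g.act x) := rfl

lemma actList_append (C D : List (Gate ι)) (x : ι → Bool) :
    actList (C ++ D) x = actList D (actList C x) := by
  simp [actList, List.foldl_append]

/-- Reversible gates act as involutions, so that it does not matter that `Gate.apply` acts on states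
by precomposition. -/
lemma Gate.act_act (g : Gate ι) (x : ι → Bool) : g.act (g.act x) = x := by
  cases g with
  | X q => simp [Gate.act]
  | H q => rfl
  | T q => rfl
  | CNOT a t =>
    by_cases h : a = t
    · simp [Gate.act, h]
    · cases hx : x a <;> simp [Gate.act, h, hx]
  | TOFFOLI a b t =>
    by_cases h : a = t ∨ b = t
    · simp [Gate.act, h]
    · obtain ⟨h1, h2⟩ := not_or.1 h
      cases hx : x a <;> cases hy : x b <;> simp [Gate.act, h1, h2, hx, hy]

lemma Gate.apply_eq_comp_act {g : Gate ι} (hg : g.IsReversible) (ψ : QState ι) :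
    g.apply ψ = fun x => ψ (g.act x) := by
  cases g with
  | X q => rfl
  | H q => exact hg.elim
  | T q => exact hg.elim
  | CNOT a t => by_cases h : a = t <;> simp [Gate.apply, Gate.act, h]
  | TOFFOLI a b t => by_cases h : a = t ∨ b = t <;> simp [Gate.apply, Gate.act, h]

lemma Gate.apply_ket {g : Gate ι} (hg : g.IsReversible) (x : ι → Bool) :
    g.apply (ket x) = ket (g.act x) := by
  rw [Gate.apply_eq_comp_act hg]
  funext y
  have : g.act y = x ↔ y = g.act x :=
    ⟨fun h => by rw [← h, Gate.act_act], fun h => by rw [h, Gate.act_act]⟩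
  simp only [ket]
  by_cases h : g.act y = x
  · rw [if_pos h, if_pos (this.1 h)]
  · rw [if_neg h, if_neg (fun e => h (this.2 e))]

end Reversible

lemma Circuit.run_append {n : ℕ} (C D : Circuit n) (ψ : QState (Fin n)) :
    Circuit.run (C ++ D) ψ = Circuit.run D (Circuit.run C ψ) := by
  simp [Circuit.run, List.foldl_append]

lemma Circuit.run_ket {n : ℕ} (C : Circuit n) (hC : ∀ g ∈ C, g.IsReversible)
    (x : Fin n → Bool) : C.run (ket x) = ket (actList C x) := by
  induction C generalizing x with
  | nil => rfl
  | cons g C ih =>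
    have h1 : Circuit.run (g :: C) (ket x) = Circuit.run C (g.apply (ket x)) := rfl
    rw [h1, Gate.apply_ket (hC g (by simp)), ih (fun g' hg' => hC g' (by simp [hg']))]
    rfl

/-! ### Conjunction trees -/

section Tree

variable {ι κ : Type}

/-- Negation of `t`, controlled by `c` if a control is given. -/
def cnotOpt (c : Option ι) (t : ι) : Gate ι :=
  match c with
  | none => .X t
  | some a => .CNOT a t

/-- Negation of `t`, controlled by `x` and also by `c` if a second control is given. -/
def toffoliOpt (c : Option ι) (x t : ι) : Gate ι :=
  match c with
  | none => .CNOT x t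
  | some a => .TOFFOLI a x t

/-- The value of an optional control; an absent control counts as `true`. -/
def ctrl (c : Option ι) (y : ι → Bool) : Bool := c.elim true y

/-- The circuit `t ↦ t ⊕ a ∧ f i' ∧ f (i' + 1) ∧ …` for the `2 ^ j` indices below the node `i` of
depth `j`, given circuits `leaf i a t` for `t ↦ t ⊕ a ∧ f i`. The left half is computed into the
clean work wire `b j`, which then controls the right half, and is computed once more to clean
`b j`: three recursive calls and one work wire for each level. -/
def tree (b : ℕ → ι) (leaf : ℕ → Option ι → ι → List (Gate ι)) :
    ℕ → ℕ → Option ι → ι → List (Gate ι)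
  | 0, i, a, t => leaf i a t
  | j + 1, i, a, t =>
      tree b leaf j (2 * i) a (b j) ++ tree b leaf j (2 * i + 1) (some (b j)) t
        ++ tree b leaf j (2 * i) a (b j)

/-- The conjunction of `f` over the `2 ^ j` indices below the node `i` of depth `j`. -/
def conj (f : ℕ → (ι → Bool) → Bool) : ℕ → ℕ → (ι → Bool) → Bool
  | 0, i, y => f i y
  | j + 1, i, y => conj f j (2 * i) y && conj f j (2 * i + 1) y

lemma conj_eq_true (f : ℕ → (ι → Bool) → Bool) (j i : ℕ) (y : ι → Bool) :
    conj f j i y = true ↔ ∀ i', i * 2 ^ j ≤ i' → i' < (i + 1) * 2 ^ j → f i' y = true := by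
  induction j generalizing i with
  | zero =>
    simp only [conj, pow_zero, mul_one]
    refine ⟨fun h i' h1 h2 => ?_, fun h => h i le_rfl (Nat.lt_succ_self i)⟩
    obtain rfl : i' = i := by omega
    exact h
  | succ j ih =>
    have e1 : 2 * i * 2 ^ j = i * 2 ^ (j + 1) := by ring
    have e2 : (2 * i + 1 + 1) * 2 ^ j = (i + 1) * 2 ^ (j + 1) := by ring
    have e3 : i * 2 ^ (j + 1) ≤ (2 * i + 1) * 2 ^ j := by
      rw [← e1]; exact Nat.mul_le_mul_right _ (by omega)
    have e4 : (2 * i + 1) * 2 ^ j ≤ (i + 1) * 2 ^ (j + 1) := by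
      rw [← e2]; exact Nat.mul_le_mul_right _ (by omega)
    simp only [conj, Bool.and_eq_true, ih, e1, e2]
    constructor
    · rintro ⟨h1, h2⟩ i' h3 h4
      rcases lt_or_ge i' ((2 * i + 1) * 2 ^ j) with h | h
      · exact h1 i' h3 h
      · exact h2 i' h h4
    · intro h
      exact ⟨fun i' h1 h2 => h i' h1 (by omega), fun i' h1 h2 => h i' (by omega) h2⟩

lemma conj_congr {f : ℕ → (ι → Bool) → Bool} {y z : ι → Bool} (h : ∀ i, f i y = f i z) (j i : ℕ) :
    conj f j i y = conj f j i z := by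
  induction j generalizing i with
  | zero => exact h i
  | succ j ih => simp [conj, ih]

variable [DecidableEq ι]

lemma ctrl_update_ne {c : Option ι} {t : ι} (h : c ≠ some t) (y : ι → Bool) (v : Bool) :
    ctrl c (Function.update y t v) = ctrl c y := by
  cases c with
  | none => rfl
  | some a =>
    have : a ≠ t := fun e => h (by rw [e])
    simp [ctrl, this]

lemma act_cnotOpt {c : Option ι} {t : ι} (h : c ≠ some t) (y : ι → Bool) :
    (cnotOpt c t).act y = Function.update y t (y t ^^ ctrl c y) := by
  cases c with
  | none => simp [cnotOpt, Gate.act, ctrl]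
  | some a =>
    have : a ≠ t := fun e => h (by rw [e])
    cases hy : y a <;> simp [cnotOpt, Gate.act, ctrl, this, hy]

lemma act_toffoliOpt {c : Option ι} {x t : ι} (h : c ≠ some t) (hx : x ≠ t) (y : ι → Bool) :
    (toffoliOpt c x t).act y = Function.update y t (y t ^^ (ctrl c y && y x)) := by
  cases c with
  | none => cases hy : y x <;> simp [toffoliOpt, Gate.act, ctrl, hx, hy]
  | some a =>
    have : a ≠ t := fun e => h (by rw [e])
    cases hy : y a <;> cases hz : y x <;> simp [toffoliOpt, Gate.act, ctrl, this, hx, hy, hz]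

/-- A tree circuit flips its target by the conjunction of its leaves. Here `V` is the set of wires
that may serve as targets and controls, and `P` is the condition under which the leaf circuits work
(their own work wires are clean). -/
lemma actList_tree {b : ℕ → ι} {leaf : ℕ → Option ι → ι → List (Gate ι)}
    {f : ℕ → (ι → Bool) → Bool} {V : ι → Prop} {P : (ι → Bool) → Prop} {D : ℕ}
    (hP : ∀ y t v, V t → P y → P (Function.update y t v))
    (hf : ∀ i y t v, V t → f i (Function.update y t v) = f i y)
    (hleaf : ∀ i a t y, V t → (∀ s ∈ a, V s) → a ≠ some t → P y →
      actList (leaf i a t) y = Function.update y t (y t ^^ (ctrl a y && f i y)))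
    (hbV : ∀ j < D, V (b j)) (hb : ∀ i < D, ∀ j < D, b i = b j → i = j)
    {j : ℕ} (hj : j ≤ D) (i : ℕ) (a : Option ι) (t : ι) (y : ι → Bool)
    (ht : V t) (haV : ∀ s ∈ a, V s) (hat : a ≠ some t)
    (hbt : ∀ l < j, b l ≠ t) (hba : ∀ l < j, a ≠ some (b l)) (hby : ∀ l < j, y (b l) = false)
    (hPy : P y) :
    actList (tree b leaf j i a t) y
      = Function.update y t (y t ^^ (ctrl a y && conj f j i y)) := by
  induction j generalizing i a t y with
  | zero => exact hleaf i a t y ht haV hat hPy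
  | succ j ih =>
    have hjV : V (b j) := hbV j (by omega)
    have hbb : ∀ l < j, b l ≠ b j := fun l hl e => by
      have := hb l (by omega) j (by omega) e
      omega
    have hf' : ∀ i y t v, V t → conj f j i (Function.update y t v) = conj f j i y :=
      fun i y t v hV => conj_congr (fun i => hf i y t v hV) j i
    have htj : t ≠ b j := fun e => hbt j (by omega) e.symm
    have haj : a ≠ some (b j) := hba j (by omega)
    have hyj : y (b j) = false := hby j (by omega)
    have hsome : (some (b j) : Option ι) ≠ some t := fun e => htj (Option.some.inj e).symm
    simp only [tree, actList_append]
    -- The first call puts `a ∧ F` on the clean wire `b j`.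
    rw [ih (by omega) (2 * i) a (b j) y hjV haV haj hbb (fun l hl => hba l (by omega))
      (fun l hl => hby l (by omega)) hPy]
    set F := conj f j (2 * i) y with hF
    set G := conj f j (2 * i + 1) y with hG
    set y1 := Function.update y (b j) (y (b j) ^^ (ctrl a y && F)) with hy1
    have hy1l : ∀ l < j, y1 (b l) = false := fun l hl => by
      rw [hy1, Function.update_of_ne (hbb l hl)]; exact hby l (by omega)
    have hP1 : P y1 := hP _ _ _ hjV hPy
    -- The second call, controlled by `b j`, flips `t` by `a ∧ F ∧ G`.
    rw [ih (by omega) (2 * i + 1) (some (b j)) t y1 ht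
      (fun s hs => by rw [Option.mem_some_iff] at hs; rw [← hs]; exact hjV) hsome
      (fun l hl => hbt l (by omega)) (fun l hl e => hbb l hl (Option.some.inj e).symm) hy1l hP1]
    have hG1 : conj f j (2 * i + 1) y1 = G := hf' _ _ _ _ hjV
    rw [hG1]
    set y2 := Function.update y1 t (y1 t ^^ (ctrl (some (b j)) y1 && G)) with hy2
    have hy2l : ∀ l < j, y2 (b l) = false := fun l hl => by
      rw [hy2, Function.update_of_ne (hbt l (by omega))]; exact hy1l l hl
    have hP2 : P y2 := hP _ _ _ ht hP1
    -- The third call flips `b j` by `a ∧ F` again, as neither `a` nor `F` depends on `t` or `b j`.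
    rw [ih (by omega) (2 * i) a (b j) y2 hjV haV haj hbb (fun l hl => hba l (by omega)) hy2l hP2]
    have hF2 : conj f j (2 * i) y2 = F := by
      rw [hy2, hf' _ _ _ _ ht, hy1, hf' _ _ _ _ hjV]
    have ha2 : ctrl a y2 = ctrl a y := by
      rw [hy2, ctrl_update_ne hat, hy1, ctrl_update_ne haj]
    have hc : ctrl (some (b j)) y1 = (ctrl a y && F) := by
      simp [ctrl, hy1, hyj]
    have h2j : y2 (b j) = (ctrl a y && F) := by
      rw [hy2, Function.update_of_ne htj.symm, hy1, Function.update_self, hyj, Bool.false_xor]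
    have h1t : y1 t = y t := by rw [hy1, Function.update_of_ne htj]
    rw [hF2, ha2, h2j, Bool.xor_self, hy2, hc, h1t, hy1]
    funext w
    by_cases h1 : w = t
    · subst h1
      simp [htj, conj, ← hF, ← hG, Bool.and_assoc]
    · by_cases h2 : w = b j
      · subst h2; simp [h1, hyj]
      · simp [h1, h2]

end Tree

lemma tree_map {ι κ : Type} (f : ι → κ) {b : ℕ → ι} {b' : ℕ → κ}
    {leaf : ℕ → Option ι → ι → List (Gate ι)} {leaf' : ℕ → Option κ → κ → List (Gate κ)}
    (hleaf : ∀ i a t, (leaf i a t).map (Gate.map f) = leaf' i (a.map f) (f t)) {j : ℕ}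
    (hb : ∀ l < j, f (b l) = b' l) (i : ℕ) (a : Option ι) (t : ι) :
    (tree b leaf j i a t).map (Gate.map f) = tree b' leaf' j i (a.map f) (f t) := by
  induction j generalizing i a t with
  | zero => exact hleaf i a t
  | succ j ih =>
    have ih' := ih (fun l hl => hb l (by omega))
    simp [tree, ih', hb j (by omega)]

lemma length_tree_le {ι : Type} {b : ℕ → ι} {leaf : ℕ → Option ι → ι → List (Gate ι)} {B : ℕ}
    (h : ∀ i a t, (leaf i a t).length ≤ B) (j i : ℕ) (a : Option ι) (t : ι) :
    (tree b leaf j i a t).length ≤ B * 3 ^ j := by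
  induction j generalizing i a t with
  | zero => simpa [tree] using h i a t
  | succ j ih =>
    have h1 := ih (2 * i) a (b j)
    have h2 := ih (2 * i + 1) (some (b j)) t
    simp only [tree, List.length_append]
    have h3 : B * 3 ^ (j + 1) = B * 3 ^ j + B * 3 ^ j + B * 3 ^ j := by ring
    omega

lemma isReversible_tree {ι : Type} {b : ℕ → ι} {leaf : ℕ → Option ι → ι → List (Gate ι)}
    (h : ∀ i a t, ∀ g ∈ leaf i a t, g.IsReversible) (j i : ℕ) (a : Option ι) (t : ι) :
    ∀ g ∈ tree b leaf j i a t, g.IsReversible := by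
  induction j generalizing i a t with
  | zero => exact h i a t
  | succ j ih =>
    intro g hg
    simp only [tree, List.mem_append] at hg
    rcases hg with (hg | hg) | hg
    exacts [ih _ _ _ g hg, ih _ _ _ g hg, ih _ _ _ g hg]

/-! ### The circuit of a formula -/

section Formula

variable {ι κ : Type}

/-- The falsity of the part of a clause that belongs to one variable of value `x`, where `p` tells
which of the literals `(x, ¬x)` occur in the clause. -/
def falsified (p : Bool × Bool) (x : Bool) : Bool :=
  if p.1 = p.2 then !p.1 else x ^^ p.1

/-- The circuit `t ↦ t ⊕ a ∧ falsified p x`. It always has two gates: where a gate is not needed,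
the pseudo-gate `CNOT t t` stands in for the identity. -/
def literalGates (p : Bool × Bool) (x : ι) (a : Option ι) (t : ι) : List (Gate ι) :=
  [if p.2 then .CNOT t t else cnotOpt a t, if p.1 = p.2 then .CNOT t t else toffoliOpt a x t]

/-- The circuit `t ↦ t ⊕ a ∧ ¬ (falsified (p 0) (x 0) ∧ falsified (p 1) (x 1) ∧ …)`. -/
def clauseGates (x b' : ℕ → ι) (q : ℕ) (p : ℕ → Bool × Bool) (a : Option ι) (t : ι) :
    List (Gate ι) :=
  cnotOpt a t :: tree b' (fun v => literalGates (p v) (x v)) q 0 a t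

/-- The circuit for a conjunction of `2 ^ p` clauses in `2 ^ q` variables. The literals of the
variable `v` in the clause `i` are given by `lit i v`, the input wires by `x`, and the work wires
for the conjunction and for the clauses by `b` and `b'`. -/
def formulaGates (x b b' : ℕ → ι) (p q : ℕ) (lit : ℕ → ℕ → Bool × Bool) (a : Option ι) (t : ι) :
    List (Gate ι) :=
  tree b (fun i => clauseGates x b' q (lit i)) p 0 a t

/-- The truth value of a clause given by its literals. -/
def clauseVal (x : ℕ → ι) (q : ℕ) (p : ℕ → Bool × Bool) (y : ι → Bool) : Bool :=
  !conj (fun v y => falsified (p v) (y (x v))) q 0 y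

lemma literalGates_map (f : ι → κ) (p : Bool × Bool) {x : ι} {x' : κ}
    (hx : p.1 ≠ p.2 → f x = x') (a : Option ι) (t : ι) :
    (literalGates p x a t).map (Gate.map f) = literalGates p x' (a.map f) (f t) := by
  obtain ⟨p, q⟩ := p
  cases p <;> cases q <;> cases a <;>
    simp_all [literalGates, cnotOpt, toffoliOpt, Gate.map]

lemma clauseGates_map (f : ι → κ) {x b' : ℕ → ι} {x₁ b₁' : ℕ → κ} {q : ℕ} {p : ℕ → Bool × Bool}
    (hx : ∀ v, (p v).1 ≠ (p v).2 → f (x v) = x₁ v) (hb' : ∀ l < q, f (b' l) = b₁' l)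
    (a : Option ι) (t : ι) :
    (clauseGates x b' q p a t).map (Gate.map f) = clauseGates x₁ b₁' q p (a.map f) (f t) := by
  rw [clauseGates, clauseGates, List.map_cons,
    tree_map f (fun v a t => literalGates_map f (p v) (hx v) a t) hb']
  cases a <;> rfl

lemma formulaGates_map (f : ι → κ) {x b b' : ℕ → ι} {x₁ b₁ b₁' : ℕ → κ} {p q : ℕ}
    {lit : ℕ → ℕ → Bool × Bool} (hx : ∀ i v, (lit i v).1 ≠ (lit i v).2 → f (x v) = x₁ v)
    (hb : ∀ l < p, f (b l) = b₁ l) (hb' : ∀ l < q, f (b' l) = b₁' l) (a : Option ι) (t : ι) :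
    (formulaGates x b b' p q lit a t).map (Gate.map f)
      = formulaGates x₁ b₁ b₁' p q lit (a.map f) (f t) :=
  tree_map f (fun i a t => clauseGates_map f (hx i) hb' a t) hb 0 a t

lemma length_clauseGates_le (x b' : ℕ → ι) (q : ℕ) (p : ℕ → Bool × Bool) (a : Option ι) (t : ι) :
    (clauseGates x b' q p a t).length ≤ 3 * 3 ^ q := by
  have h := length_tree_le (b := b') (leaf := fun v => literalGates (p v) (x v)) (B := 2)
    (fun _ _ _ => le_rfl) q 0 a t
  have : 1 ≤ 3 ^ q := Nat.one_le_pow _ _ (by norm_num)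
  simp only [clauseGates, List.length_cons]
  omega

lemma length_formulaGates_le (x b b' : ℕ → ι) (p q : ℕ) (lit : ℕ → ℕ → Bool × Bool)
    (a : Option ι) (t : ι) :
    (formulaGates x b b' p q lit a t).length ≤ 3 * 3 ^ (p + q) := by
  refine (length_tree_le (fun i a t => length_clauseGates_le x b' q (lit i) a t) p 0 a t).trans
    (le_of_eq ?_)
  ring

lemma isReversible_cnotOpt (a : Option ι) (t : ι) : (cnotOpt a t).IsReversible := by
  cases a <;> trivial

lemma isReversible_toffoliOpt (a : Option ι) (x t : ι) : (toffoliOpt a x t).IsReversible := by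
  cases a <;> trivial

lemma isReversible_clauseGates (x b' : ℕ → ι) (q : ℕ) (p : ℕ → Bool × Bool) (a : Option ι)
    (t : ι) : ∀ g ∈ clauseGates x b' q p a t, g.IsReversible := by
  intro g hg
  rcases List.mem_cons.1 hg with rfl | hg
  · exact isReversible_cnotOpt a t
  · refine isReversible_tree (fun v a t g hg => ?_) q 0 a t g hg
    simp only [literalGates, List.mem_cons, List.not_mem_nil, or_false] at hg
    rcases hg with rfl | rfl
    · split_ifs
      exacts [trivial, isReversible_cnotOpt a t]
    · split_ifs
      exacts [trivial, isReversible_toffoliOpt a _ t]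

lemma isReversible_formulaGates (x b b' : ℕ → ι) (p q : ℕ) (lit : ℕ → ℕ → Bool × Bool)
    (a : Option ι) (t : ι) : ∀ g ∈ formulaGates x b b' p q lit a t, g.IsReversible :=
  isReversible_tree (fun i a t => isReversible_clauseGates x b' q (lit i) a t) p 0 a t

variable [DecidableEq ι]

lemma actList_literalGates (p : Bool × Bool) {x : ι} {a : Option ι} {t : ι} (hat : a ≠ some t)
    (hx : p.1 ≠ p.2 → x ≠ t) (y : ι → Bool) :
    actList (literalGates p x a t) y
      = Function.update y t (y t ^^ (ctrl a y && falsified p (y x))) := by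
  have hid : ∀ z : ι → Bool, (Gate.CNOT t t).act z = z := fun z => by simp [Gate.act]
  obtain ⟨p, q⟩ := p
  cases p <;> cases q
  · simp [literalGates, hid, act_cnotOpt hat, falsified]
  · have hx := hx (by simp)
    simp [literalGates, hid, act_toffoliOpt hat hx, falsified]
  · have hx := hx (by simp)
    simp only [literalGates, falsified]
    simp [act_cnotOpt hat, act_toffoliOpt hat hx, ctrl_update_ne hat, hx]
    cases y t <;> cases ctrl a y <;> cases y x <;> rfl
  · simp [literalGates, hid, falsified]

lemma falsified_update {p : Bool × Bool} {x t : ι} (hx : p.1 ≠ p.2 → x ≠ t) (y : ι → Bool)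
    (v : Bool) : falsified p (Function.update y t v x) = falsified p (y x) := by
  by_cases h : p.1 = p.2
  · simp [falsified, h]
  · rw [Function.update_of_ne (hx h)]

/-- The clause circuit flips its target by the value of the clause, for targets and controls in a
set `V` of wires that avoids the inputs. -/
lemma actList_clauseGates {x b' : ℕ → ι} {q : ℕ} {p : ℕ → Bool × Bool} {V : ι → Prop}
    (hxV : ∀ v t, (p v).1 ≠ (p v).2 → V t → x v ≠ t) (hbV : ∀ l < q, V (b' l))
    (hb : ∀ i < q, ∀ j < q, b' i = b' j → i = j) (a : Option ι) (t : ι) (y : ι → Bool)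
    (ht : V t) (haV : ∀ s ∈ a, V s) (hat : a ≠ some t)
    (hbt : ∀ l < q, b' l ≠ t) (hba : ∀ l < q, a ≠ some (b' l)) (hby : ∀ l < q, y (b' l) = false) :
    actList (clauseGates x b' q p a t) y
      = Function.update y t (y t ^^ (ctrl a y && clauseVal x q p y)) := by
  have hf : ∀ i (y : ι → Bool) t v, V t →
      falsified (p i) (Function.update y t v (x i)) = falsified (p i) (y (x i)) :=
    fun i y t v hV => falsified_update (fun h => hxV i t h hV) y v
  rw [clauseGates, actList_cons, act_cnotOpt hat,
    actList_tree (f := fun v y => falsified (p v) (y (x v))) (V := V) (P := fun _ => True) (D := q)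
      (fun _ _ _ _ _ => trivial) hf
      (fun i a t y h1 _ h3 _ => actList_literalGates (p i) h3 (fun h => hxV i t h h1) y)
      hbV hb le_rfl 0 a t _ ht haV hat hbt hba
      (fun l hl => by rw [Function.update_of_ne (hbt l hl)]; exact hby l hl) trivial]
  rw [conj_congr (fun i => hf i y t _ ht), ctrl_update_ne hat, Function.update_self,
    Function.update_idem, clauseVal]
  congr 1
  cases y t <;> cases ctrl a y <;>
    cases conj (fun v y => falsified (p v) (y (x v))) q 0 y <;> rfl

lemma clauseVal_update {x : ℕ → ι} {q : ℕ} {p : ℕ → Bool × Bool} {t : ι}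
    (hx : ∀ v, (p v).1 ≠ (p v).2 → x v ≠ t) (y : ι → Bool) (v : Bool) :
    clauseVal x q p (Function.update y t v) = clauseVal x q p y := by
  rw [clauseVal, clauseVal, conj_congr (fun i => falsified_update (hx i) y v)]

/-- The formula circuit flips its target by the value of the formula, for targets and controls in a
set `V` of wires that avoids the inputs. -/
lemma actList_formulaGates {x b b' : ℕ → ι} {p q : ℕ} {lit : ℕ → ℕ → Bool × Bool} {V : ι → Prop}
    (hxV : ∀ i v t, (lit i v).1 ≠ (lit i v).2 → V t → x v ≠ t)
    (hbV : ∀ l < p, V (b l)) (hb'V : ∀ l < q, V (b' l))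
    (hb : ∀ i < p, ∀ j < p, b i = b j → i = j) (hb' : ∀ i < q, ∀ j < q, b' i = b' j → i = j)
    (hbb' : ∀ i < p, ∀ j < q, b i ≠ b' j)
    (a : Option ι) (t : ι) (y : ι → Bool) (ht : V t) (haV : ∀ s ∈ a, V s) (hat : a ≠ some t)
    (hbt : ∀ l < p, b l ≠ t) (hba : ∀ l < p, a ≠ some (b l)) (hby : ∀ l < p, y (b l) = false)
    (hb't : ∀ l < q, b' l ≠ t) (hb'a : ∀ l < q, a ≠ some (b' l))
    (hb'y : ∀ l < q, y (b' l) = false) :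
    actList (formulaGates x b b' p q lit a t) y
      = Function.update y t (y t ^^ (ctrl a y && conj (fun i => clauseVal x q (lit i)) p 0 y)) := by
  refine actList_tree (f := fun i => clauseVal x q (lit i))
    (V := fun t => V t ∧ ∀ l < q, b' l ≠ t) (P := fun y => ∀ l < q, y (b' l) = false) (D := p)
    (fun y t v h1 h2 l hl => by rw [Function.update_of_ne (h1.2 l hl)]; exact h2 l hl)
    (fun i y t v h => clauseVal_update (fun v hv => hxV i v t hv h.1) y v)
    (fun i a t y h1 h2 h3 h4 => actList_clauseGates (hxV i) hb'V hb' a t y h1.1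
      (fun s hs => (h2 s hs).1) h3 h1.2 (fun l hl e => (h2 (b' l) e).2 l hl rfl) h4)
    (fun j hj => ⟨hbV j hj, fun l hl e => hbb' j hj l hl e.symm⟩) hb le_rfl 0 a t y ⟨ht, hb't⟩
    (fun s hs => ⟨haV s hs, fun l hl e => hb'a l hl ?_⟩) hat hbt hba hby hb'y
  rw [e]; exact hs

end Formula

/-- The literals of the variable `v` in the clause `i` of `φ`. Missing clauses are read as
tautologies, missing variables as not occurring. -/
def CNF.literals {n : ℕ} (φ : CNF n) (i v : ℕ) : Bool × Bool :=
  match φ[i]? with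
  | none => (true, true)
  | some C =>
      if h : v < n then (decide ((⟨v, h⟩, true) ∈ C), decide ((⟨v, h⟩, false) ∈ C))
      else (false, false)

lemma CNF.lt_of_literals_ne {n : ℕ} {φ : CNF n} {i v : ℕ}
    (h : (φ.literals i v).1 ≠ (φ.literals i v).2) : v < n := by
  by_contra hv
  apply h
  cases hi : φ[i]? <;> simp [CNF.literals, hi, hv]

lemma clauseVal_literals {ι : Type} {n : ℕ} (φ : CNF n) {x : ℕ → ι} {q : ℕ}
    {y : ι → Bool} {i : ℕ} {C : Clause n} (hi : φ[i]? = some C) (hq : n ≤ 2 ^ q) :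
    clauseVal x q (φ.literals i) y = true ↔ ∃ l ∈ C, y (x l.1) = l.2 := by
  have h1 : ∀ v : Fin n, falsified (φ.literals i v) (y (x v)) = true ↔
      ¬ ∃ s : Bool, (v, s) ∈ C ∧ y (x v) = s := by
    intro v
    simp only [CNF.literals, hi, v.2, dif_pos, Bool.exists_bool, falsified]
    by_cases h1 : (v, true) ∈ C <;> by_cases h2 : (v, false) ∈ C <;>
      cases hy : y (x v) <;> simp [h1, h2]
  rw [clauseVal, Bool.not_eq_true', ← Bool.not_eq_true, conj_eq_true]
  constructor
  · intro h
    by_contra hC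
    apply h
    intro v _ hv
    by_cases hvn : v < n
    · exact (h1 ⟨v, hvn⟩).2 fun ⟨s, hs, e⟩ => hC ⟨_, hs, e⟩
    · simp [CNF.literals, hi, hvn, falsified]
  · rintro ⟨l, hl, e⟩ h
    exact (h1 l.1).1 (h l.1 (by simp) (by simpa using lt_of_lt_of_le l.1.2 hq)) ⟨l.2, hl, e⟩

/-- The conjunction of the clauses is the value of the formula. The bound on `n` is needed only if
there is a clause to be evaluated. -/
lemma conj_clauseVal {ι : Type} {n : ℕ} (φ : CNF n) {x : ℕ → ι} {p q : ℕ}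
    {y : ι → Bool} {z : Fin n → Bool} (hz : ∀ v : Fin n, y (x v) = z v)
    (hp : φ.length ≤ 2 ^ p) (hq : φ ≠ [] → n ≤ 2 ^ q) :
    conj (fun i => clauseVal x q (φ.literals i)) p 0 y = φ.eval z := by
  rw [Bool.eq_iff_iff, conj_eq_true, CNF.eval, decide_eq_true_iff]
  constructor
  · intro h C hC
    obtain ⟨i, hi, rfl⟩ := List.getElem_of_mem hC
    have := (clauseVal_literals φ (List.getElem?_eq_getElem hi)
      (hq (List.ne_nil_of_mem hC))).1 (h i (by simp) (by simpa using lt_of_lt_of_le hi hp))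
    simpa only [hz] using this
  · intro h i _ _
    rcases hi : φ[i]? with _ | C
    · -- Indices beyond the end of the formula count as true clauses.
      have h0 : ¬ conj (fun v y => falsified (φ.literals i v) (y (x v))) q 0 y = true := by
        rw [conj_eq_true]
        intro h'
        have := h' 0 (by simp) (by simp)
        simp [CNF.literals, hi, falsified] at this
      simpa [clauseVal] using h0
    · have hC := List.mem_of_getElem? hi
      refine (clauseVal_literals φ hi (hq (List.ne_nil_of_mem hC))).2 ?_
      simpa only [hz] using h C hC

/-! ### Layers of Hadamard gates and the amplitude of a sandwich -/

section Hadamard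

variable {ι : Type} [DecidableEq ι]

lemma Gate.apply_sum {κ : Type} (g : Gate ι) (s : Finset κ) (c : κ → ℂ) (φ : κ → QState ι) :
    g.apply (fun y => ∑ i ∈ s, c i * φ i y) = fun y => ∑ i ∈ s, c i * g.apply (φ i) y := by
  funext y
  cases g with
  | X q => rfl
  | H q =>
    simp only [Gate.apply, Finset.mul_sum, ← Finset.sum_add_distrib, Finset.sum_div]
    exact Finset.sum_congr rfl fun i _ => by ring
  | T q =>
    simp only [Gate.apply, Finset.mul_sum]
    exact Finset.sum_congr rfl fun i _ => by ring
  | CNOT a t => by_cases h : a = t <;> simp [Gate.apply, h]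
  | TOFFOLI a b t => by_cases h : a = t ∨ b = t <;> simp [Gate.apply, h]

lemma Circuit.run_sum {n : ℕ} {κ : Type} (C : Circuit n) (s : Finset κ) (c : κ → ℂ)
    (φ : κ → QState (Fin n)) :
    C.run (fun y => ∑ i ∈ s, c i * φ i y) = fun y => ∑ i ∈ s, c i * C.run (φ i) y := by
  induction C generalizing φ with
  | nil => rfl
  | cons g C ih =>
    have h : ∀ ψ, Circuit.run (g :: C) ψ = Circuit.run C (g.apply ψ) := fun _ => rfl
    simp only [h, Gate.apply_sum, ih]

/-- A layer of Hadamard gates on a basis state that vanishes on the wires of the layer. -/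
lemma run_map_H_ket {n : ℕ} {L : List (Fin n)} (hL : L.Nodup) {y : Fin n → Bool}
    (hy : ∀ q ∈ L, y q = false) (z : Fin n → Bool) :
    Circuit.run (L.map Gate.H) (ket y) z
      = if ∀ q, q ∉ L → z q = y q then (1 / (Real.sqrt 2 : ℂ)) ^ L.length else 0 := by
  induction L using List.reverseRecOn generalizing z with
  | nil =>
    have : (∀ q, z q = y q) ↔ z = y := funext_iff.symm
    by_cases h : z = y <;> simp [Circuit.run, ket, this, h]
  | append_singleton L q ih =>
    have hn := List.nodup_append.1 hL
    have hq : q ∉ L := fun h => hn.2.2 q h q (by simp) rfl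
    have ih := ih hn.1 (fun r hr => hy r (by simp [hr]))
    have hyq : y q = false := hy q (by simp)
    rw [List.map_append, Circuit.run_append]
    change (Gate.H q).apply _ z = _
    simp only [Gate.apply, ih]
    have h1 : (∀ r, r ∉ L → Function.update z q false r = y r) ↔
        ∀ r, r ∉ L ++ [q] → z r = y r := by
      constructor
      · intro h r hr
        simp only [List.mem_append, List.mem_singleton, not_or] at hr
        simpa [hr.2] using h r hr.1
      · intro h r hr
        by_cases e : r = q
        · subst e; simp [hyq]
        · rw [Function.update_of_ne e]; exact h r (by simp [hr, e])
    have h2 : ¬ ∀ r, r ∉ L → Function.update z q true r = y r := fun h => by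
      have := h q hq
      simp [hyq] at this
    rw [if_neg h2, mul_zero, add_zero]
    by_cases h : ∀ r, r ∉ L ++ [q] → z r = y r
    · rw [if_pos (h1.2 h), if_pos h, List.length_append, List.length_singleton, pow_succ]
      ring
    · rw [if_neg (fun h' => h (h1.1 h')), if_neg h, zero_div]

/-- The amplitudes after a layer of Hadamard gates, at a bit string that vanishes on the wires of
the layer: all signs are positive. -/
lemma run_map_H_apply {n : ℕ} {L : List (Fin n)} (hL : L.Nodup) (ψ : QState (Fin n))
    {y : Fin n → Bool} (hy : ∀ q ∈ L, y q = false) :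
    Circuit.run (L.map Gate.H) ψ y
      = (1 / (Real.sqrt 2 : ℂ)) ^ L.length *
        ∑ z : Fin n → Bool, if ∀ q, q ∉ L → z q = y q then ψ z else 0 := by
  induction L using List.reverseRecOn generalizing y with
  | nil =>
    have : ∀ z : Fin n → Bool, (∀ q, z q = y q) ↔ z = y := fun z => funext_iff.symm
    simp [Circuit.run, this]
  | append_singleton L q ih =>
    have hn := List.nodup_append.1 hL
    have hq : q ∉ L := fun h => hn.2.2 q h q (by simp) rfl
    have hyq : y q = false := hy q (by simp)
    have hu : ∀ v, ∀ r ∈ L, Function.update y q v r = false := fun v r hr => by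
      have hrq : r ≠ q := by rintro rfl; exact hq hr
      rw [Function.update_of_ne hrq]
      exact hy r (by simp [hr])
    rw [List.map_append, Circuit.run_append]
    change (Gate.H q).apply _ y = _
    simp only [Gate.apply, hyq]
    rw [ih hn.1 (hu false), ih hn.1 (hu true)]
    have hs : (∑ z : Fin n → Bool, if ∀ r, r ∉ L ++ [q] → z r = y r then ψ z else 0)
        = (∑ z : Fin n → Bool, if ∀ r, r ∉ L → z r = Function.update y q false r then ψ z else 0)
        + ∑ z : Fin n → Bool,
            if ∀ r, r ∉ L → z r = Function.update y q true r then ψ z else 0 := by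
      rw [← Finset.sum_add_distrib]
      refine Finset.sum_congr rfl fun z _ => ?_
      have h1 : ∀ v, (∀ r, r ∉ L → z r = Function.update y q v r) ↔
          (∀ r, r ∉ L ++ [q] → z r = y r) ∧ z q = v := by
        intro v
        constructor
        · intro h
          refine ⟨fun r hr => ?_, by simpa using h q hq⟩
          simp only [List.mem_append, List.mem_singleton, not_or] at hr
          simpa [hr.2] using h r hr.1
        · rintro ⟨h, hv⟩ r hr
          by_cases e : r = q
          · subst e; simp [hv]
          · rw [Function.update_of_ne e]; exact h r (by simp [hr, e])
      simp only [h1]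
      by_cases h : ∀ r, r ∉ L ++ [q] → z r = y r
      · simp only [eq_true h, true_and]
        cases z q <;> simp
      · simp only [h, false_and, if_false, add_zero]
    rw [hs, List.length_append, List.length_singleton, pow_succ]
    simp only [Bool.false_eq_true, if_false]
    ring

end Hadamard

section Sandwich

variable {n w : ℕ}

@[simp] lemma wires_input (x : Fin n → Bool) (a : Fin w → Bool) (b : Bool) (i : Fin n) :
    wires x a b (Fin.castAdd w i).castSucc = x i := by
  rw [wires, Fin.snoc_castSucc, Fin.append_left]

@[simp] lemma wires_work (x : Fin n → Bool) (a : Fin w → Bool) (b : Bool) (i : Fin w) :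
    wires x a b (Fin.natAdd n i).castSucc = a i := by
  rw [wires, Fin.snoc_castSucc, Fin.append_right]

@[simp] lemma wires_last (x : Fin n → Bool) (a : Fin w → Bool) (b : Bool) :
    wires x a b (Fin.last (n + w)) = b := by
  rw [wires, Fin.snoc_last]

lemma wires_eta (y : Fin (n + w + 1) → Bool) :
    wires (fun i => y (Fin.castAdd w i).castSucc) (fun i => y (Fin.natAdd n i).castSucc)
      (y (Fin.last _)) = y := by
  funext i
  refine Fin.lastCases ?_ (fun i => ?_) i
  · simp
  · refine Fin.addCases (fun i => ?_) (fun i => ?_) i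
    · rw [wires_input]
    · rw [wires_work]

lemma wires_congr_left {x x' : Fin n → Bool} {a a' : Fin w → Bool} {b b' : Bool}
    (h : wires x a b = wires x' a' b') : x = x' :=
  funext fun i => by simpa using congrFun h (Fin.castAdd w i).castSucc

lemma hadamards_eq_map (n w : ℕ) :
    hadamards n w
      = ((List.finRange n).map fun i => (Fin.castAdd w i).castSucc).map Gate.H := by
  simp [hadamards]

/-- The bit strings that agree with `(x, a, b)` outside the inputs are the strings `(x', a, b)`. -/
lemma forall_notMem_inputs_iff (z : Fin (n + w + 1) → Bool) (x : Fin n → Bool)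
    (a : Fin w → Bool) (b : Bool) :
    (∀ q, q ∉ (List.finRange n).map (fun i => (Fin.castAdd w i).castSucc) →
      z q = wires x a b q) ↔ ∃ x', z = wires x' a b := by
  constructor
  · intro h
    refine ⟨fun i => z (Fin.castAdd w i).castSucc, ?_⟩
    conv_lhs => rw [← wires_eta z]
    have h1 : z (Fin.last _) = b := by
      rw [h, wires_last]
      simp only [List.mem_map, not_exists, not_and]
      exact fun i _ => (Fin.castSucc_lt_last _).ne
    have h2 : (fun i => z (Fin.natAdd n i).castSucc) = a := by
      funext i
      rw [h, wires_work]
      simp only [List.mem_map, not_exists, not_and]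
      intro j _ e
      have := congrArg Fin.val e
      simp at this
      omega
    rw [h1, h2]
  · rintro ⟨x', rfl⟩ q hq
    revert hq
    refine Fin.lastCases ?_ (fun i => ?_) q
    · simp
    · refine Fin.addCases (fun i => ?_) (fun i => ?_) i
      · intro h
        exact absurd (List.mem_map.2 ⟨i, List.mem_finRange i, rfl⟩) h
      · rw [wires_work, wires_work]
        exact fun _ => rfl

/-- The first layer of Hadamard gates prepares the uniform superposition of all inputs, the second
one sums up the amplitudes, so the amplitude is the fraction of the inputs that set the output. -/
lemma amplitude_sandwich {R : Circuit (n + w + 1)} {f : (Fin n → Bool) → Bool}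
    (hR : TidilyComputes R f) :
    (sandwich R).amplitude (fun _ => false)
      = ((Finset.univ.filter fun x => f x = true).card : ℂ) / 2 ^ n := by
  classical
  set L : List (Fin (n + w + 1)) :=
    (List.finRange n).map (fun i => (Fin.castAdd w i).castSucc) with hL
  have hnd : L.Nodup := (List.nodup_finRange n).map fun i j h => by
    have := congrArg Fin.val h
    exact Fin.ext (by simpa using this)
  have hlen : L.length = n := by simp [hL]
  set s : ℂ := (1 / (Real.sqrt 2 : ℂ)) ^ n with hs
  set Z : Fin w → Bool := fun _ => false
  have h0 : (fun _ => false : Fin (n + w + 1) → Bool) = wires (fun _ => false) Z false := by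
    rw [← wires_eta (fun _ => false : Fin (n + w + 1) → Bool)]
  have hfirst : Circuit.run (hadamards n w) (ket fun _ => false)
      = fun z => ∑ x : Fin n → Bool, s * ket (wires x Z false) z := by
    funext z
    rw [hadamards_eq_map, run_map_H_ket hnd (fun _ _ => rfl), hlen, ← hs, ← Finset.mul_sum]
    have hz := forall_notMem_inputs_iff z (fun _ => false) Z false
    rw [← h0, ← hL] at hz
    rw [if_congr hz rfl rfl]
    simp only [ket]
    by_cases h : ∃ x', z = wires x' Z false
    · obtain ⟨x', rfl⟩ := h
      rw [if_pos ⟨x', rfl⟩, Finset.sum_eq_single x', if_pos rfl, mul_one]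
      · intro x _ hx
        exact if_neg fun e => hx (wires_congr_left e).symm
      · simp
    · rw [if_neg h, Finset.sum_eq_zero, mul_zero]
      intro x _
      exact if_neg fun e => h ⟨x, e⟩
  -- The final negation turns the amplitude at zero into the one at which the output wire is set.
  have hsplit : (sandwich R).amplitude (fun _ => false)
      = Circuit.run (hadamards n w) (R.run (Circuit.run (hadamards n w) (ket fun _ => false)))
          (wires (fun _ => false) Z true) := by
    rw [Circuit.amplitude, sandwich, Circuit.run_append, Circuit.run_append, Circuit.run_append]
    change (Gate.X (Fin.last (n + w))).apply _ _ = _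
    simp only [Gate.apply]
    rw [h0, Bool.not_false, wires, Fin.update_snoc_last]
    rfl
  rw [hsplit, hfirst, Circuit.run_sum, hadamards_eq_map, run_map_H_apply hnd, hlen, ← hs]
  · have hR2 : ∀ x, R.run (ket (wires x Z false)) = ket (wires x Z (f x)) := fun x => by
      rw [hR.2, Bool.false_xor]
    have hz := fun z : Fin (n + w + 1) → Bool =>
      forall_notMem_inputs_iff z (fun _ => false) Z true
    rw [← hL] at hz
    simp only [hR2, hz]
    have h1 : ∀ z : Fin (n + w + 1) → Bool,
        (if ∃ x', z = wires x' Z true then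
          ∑ x : Fin n → Bool, s * ket (wires x Z (f x)) z else 0)
        = ∑ x : Fin n → Bool, if z = wires x Z (f x) then (if f x = true then s else 0) else 0 := by
      intro z
      split_ifs with h
      · obtain ⟨x', rfl⟩ := h
        refine Finset.sum_congr rfl fun x _ => ?_
        simp only [ket]
        by_cases e : wires x' Z true = wires x Z (f x)
        · have := congrFun e (Fin.last _)
          simp only [wires_last] at this
          simp [e, ← this]
        · simp [e]
      · symm
        refine Finset.sum_eq_zero fun x _ => ?_
        by_cases e : z = wires x Z (f x)
        · by_cases hf : f x = true
          · rw [hf] at e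
            exact absurd ⟨x, e⟩ h
          · simp [hf]
        · simp [e]
    rw [Finset.sum_congr rfl fun z _ => h1 z, Finset.sum_comm]
    simp only [Finset.sum_ite_eq', Finset.mem_univ, if_true, Finset.sum_ite, Finset.sum_const_zero,
      add_zero, Finset.sum_const, nsmul_eq_mul]
    -- Each layer contributes a factor `s = 2 ^ (- n / 2)`.
    have h2 : s * s = 1 / 2 ^ n := by
      rw [hs, ← mul_pow, div_mul_div_comm, one_mul, ← Complex.ofReal_mul,
        Real.mul_self_sqrt (by norm_num)]
      simp
    rw [mul_left_comm, h2]
    ring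
  · intro q hq
    obtain ⟨i, -, rfl⟩ := List.mem_map.1 hq
    simp

end Sandwich

/-! ### Tidy circuits for formulas on consecutively numbered wires -/

/-- The wire with number `i` (modulo `N + 1`). -/
def wire (N i : ℕ) : Fin (N + 1) := Fin.ofNat (N + 1) i

lemma wire_val {N i : ℕ} (h : i < N + 1) : (wire N i).val = i := Nat.mod_eq_of_lt h

lemma wire_inj {N i j : ℕ} (hi : i < N + 1) (hj : j < N + 1) : wire N i = wire N j ↔ i = j := by
  rw [Fin.ext_iff, wire_val hi, wire_val hj]

lemma wires_wire_input {n w : ℕ} (x : Fin n → Bool) (a : Fin w → Bool) (b : Bool) (i : Fin n) :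
    wires x a b (wire (n + w) i) = x i := by
  rw [← wires_input x a b i]
  congr 1
  exact Fin.ext (wire_val (by omega))

lemma wires_wire_work {n w : ℕ} (x : Fin n → Bool) (b : Bool) {i : ℕ} (h1 : n ≤ i)
    (h2 : i < n + w) : wires x (fun _ : Fin w => false) b (wire (n + w) i) = false := by
  have h : wire (n + w) i = (Fin.natAdd n (⟨i - n, by omega⟩ : Fin w)).castSucc := by
    refine Fin.ext ?_
    rw [wire_val (by omega)]
    simp
    omega
  rw [h, wires_work]

/-- The circuit of `φ` on `n + w + 1` wires whose work wires start at `B` and at `B'`. -/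
def CNF.circuit {n : ℕ} (φ : CNF n) (w B B' p q : ℕ) (c : Option (Fin (n + w + 1))) :
    Circuit (n + w + 1) :=
  formulaGates (wire (n + w)) (fun j => wire (n + w) (B + j)) (fun j => wire (n + w) (B' + j))
    p q φ.literals c (Fin.last (n + w))

/-- If the work wires from `B` on are clean, the circuit of `φ` flips the last wire by the value of
`φ`. The wires between the inputs and `B` are left for the control. -/
lemma CNF.actList_circuit {n : ℕ} (φ : CNF n) {w B B' p q : ℕ} {c : Option (Fin (n + w + 1))}
    (hB : n ≤ B) (hB' : B + p ≤ B') (hw : B' + q ≤ n + w) (hc : ∀ s ∈ c, n ≤ s.val ∧ s.val < B)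
    (hp : φ.length ≤ 2 ^ p) (hq : φ ≠ [] → n ≤ 2 ^ q) (y : Fin (n + w + 1) → Bool)
    (hy : ∀ i, B ≤ i → i < n + w → y (wire (n + w) i) = false) {x : Fin n → Bool}
    (hx : ∀ i : Fin n, y (wire (n + w) i) = x i) :
    actList (φ.circuit w B B' p q c) y
      = Function.update y (Fin.last _) (y (Fin.last _) ^^ (ctrl c y && φ.eval x)) := by
  have hlast : ∀ i, i < n + w → wire (n + w) i ≠ Fin.last (n + w) := fun i hi e => by
    have := congrArg Fin.val e
    rw [wire_val (by omega), Fin.val_last] at this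
    omega
  have hca : ∀ i, B ≤ i → i < n + w → c ≠ some (wire (n + w) i) := fun i h1 h2 e => by
    have := (hc _ (Option.mem_def.2 e)).2
    rw [wire_val (by omega)] at this
    omega
  rw [CNF.circuit, actList_formulaGates (V := fun t => n ≤ t.val)]
  · rw [conj_clauseVal φ hx hp hq]
  · intro i v t h1 h2 e
    have h3 := CNF.lt_of_literals_ne h1
    rw [← e, wire_val (by omega)] at h2
    omega
  · intro l hl
    rw [wire_val (by omega)]; omega
  · intro l hl
    rw [wire_val (by omega)]; omega
  · intro i hi j hj e
    rw [wire_inj (by omega) (by omega)] at e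
    omega
  · intro i hi j hj e
    rw [wire_inj (by omega) (by omega)] at e
    omega
  · intro i hi j hj e
    rw [wire_inj (by omega) (by omega)] at e
    omega
  · simp
  · exact fun s hs => (hc s hs).1
  · intro e
    have := (hc _ (Option.mem_def.2 e)).2
    rw [Fin.val_last] at this
    omega
  · exact fun l hl => hlast _ (by omega)
  · exact fun l hl => hca _ (by omega) (by omega)
  · exact fun l hl => hy _ (by omega) (by omega)
  · exact fun l hl => hlast _ (by omega)
  · exact fun l hl => hca _ (by omega) (by omega)
  · exact fun l hl => hy _ (by omega) (by omega)

lemma CNF.isReversible_circuit {n : ℕ} (φ : CNF n) (w B B' p q : ℕ)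
    (c : Option (Fin (n + w + 1))) : ∀ g ∈ φ.circuit w B B' p q c, g.IsReversible :=
  isReversible_formulaGates _ _ _ _ _ _ _ _

lemma update_wires_last {n w : ℕ} (x : Fin n → Bool) (a : Fin w → Bool) (b v : Bool) :
    Function.update (wires x a b) (Fin.last (n + w)) v = wires x a v := by
  rw [wires, Fin.update_snoc_last]
  rfl

/-- Without a control, `p + q` work wires suffice. -/
lemma CNF.tidilyComputes_circuit {n : ℕ} (φ : CNF n) {p q : ℕ} (hp : φ.length ≤ 2 ^ p)
    (hq : n ≤ 2 ^ q) :
    TidilyComputes (φ.circuit (p + q) n (n + p) p q none) φ.eval := by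
  refine ⟨φ.isReversible_circuit _ _ _ _ _ _, fun x b => ?_⟩
  rw [Circuit.run_ket _ (φ.isReversible_circuit _ _ _ _ _ _),
    φ.actList_circuit le_rfl le_rfl (by omega) (by simp) hp (fun _ => hq) _
      (fun i h1 h2 => wires_wire_work x b h1 h2) (fun i => wires_wire_input x _ b i),
    update_wires_last, wires_last]
  simp [ctrl]

/-- The uniform variant of the circuit of a formula: two trees of the same depth `D`, controlled by
the work wire `n` which holds the constant one while they are evaluated. Thanks to this control, the
kind of a gate depends only on its place in the tree and on the literals. -/
def CNF.uniformCircuit {n : ℕ} (φ : CNF n) (D : ℕ) : Circuit (n + (2 * D + 1) + 1) :=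
  Gate.X (wire _ n) :: φ.circuit (2 * D + 1) (n + 1) (n + 1 + D) D D (some (wire _ n))
    ++ [Gate.X (wire _ n)]

lemma CNF.tidilyComputes_uniformCircuit {n : ℕ} (φ : CNF n) {D : ℕ} (hp : φ.length ≤ 2 ^ D)
    (hq : φ ≠ [] → n ≤ 2 ^ D) : TidilyComputes (φ.uniformCircuit D) φ.eval := by
  have hrev : ∀ g ∈ φ.uniformCircuit D, g.IsReversible := by
    intro g hg
    simp only [CNF.uniformCircuit, List.cons_append, List.mem_cons, List.mem_append,
      List.not_mem_nil, or_false] at hg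
    rcases hg with rfl | hg | rfl
    exacts [trivial, φ.isReversible_circuit _ _ _ _ _ _ g hg, trivial]
  refine ⟨hrev, fun x b => ?_⟩
  rw [Circuit.run_ket _ hrev]
  congr 1
  set y := wires x (fun _ : Fin (2 * D + 1) => false) b with hy
  have hn : wire (n + (2 * D + 1)) n ≠ Fin.last _ := fun e => by
    have := congrArg Fin.val e
    rw [wire_val (by omega), Fin.val_last] at this
    omega
  have hyn : y (wire _ n) = false := wires_wire_work x b le_rfl (by omega)
  rw [CNF.uniformCircuit, List.cons_append, actList_cons, actList_append,
    φ.actList_circuit (x := x) (by omega) le_rfl (by omega)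
      (by simp [wire_val (show n < n + (2 * D + 1) + 1 by omega)]) hp hq]
  · simp only [Gate.act, actList_cons, actList_nil, hyn, Bool.not_false]
    rw [Function.update_comm hn, Function.update_of_ne hn.symm, ctrl, Option.elim_some,
      Function.update_self, Bool.true_and, hy, wires_last, update_wires_last, Function.update_self,
      Function.update_idem, Bool.not_true]
    refine Function.update_eq_self_iff.2 ?_
    exact (wires_wire_work x _ le_rfl (by omega)).symm
  · intro i h1 h2
    simp only [Gate.act]
    rw [Function.update_of_ne, hy, wires_wire_work x b (by omega) h2]
    rw [Ne, wire_inj (by omega) (by omega)]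
    omega
  · intro i
    simp only [Gate.act]
    rw [Function.update_of_ne, hy, wires_wire_input]
    rw [Ne, wire_inj (by omega) (by omega)]
    omega

/-- A tidy circuit for `φ` with trees of the least possible depths, and the amplitude of its
sandwich. -/
lemma CNF.exists_tidy_circuit {n : ℕ} (φ : CNF n) :
    ∃ (w : ℕ) (R : Circuit (n + w + 1)),
      w + 1 ≤ max 1 (2 * (Nat.clog 2 n + Nat.clog 2 φ.length)) ∧
      R.length ≤ 8 * 3 ^ (Nat.clog 2 n + Nat.clog 2 φ.length) ∧
      TidilyComputes R φ.eval ∧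
      (sandwich R).amplitude (fun _ => false) = (φ.count : ℂ) / 2 ^ n := by
  have ht := φ.tidilyComputes_circuit (Nat.le_pow_clog one_lt_two φ.length)
    (Nat.le_pow_clog one_lt_two n)
  refine ⟨_, _, by omega, ?_, ht, amplitude_sandwich ht⟩
  refine (length_formulaGates_le _ _ _ _ _ _ _ _).trans ?_
  rw [Nat.add_comm]
  exact Nat.mul_le_mul_right _ (by norm_num)

/-! ### Deterministic runs and sequential composition of programs -/

/-- The machine goes from `c` to `d` in `t` deterministic steps. -/
def Reach : ℕ → Config → Config → Prop
  | 0, c, d => c = d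
  | t + 1, c, d => ∃ e, c.step = [e] ∧ Reach t e d

lemma Reach.trans {t u : ℕ} {c d e : Config} (h : Reach t c d) (h' : Reach u d e) :
    Reach (t + u) c e := by
  induction t generalizing c with
  | zero => obtain rfl : c = d := h; simpa using h'
  | succ t ih =>
    obtain ⟨f, hf, hfd⟩ := h
    rw [Nat.succ_add]
    exact ⟨f, hf, ih hfd⟩

lemma Reach.of_step {c d : Config} (h : c.step = [d]) : Reach 1 c d := ⟨d, h, rfl⟩

lemma Reach.haltsWithin {t u : ℕ} {c d : Config} (h : Reach t c d) (hd : HaltsWithin u d) :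
    HaltsWithin (u + t) c := by
  induction t generalizing c with
  | zero => obtain rfl : c = d := h; exact hd
  | succ t ih =>
    obtain ⟨e, he, hed⟩ := h
    rw [← Nat.add_assoc]
    intro e' he' _
    rw [he, List.mem_singleton] at he'
    rw [he']
    exact ih hed

lemma Reach.outputProb_eq {t u : ℕ} {c d : Config} (h : Reach t c d) (out : List ℕ) :
    outputProb out (u + t) c = outputProb out u d := by
  induction t generalizing c with
  | zero => obtain rfl : c = d := h; rfl
  | succ t ih =>
    obtain ⟨e, he, hed⟩ := h
    rw [← Nat.add_assoc, outputProb, he]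
    simp [ih hed]

lemma step_of_todo_eq_nil {c : Config} (h : c.todo = []) : c.step = [c] := by
  rw [Config.step, h]

lemma HaltsWithin.of_todo_eq_nil {c : Config} (h : c.todo = []) (t : ℕ) : HaltsWithin t c := by
  induction t with
  | zero => exact h
  | succ t ih =>
    intro d hd _
    rw [step_of_todo_eq_nil h, List.mem_singleton] at hd
    rw [hd]
    exact ih

lemma HaltsWithin.succ {t : ℕ} {c : Config} (h : HaltsWithin t c) : HaltsWithin (t + 1) c := by
  induction t generalizing c with
  | zero => exact HaltsWithin.of_todo_eq_nil h _
  | succ t ih => exact fun d hd h0 => ih (h d hd h0)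

lemma HaltsWithin.mono {t u : ℕ} {c : Config} (h : HaltsWithin t c) (htu : t ≤ u) :
    HaltsWithin u c := by
  induction u, htu using Nat.le_induction with
  | base => exact h
  | succ u _ ih => exact ih.succ

lemma outputProb_nonneg (out : List ℕ) (t : ℕ) (c : Config) : 0 ≤ outputProb out t c := by
  induction t generalizing c with
  | zero =>
    rw [outputProb]
    split_ifs
    exacts [tsum_nonneg fun _ => by positivity, le_rfl]
  | succ t ih =>
    rw [outputProb]
    refine List.sum_nonneg fun x hx => ?_
    obtain ⟨d, -, rfl⟩ := List.mem_map.1 hx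
    exact ih d

lemma outputProb_le_succ (out : List ℕ) (t : ℕ) (c : Config) :
    outputProb out t c ≤ outputProb out (t + 1) c := by
  induction t generalizing c with
  | zero =>
    by_cases h : c.todo = []
    · rw [outputProb.eq_2, step_of_todo_eq_nil h]
      simp
    · rw [outputProb.eq_1, if_neg (fun h' => h h'.1)]
      exact outputProb_nonneg _ _ _
  | succ t ih =>
    rw [outputProb.eq_2, outputProb.eq_2]
    exact List.sum_le_sum fun d _ => ih d

lemma outputProb_mono (out : List ℕ) {t u : ℕ} (h : t ≤ u) (c : Config) :
    outputProb out t c ≤ outputProb out u c := by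
  induction u, h using Nat.le_induction with
  | base => exact le_rfl
  | succ u _ ih => exact ih.trans (outputProb_le_succ _ _ _)

/-- The registers named by a gate are below `R`. -/
def Gate.RegsLt (R : ℕ) : Gate ℕ → Prop
  | .X q => q < R
  | .H q => q < R
  | .T q => q < R
  | .CNOT a t => a < R ∧ t < R
  | .TOFFOLI a b t => a < R ∧ b < R ∧ t < R

/-- All registers named by a program are below `R`. -/
def Prog.RegsLt (R : ℕ) : Prog → Prop
  | .skip => True
  | .const r _ => r < R
  | .copy r s => r < R ∧ s < R
  | .succ r => r < R
  | .pred r => r < R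
  | .load r s => r < R ∧ s < R
  | .store r s => r < R ∧ s < R
  | .gate g => g.RegsLt R
  | .measure r s => r < R ∧ s < R
  | .seq P Q => P.RegsLt R ∧ Q.RegsLt R
  | .ite r P Q => r < R ∧ P.RegsLt R ∧ Q.RegsLt R
  | .loop r P => r < R ∧ P.RegsLt R

lemma Gate.RegsLt.mono {R S : ℕ} (h : R ≤ S) {g : Gate ℕ} (hg : g.RegsLt R) : g.RegsLt S := by
  cases g <;> simp only [Gate.RegsLt] at hg ⊢ <;> omega

lemma Prog.RegsLt.mono {R S : ℕ} (h : R ≤ S) {P : Prog} (hP : P.RegsLt R) : P.RegsLt S := by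
  induction P with
  | skip => trivial
  | gate g => exact Gate.RegsLt.mono h hP
  | seq P Q ihP ihQ => exact ⟨ihP hP.1, ihQ hP.2⟩
  | ite r P Q ihP ihQ => exact ⟨hP.1.trans_le h, ihP hP.2.1, ihQ hP.2.2⟩
  | loop r P ih => exact ⟨hP.1.trans_le h, ih hP.2⟩
  | _ => simp only [Prog.RegsLt] at hP ⊢; omega

lemma Gate.exists_regsLt (g : Gate ℕ) : ∃ R, g.RegsLt R := by
  cases g with
  | X q => exact ⟨q + 1, Nat.lt_succ_self q⟩
  | H q => exact ⟨q + 1, Nat.lt_succ_self q⟩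
  | T q => exact ⟨q + 1, Nat.lt_succ_self q⟩
  | CNOT a t => exact ⟨a + t + 1, by simp only [Gate.RegsLt]; omega⟩
  | TOFFOLI a b t => exact ⟨a + b + t + 1, by simp only [Gate.RegsLt]; omega⟩

lemma Prog.exists_regsLt (P : Prog) : ∃ R, P.RegsLt R := by
  induction P with
  | skip => exact ⟨0, trivial⟩
  | const r v => exact ⟨r + 1, Nat.lt_succ_self r⟩
  | succ r => exact ⟨r + 1, Nat.lt_succ_self r⟩
  | pred r => exact ⟨r + 1, Nat.lt_succ_self r⟩
  | copy r s => exact ⟨r + s + 1, by simp only [Prog.RegsLt]; omega⟩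
  | load r s => exact ⟨r + s + 1, by simp only [Prog.RegsLt]; omega⟩
  | store r s => exact ⟨r + s + 1, by simp only [Prog.RegsLt]; omega⟩
  | measure r s => exact ⟨r + s + 1, by simp only [Prog.RegsLt]; omega⟩
  | gate g => exact g.exists_regsLt
  | seq P Q ihP ihQ =>
    obtain ⟨R, hR⟩ := ihP
    obtain ⟨S, hS⟩ := ihQ
    exact ⟨R + S, hR.mono (by omega), hS.mono (by omega)⟩
  | ite r P Q ihP ihQ =>
    obtain ⟨R, hR⟩ := ihP
    obtain ⟨S, hS⟩ := ihQ
    exact ⟨r + R + S + 1, by omega, hR.mono (by omega), hS.mono (by omega)⟩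
  | loop r P ih =>
    obtain ⟨R, hR⟩ := ih
    exact ⟨r + R + 1, by omega, hR.mono (by omega)⟩

lemma Gate.map_update {R v : ℕ} {ρ : ℕ → ℕ} {g : Gate ℕ} (hg : g.RegsLt R) :
    g.map (Function.update ρ R v) = g.map ρ := by
  have h : ∀ r, r < R → Function.update ρ R v r = ρ r :=
    fun r hr => Function.update_of_ne hr.ne _ _
  cases g <;> simp only [Gate.RegsLt] at hg <;> simp [Gate.map, h, hg]

/-- The configuration `c` as part of a larger computation: `Q` remains to be executed afterwards,
and the register `R` holds the value `v`. -/
def Config.lift (Q : Prog) (R v : ℕ) (c : Config) : Config where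
  todo := c.todo ++ [Q]
  reg := Function.update c.reg R v
  mem := c.mem
  state := c.state

/-- A program that does not use the register `R` is not affected by its contents. -/
lemma step_lift {Q : Prog} {R v : ℕ} {c : Config} (h0 : c.todo ≠ [])
    (hc : ∀ P ∈ c.todo, P.RegsLt R) :
    (c.lift Q R v).step = c.step.map (Config.lift Q R v) ∧
      ∀ d ∈ c.step, ∀ P ∈ d.todo, P.RegsLt R := by
  obtain ⟨todo, ρ, μ, ψ⟩ := c
  cases todo with
  | nil => exact absurd rfl h0
  | cons P k =>
    have hk : ∀ P ∈ k, P.RegsLt R := fun P' hP' => hc P' (List.mem_cons_of_mem _ hP')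
    have hP : P.RegsLt R := hc P (List.mem_cons_self)
    have hr : ∀ r, r < R → Function.update ρ R v r = ρ r :=
      fun r hr => Function.update_of_ne hr.ne _ _
    have hu : ∀ r w, r < R → Function.update (Function.update ρ R v) r w
        = Function.update (Function.update ρ r w) R v :=
      fun r w h => Function.update_comm h.ne' _ _ _
    cases P with
    | gate g =>
      simp only [Prog.RegsLt] at hP
      simp [Config.lift, Config.step, Gate.map_update hP]
      exact hk
    | _ =>
      simp only [Prog.RegsLt] at hP
      simp [Config.lift, Config.step, hr, hu, hP]
      try (split_ifs <;> simp_all [Prog.RegsLt])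
      try exact hk

lemma HaltsWithin.lift {Q : Prog} {R v T : ℕ}
    (hQ : ∀ ρ μ ψ, HaltsWithin T ⟨[Q], ρ, μ, ψ⟩) {t : ℕ} {c : Config}
    (hc : ∀ P ∈ c.todo, P.RegsLt R) (h : HaltsWithin t c) :
    HaltsWithin (t + T) (c.lift Q R v) := by
  have hnil : ∀ c : Config, c.todo = [] → HaltsWithin T (c.lift Q R v) := fun c h => by
    have := hQ (Function.update c.reg R v) c.mem c.state
    rwa [Config.lift, h]
  induction t generalizing c with
  | zero => rw [Nat.zero_add]; exact hnil c h
  | succ t ih =>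
    by_cases h0 : c.todo = []
    · exact (hnil c h0).mono (by omega)
    · obtain ⟨h1, h2⟩ := step_lift (Q := Q) (v := v) h0 hc
      rw [Nat.succ_add]
      intro d hd hd0
      rw [h1] at hd
      obtain ⟨e, he, rfl⟩ := List.mem_map.1 hd
      exact ih (h2 e he) (h e he hd0)

lemma outputProb_lift {Q : Prog} {R v T : ℕ} {out out' : List ℕ}
    (hQ : ∀ ρ μ ψ, ρ R = v → (⟨[], ρ, μ, ψ⟩ : Config).output = out →
      ∃ t ≤ T, ∃ d : Config, Reach t ⟨[Q], ρ, μ, ψ⟩ d ∧ d.todo = [] ∧ d.output = out' ∧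
        d.state = ψ)
    (hR : R ≠ 0) {t : ℕ} {c : Config} (hc : ∀ P ∈ c.todo, P.RegsLt R) :
    outputProb out t c ≤ outputProb out' (t + T) (c.lift Q R v) := by
  have hnil : ∀ c : Config, outputProb out 0 c ≤ outputProb out' T (c.lift Q R v) := by
    intro c
    rw [outputProb]
    split_ifs with h
    · obtain ⟨todo, ρ, μ, ψ⟩ := c
      obtain ⟨h1, h2⟩ := h
      obtain rfl : todo = [] := h1
      obtain ⟨t, ht, d, hd, hd1, hd2, hd3⟩ := hQ (Function.update ρ R v) μ ψ (by simp)
        (by rw [← h2]; simp [Config.output, Function.update_of_ne hR.symm])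
      refine le_trans (le_of_eq ?_) (outputProb_mono out' ht _)
      have := hd.outputProb_eq (u := 0) out'
      rw [Nat.zero_add] at this
      rw [Config.lift, List.nil_append, this, outputProb, if_pos ⟨hd1, hd2⟩, hd3]
    · exact outputProb_nonneg _ _ _
  induction t generalizing c with
  | zero => rw [Nat.zero_add]; exact hnil c
  | succ t ih =>
    by_cases h0 : c.todo = []
    · rw [outputProb, step_of_todo_eq_nil h0]
      simp only [List.map_cons, List.map_nil, List.sum_cons, List.sum_nil, add_zero]
      exact (ih hc).trans (outputProb_mono _ (by omega) _)
    · obtain ⟨h1, h2⟩ := step_lift (Q := Q) (v := v) h0 hc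
      rw [Nat.succ_add, outputProb, outputProb, h1, List.map_map]
      exact List.sum_le_sum fun d hd => ih (h2 d hd)

/-- Running a deterministic reduction, then an algorithm for the problem reduced to, then a
deterministic evaluation of its output. The register `R` carries a number `v` past the
algorithm. -/
lemma computesWithin_seq {A P Q : Prog} {R v T U t : ℕ} {inp inp' out out' : List ℕ}
    (hR : R ≠ 0) (hP : P.RegsLt R)
    (hA : ∃ u ≤ U, ∀ k, Reach u ⟨A :: k, (P.start inp).reg, (P.start inp).mem, (P.start inp).state⟩
      ⟨k, Function.update (P.start inp').reg R v, (P.start inp').mem, (P.start inp').state⟩)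
    (hQ : ∀ ρ μ ψ, ∃ t ≤ T, ∃ d : Config, Reach t ⟨[Q], ρ, μ, ψ⟩ d ∧ d.todo = [] ∧ d.state = ψ ∧
      (ρ R = v → (⟨[], ρ, μ, ψ⟩ : Config).output = out → d.output = out'))
    (h : P.ComputesWithin t inp' out) :
    (Prog.seq A (.seq P Q)).ComputesWithin (t + T + (U + 2)) inp out' := by
  obtain ⟨u, hu, hA⟩ := hA
  have h1 : Reach (u + 2) ((Prog.seq A (.seq P Q)).start inp) ((P.start inp').lift Q R v) := by
    have := ((Reach.of_step rfl : Reach 1 ((Prog.seq A (.seq P Q)).start inp) _).trans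
      (hA [.seq P Q])).trans (Reach.of_step rfl)
    rwa [show 1 + u + 1 = u + 2 by omega] at this
  have hc : ∀ P' ∈ (P.start inp').todo, P'.RegsLt R := by
    intro P' hP'
    obtain rfl : P' = P := by simpa [Prog.start] using hP'
    exact hP
  constructor
  · refine (h1.haltsWithin (HaltsWithin.lift (T := T) (fun ρ μ ψ => ?_) hc h.1)).mono (by omega)
    obtain ⟨t, ht, d, hd, hd1, -, -⟩ := hQ ρ μ ψ
    have := hd.haltsWithin (HaltsWithin.of_todo_eq_nil hd1 0)
    exact this.mono (by omega)
  · refine h.2.trans ?_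
    refine le_trans (outputProb_lift (Q := Q) (v := v) (T := T) (out' := out')
      (fun ρ μ ψ e1 e2 => ?_) hR hc) ?_
    · obtain ⟨t, ht, d, hd, hd1, hd2, hd3⟩ := hQ ρ μ ψ
      exact ⟨t, ht, d, hd, hd1, hd3 e1 e2, hd2⟩
    · rw [← h1.outputProb_eq]
      exact outputProb_mono _ (by omega) _

/-! ### Classical programs on named registers -/

/-- The registers of the reduction, in the order of their numbers:
* parameters: the length of the input, the number of variables, the depth `D` of the trees, `3 ^ D`,
  the output wire, the first work wires for the formula and for the clauses, twice the number of
  variables, the address at which the next gate is written, the number of gates written so far;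
* the four numbers of the gate to be written;
* the numbers of the current leaves of the trees for the formula and for a clause, each with the
  number of leaves that remain;
* of the current clause, the address of its encoding, its control, its target, and a number that is
  zero if there is no such clause;
* of the current variable, its index, the control, the target, and the indicators of its literals;
* the registers of `decode`;
* temporary registers, and the number of wires. -/
structure Regs where
  (len n depth pow out b1 b2 n2 wp cnt : ℕ)
  (e0 e1 e2 e3 : ℕ)
  (g gc h hc : ℕ)
  (ptr a t val : ℕ)
  (v a' t' pos neg : ℕ)
  (dG dS dW dJ dI dA dT quo rem : ℕ)
  (tmp tmp2 k : ℕ)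

namespace Regs

/-- The contents of the registers as a list. -/
def toList (s : Regs) : List ℕ :=
  [s.len, s.n, s.depth, s.pow, s.out, s.b1, s.b2, s.n2, s.wp, s.cnt, s.e0, s.e1, s.e2, s.e3,
    s.g, s.gc, s.h, s.hc, s.ptr, s.a, s.t, s.val, s.v, s.a', s.t', s.pos, s.neg,
    s.dG, s.dS, s.dW, s.dJ, s.dI, s.dA, s.dT, s.quo, s.rem, s.tmp, s.tmp2, s.k]

/-- The contents of the register with number `r`; the registers beyond the named ones are zero. -/
def get (s : Regs) (r : ℕ) : ℕ := s.toList.getD r 0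

/-- Changing the register with number `r`, if it is a named one. -/
def set (s : Regs) (r w : ℕ) : Regs :=
  match r with
  | 0 => { s with len := w }
  | 1 => { s with n := w }
  | 2 => { s with depth := w }
  | 3 => { s with pow := w }
  | 4 => { s with out := w }
  | 5 => { s with b1 := w }
  | 6 => { s with b2 := w }
  | 7 => { s with n2 := w }
  | 8 => { s with wp := w }
  | 9 => { s with cnt := w }
  | 10 => { s with e0 := w }
  | 11 => { s with e1 := w }
  | 12 => { s with e2 := w }
  | 13 => { s with e3 := w }
  | 14 => { s with g := w }
  | 15 => { s with gc := w }
  | 16 => { s with h := w }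
  | 17 => { s with hc := w }
  | 18 => { s with ptr := w }
  | 19 => { s with a := w }
  | 20 => { s with t := w }
  | 21 => { s with val := w }
  | 22 => { s with v := w }
  | 23 => { s with a' := w }
  | 24 => { s with t' := w }
  | 25 => { s with pos := w }
  | 26 => { s with neg := w }
  | 27 => { s with dG := w }
  | 28 => { s with dS := w }
  | 29 => { s with dW := w }
  | 30 => { s with dJ := w }
  | 31 => { s with dI := w }
  | 32 => { s with dA := w }
  | 33 => { s with dT := w }
  | 34 => { s with quo := w }
  | 35 => { s with rem := w }
  | 36 => { s with tmp := w }
  | 37 => { s with tmp2 := w }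
  | 38 => { s with k := w }
  | _ => s

lemma toList_set (s : Regs) {r : ℕ} (hr : r < 39) (w : ℕ) :
    (s.set r w).toList = s.toList.set r w := by
  interval_cases r <;> rfl

lemma update_get (s : Regs) {r : ℕ} (hr : r < 39) (w : ℕ) :
    Function.update s.get r w = (s.set r w).get := by
  funext i
  have hl : s.toList.length = 39 := rfl
  rw [get, toList_set s hr]
  by_cases h : i = r
  · subst h
    simp [List.getD_eq_getElem?_getD, hl, hr]
  · rw [Function.update_of_ne h, get, List.getD_eq_getElem?_getD, List.getD_eq_getElem?_getD,
      List.getElem?_set_ne (Ne.symm h)]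

end Regs

/-- `rLen`, `rN`, … are the numbers of the registers, in the order of the fields of `Regs`. -/
abbrev rLen : ℕ := 0
abbrev rN : ℕ := 1
abbrev rDepth : ℕ := 2
abbrev rPow : ℕ := 3
abbrev rOut : ℕ := 4
abbrev rB1 : ℕ := 5
abbrev rB2 : ℕ := 6
abbrev rN2 : ℕ := 7
abbrev rWp : ℕ := 8
abbrev rCnt : ℕ := 9
abbrev rE0 : ℕ := 10
abbrev rE1 : ℕ := 11
abbrev rE2 : ℕ := 12
abbrev rE3 : ℕ := 13
abbrev rG : ℕ := 14
abbrev rGc : ℕ := 15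
abbrev rH : ℕ := 16
abbrev rHc : ℕ := 17
abbrev rPtr : ℕ := 18
abbrev rA : ℕ := 19
abbrev rT : ℕ := 20
abbrev rVal : ℕ := 21
abbrev rV : ℕ := 22
abbrev rA' : ℕ := 23
abbrev rT' : ℕ := 24
abbrev rPos : ℕ := 25
abbrev rNeg : ℕ := 26
abbrev rDG : ℕ := 27
abbrev rDS : ℕ := 28
abbrev rDW : ℕ := 29
abbrev rDJ : ℕ := 30
abbrev rDI : ℕ := 31
abbrev rDA : ℕ := 32
abbrev rDT : ℕ := 33
abbrev rQuo : ℕ := 34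
abbrev rRem : ℕ := 35
abbrev rTmp : ℕ := 36
abbrev rTmp2 : ℕ := 37
abbrev rK : ℕ := 38

/-- The classical part of a configuration: registers and memory. -/
abbrev Store : Type := Regs × (ℕ → ℕ)

/-- The program `P` leads from the store `s` to the store `s'` deterministically, in at most `B`
steps, and without touching the qubits. -/
def Runs (P : Prog) (s s' : Store) (B : ℕ) : Prop :=
  ∃ t ≤ B, ∀ k ψ, Reach t ⟨P :: k, s.1.get, s.2, ψ⟩ ⟨k, s'.1.get, s'.2, ψ⟩

lemma Runs.mono {P : Prog} {s s' : Store} {B C : ℕ} (h : Runs P s s' B) (hBC : B ≤ C) :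
    Runs P s s' C := by
  obtain ⟨t, ht, h⟩ := h
  exact ⟨t, ht.trans hBC, h⟩

lemma Runs.seq {P Q : Prog} {s s' s'' : Store} {B C : ℕ} (h : Runs P s s' B)
    (h' : Runs Q s' s'' C) : Runs (.seq P Q) s s'' (B + C + 1) := by
  obtain ⟨t, ht, h⟩ := h
  obtain ⟨u, hu, h'⟩ := h'
  refine ⟨1 + t + u, by omega, fun k ψ => ?_⟩
  exact ((Reach.of_step rfl).trans (h (Q :: k) ψ)).trans (h' k ψ)

lemma Runs.ite_pos {r : ℕ} {P Q : Prog} {s s' : Store} {B : ℕ} (hr : s.1.get r ≠ 0)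
    (h : Runs P s s' B) : Runs (.ite r P Q) s s' (B + 1) := by
  obtain ⟨t, ht, h⟩ := h
  refine ⟨1 + t, by omega, fun k ψ => (Reach.of_step ?_).trans (h k ψ)⟩
  simp [Config.step, hr]

lemma Runs.ite_neg {r : ℕ} {P Q : Prog} {s s' : Store} {B : ℕ} (hr : s.1.get r = 0)
    (h : Runs Q s s' B) : Runs (.ite r P Q) s s' (B + 1) := by
  obtain ⟨t, ht, h⟩ := h
  refine ⟨1 + t, by omega, fun k ψ => (Reach.of_step ?_).trans (h k ψ)⟩
  simp [Config.step, hr]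

/-- A loop that passes through the stores `s 0, …, s N`. -/
lemma Runs.loop {r : ℕ} {P : Prog} (s : ℕ → Store) {N B : ℕ}
    (h0 : ∀ i < N, (s i).1.get r ≠ 0) (hN : (s N).1.get r = 0)
    (hP : ∀ i < N, Runs P (s i) (s (i + 1)) B) :
    Runs (.loop r P) (s 0) (s N) (N * (B + 1) + 1) := by
  induction N generalizing s with
  | zero =>
    refine ⟨1, by omega, fun k ψ => Reach.of_step ?_⟩
    simp [Config.step, hN]
  | succ N ih =>
    obtain ⟨t, ht, h⟩ := hP 0 (by omega)
    obtain ⟨u, hu, h'⟩ := ih (fun i => s (i + 1)) (fun i hi => h0 (i + 1) (by omega)) hN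
      (fun i hi => hP (i + 1) (by omega))
    refine ⟨1 + t + u, ?_, fun k ψ => ?_⟩
    · have : (N + 1) * (B + 1) = N * (B + 1) + (B + 1) := by ring
      omega
    · refine ((Reach.of_step ?_).trans (h (.loop r P :: k) ψ)).trans (h' k ψ)
      simp [Config.step, h0 0 (by omega)]

/-- Programs without loops that use neither qubits nor registers other than the named ones. -/
def Prog.Straight : Prog → Bool
  | .skip => true
  | .const r _ => r < 39
  | .copy r _ => r < 39
  | .succ r => r < 39
  | .pred r => r < 39
  | .load r _ => r < 39
  | .store _ _ => true
  | .seq P Q => P.Straight && Q.Straight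
  | .ite _ P Q => P.Straight && Q.Straight
  | _ => false

/-- The effect of a program without loops. -/
def Prog.eval : Prog → Store → Store
  | .const r v, s => (s.1.set r v, s.2)
  | .copy r r', s => (s.1.set r (s.1.get r'), s.2)
  | .succ r, s => (s.1.set r (s.1.get r + 1), s.2)
  | .pred r, s => (s.1.set r (s.1.get r - 1), s.2)
  | .load r r', s => (s.1.set r (s.2 (s.1.get r')), s.2)
  | .store r r', s => (s.1, Function.update s.2 (s.1.get r) (s.1.get r'))
  | .seq P Q, s => Q.eval (P.eval s)
  | .ite r P Q, s => if s.1.get r ≠ 0 then P.eval s else Q.eval s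
  | _, s => s

/-- A bound for the running time of a program without loops. -/
def Prog.cost : Prog → ℕ
  | .seq P Q => P.cost + Q.cost + 1
  | .ite _ P Q => P.cost + Q.cost + 1
  | _ => 1

lemma runs_eval {P : Prog} (hP : P.Straight = true) (s : Store) : Runs P s (P.eval s) P.cost := by
  induction P generalizing s with
  | seq P Q ihP ihQ =>
    rw [Prog.Straight, Bool.and_eq_true] at hP
    exact (ihP hP.1 s).seq (ihQ hP.2 _)
  | ite r P Q ihP ihQ =>
    rw [Prog.Straight, Bool.and_eq_true] at hP
    by_cases h : s.1.get r ≠ 0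
    · rw [Prog.eval, if_pos h]
      refine ((ihP hP.1 s).ite_pos h).mono ?_
      simp only [Prog.cost]; omega
    · rw [Prog.eval, if_neg h]
      refine ((ihQ hP.2 s).ite_neg (not_not.1 h)).mono ?_
      simp only [Prog.cost]; omega
  | skip => exact ⟨1, le_rfl, fun k ψ => Reach.of_step rfl⟩
  | store r r' => exact ⟨1, le_rfl, fun k ψ => Reach.of_step rfl⟩
  | gate g => exact absurd hP (by simp [Prog.Straight])
  | measure r r' => exact absurd hP (by simp [Prog.Straight])
  | loop r P => exact absurd hP (by simp [Prog.Straight])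
  | _ =>
    refine ⟨1, le_rfl, fun k ψ => Reach.of_step ?_⟩
    simp only [Prog.Straight, decide_eq_true_eq] at hP
    simp only [Config.step, Prog.eval, Regs.update_get _ hP]

/-- The behaviour of a program without loops is found by symbolic evaluation. -/
lemma runs_of_eval_eq {P : Prog} {s s' : Store} {B : ℕ} (hP : P.Straight = true)
    (h : P.eval s = s') (hB : P.cost ≤ B) : Runs P s s' B :=
  h ▸ (runs_eval hP s).mono hB

/-- The composition of a list of programs. -/
def Prog.block : List Prog → Prog
  | [] => .skip
  | P :: l => .seq P (Prog.block l)

lemma Runs.nil (s : Store) : Runs (Prog.block []) s s 1 := runs_eval rfl s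

lemma Runs.cons {P : Prog} {l : List Prog} {s s' s'' : Store} {B C : ℕ} (h : Runs P s s' B)
    (h' : Runs (Prog.block l) s' s'' C) : Runs (Prog.block (P :: l)) s s'' (B + C + 1) :=
  h.seq h'

/-- While the register `r` is not zero, decrement it and execute the commands of `l`. -/
def Prog.repeat (r : ℕ) (l : List Prog) : Prog := .loop r (.block (.pred r :: l))

/-- The loop rule with the first and the last store given up to equality. -/
lemma Runs.repeat {r : ℕ} {l : List Prog} {s₀ s₁ : Store} (s : ℕ → Store) {N B : ℕ}
    (hs₀ : s 0 = s₀) (hs₁ : s N = s₁)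
    (h0 : ∀ i < N, (s i).1.get r ≠ 0) (hN : (s N).1.get r = 0)
    (hP : ∀ i < N, Runs (.block (.pred r :: l)) (s i) (s (i + 1)) B) :
    Runs (.repeat r l) s₀ s₁ (N * (B + 1) + 1) :=
  hs₀ ▸ hs₁ ▸ Runs.loop s h0 hN hP

lemma Runs.of_eq {P : Prog} {s s₁ s₂ : Store} {B : ℕ} (h : Runs P s s₁ B) (hs : s₁ = s₂) :
    Runs P s s₂ B := hs ▸ h

attribute [simp] Prog.block Prog.eval Regs.get Regs.set Regs.toList

/-! ### Enumeration of the leaves of a tree -/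

/-- The index of a leaf below its tree: the binary number whose digits tell at which levels the
path to the leaf turns right. The path is given by the ternary digits of `g`, the digit at the place
`j` telling which of the three calls at the level `j` is followed. -/
def leafIndex (g : ℕ) : ℕ → ℕ
  | 0 => 0
  | j + 1 => leafIndex g j + if g / 3 ^ j % 3 = 1 then 2 ^ j else 0

/-- The control of a leaf: the work wire of the lowest level at which its path turns right, or `0`
if there is none. The work wires are `W, W + 1, …`. -/
def leafControl (W g : ℕ) : ℕ → ℕ
  | 0 => 0
  | j + 1 => if g / 3 ^ j % 3 = 1 ∧ leafControl W g j = 0 then W + j else leafControl W g j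

/-- The target of a leaf: the work wire of the lowest level at which its path turns left, or `0`
if there is none. -/
def leafTarget (W g : ℕ) : ℕ → ℕ
  | 0 => 0
  | j + 1 => if g / 3 ^ j % 3 ≠ 1 ∧ leafTarget W g j = 0 then W + j else leafTarget W g j

/-- The number `x`, or `d` if `x` is zero. -/
def orElse (x d : ℕ) : ℕ := if x = 0 then d else x

lemma digit_add {s r j l : ℕ} (hl : l < j) : (s * 3 ^ j + r) / 3 ^ l % 3 = r / 3 ^ l % 3 := by
  obtain ⟨d, rfl⟩ := Nat.exists_eq_add_of_lt hl
  have : s * 3 ^ (l + d + 1) + r = r + 3 ^ l * (3 * (s * 3 ^ d)) := by ring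
  rw [this, Nat.add_mul_div_left _ _ (by positivity), Nat.add_mul_mod_self_left]

lemma leafIndex_add (s r : ℕ) {j l : ℕ} (hl : l ≤ j) :
    leafIndex (s * 3 ^ j + r) l = leafIndex r l := by
  induction l with
  | zero => rfl
  | succ l ih => rw [leafIndex, leafIndex, ih (by omega), digit_add (by omega)]

lemma leafControl_add (W s r : ℕ) {j l : ℕ} (hl : l ≤ j) :
    leafControl W (s * 3 ^ j + r) l = leafControl W r l := by
  induction l with
  | zero => rfl
  | succ l ih => rw [leafControl, leafControl, ih (by omega), digit_add (by omega)]

lemma leafTarget_add (W s r : ℕ) {j l : ℕ} (hl : l ≤ j) :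
    leafTarget W (s * 3 ^ j + r) l = leafTarget W r l := by
  induction l with
  | zero => rfl
  | succ l ih => rw [leafTarget, leafTarget, ih (by omega), digit_add (by omega)]

/-- The leaves of a tree in their order, for consecutively numbered work wires. As `W` is positive,
the number `0` of `leafControl` and `leafTarget` is never a work wire; it stands for the control and
the target of the whole tree. -/
lemma tree_eq_flatMap {W : ℕ} (hW : 0 < W) (leaf : ℕ → Option ℕ → ℕ → List (Gate ℕ))
    (j i a t : ℕ) :
    tree (fun l => W + l) leaf j i (some a) t = (List.range (3 ^ j)).flatMap fun g =>
      leaf (2 ^ j * i + leafIndex g j) (some (orElse (leafControl W g j) a))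
        (orElse (leafTarget W g j) t) := by
  induction j generalizing i a t with
  | zero => simp [tree, leafIndex, leafControl, leafTarget, orElse]
  | succ j ih =>
    have hr : List.range (3 ^ (j + 1)) = List.range (3 ^ j)
        ++ (List.range (3 ^ j)).map (fun r => 1 * 3 ^ j + r)
        ++ (List.range (3 ^ j)).map (fun r => 2 * 3 ^ j + r) := by
      rw [one_mul, ← List.range_add, two_mul, ← List.range_add]
      congr 1
      ring
    have h0 : ∀ r, r = 0 * 3 ^ j + r := fun r => by omega
    have hd : ∀ s r, r < 3 ^ j → s < 3 → (s * 3 ^ j + r) / 3 ^ j % 3 = s := fun s r hr hs => by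
      rw [Nat.mul_comm, Nat.mul_add_div (by positivity), Nat.div_eq_of_lt hr, add_zero,
        Nat.mod_eq_of_lt hs]
    -- The three calls correspond to the values of the leading digit.
    simp only [tree, ih, hr, List.flatMap_append, List.flatMap_map]
    congr 1
    · congr 1
      · refine List.flatMap_congr fun r hr => ?_
        have hd := hd 0 r (List.mem_range.1 hr) (by norm_num)
        rw [← h0] at hd
        simp only [leafIndex, leafControl, leafTarget, hd]
        congr 1
        · simp; ring
        · by_cases h : leafTarget W r j = 0 <;> simp [h, orElse, hW.ne']
      · refine List.flatMap_congr fun r hr => ?_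
        have hd := hd 1 r (List.mem_range.1 hr) (by norm_num)
        simp only [leafIndex, leafControl, leafTarget, hd, leafIndex_add 1 r le_rfl,
          leafControl_add W 1 r le_rfl, leafTarget_add W 1 r le_rfl]
        congr 1
        · simp; ring
        · by_cases h : leafControl W r j = 0 <;> simp [h, orElse, hW.ne']
    · refine List.flatMap_congr fun r hr => ?_
      have hd := hd 2 r (List.mem_range.1 hr) (by norm_num)
      simp only [leafIndex, leafControl, leafTarget, hd, leafIndex_add 2 r le_rfl,
        leafControl_add W 2 r le_rfl, leafTarget_add W 2 r le_rfl]
      congr 1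
      · simp; ring
      · by_cases h : leafTarget W r j = 0 <;> simp [h, orElse, hW.ne']

lemma leafIndex_lt (g j : ℕ) : leafIndex g j < 2 ^ j := by
  induction j with
  | zero => simp [leafIndex]
  | succ j ih =>
    rw [leafIndex, pow_succ]
    split_ifs <;> omega

/-! ### The gates of the reduction, in the order in which they are written -/

/-- The gates of a clause of the uniform circuit, with all labels given as numbers. -/
def clauseList (n D : ℕ) (p : ℕ → Bool × Bool) (a t : ℕ) : List (Gate ℕ) :=
  .CNOT a t :: (List.range (3 ^ D)).flatMap fun h =>
    literalGates (p (leafIndex h D)) (leafIndex h D)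
      (some (orElse (leafControl (n + 1 + D) h D) a)) (orElse (leafTarget (n + 1 + D) h D) t)

/-- The gates of the trees of the uniform circuit, with all labels given as numbers. -/
def formulaList (n D : ℕ) (lit : ℕ → ℕ → Bool × Bool) : List (Gate ℕ) :=
  (List.range (3 ^ D)).flatMap fun g => clauseList n D (lit (leafIndex g D))
    (orElse (leafControl (n + 1) g D) n) (orElse (leafTarget (n + 1) g D) (n + 1 + D + D))

/-- The gates of the sandwich of the uniform circuit, with all labels given as numbers. -/
def sandwichList (n D : ℕ) (lit : ℕ → ℕ → Bool × Bool) : List (Gate ℕ) :=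
  (List.range n).map Gate.H ++ [Gate.X n] ++ formulaList n D lit ++ [Gate.X n]
    ++ (List.range n).map Gate.H ++ [Gate.X (n + 1 + D + D)]

/-- With the wires in the order of inputs, constant one, work wires for the formula, work wires for
the clauses, output. -/
lemma formulaGates_eq_formulaList (n D : ℕ) (lit : ℕ → ℕ → Bool × Bool) :
    formulaGates id (fun j => n + 1 + j) (fun j => n + 1 + D + j) D D lit (some n) (n + 1 + D + D)
      = formulaList n D lit := by
  rw [formulaGates, tree_eq_flatMap (by omega), formulaList]
  refine List.flatMap_congr fun g _ => ?_
  rw [clauseGates, tree_eq_flatMap (by omega), clauseList]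
  simp [cnotOpt]

lemma map_sandwich_uniformCircuit {n : ℕ} (φ : CNF n) (D : ℕ) :
    (sandwich (φ.uniformCircuit D)).map (Gate.map Fin.val) = sandwichList n D φ.literals := by
  have hlast : (Fin.last (n + (2 * D + 1))).val = n + 1 + D + D := by simp; omega
  have hn : (wire (n + (2 * D + 1)) n).val = n := wire_val (by omega)
  have hH : (hadamards n (2 * D + 1)).map (Gate.map Fin.val) = (List.range n).map Gate.H := by
    rw [hadamards, List.map_map, ← List.map_coe_finRange_eq_range, List.map_map]
    rfl
  have hF : (φ.circuit (2 * D + 1) (n + 1) (n + 1 + D) D D (some (wire _ n))).map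
      (Gate.map Fin.val) = formulaList n D φ.literals := by
    rw [CNF.circuit, formulaGates_map Fin.val (x₁ := id) (b₁ := fun j => n + 1 + j)
      (b₁' := fun j => n + 1 + D + j), Option.map_some, hn, hlast, formulaGates_eq_formulaList]
    · intro i v h
      have := CNF.lt_of_literals_ne h
      exact wire_val (by omega)
    · exact fun l hl => wire_val (by omega)
    · exact fun l hl => wire_val (by omega)
  simp only [sandwich, CNF.uniformCircuit, List.map_append, List.map_cons, List.map_nil, hH, hF,
    Gate.map, hn, hlast, sandwichList, List.cons_append, List.append_assoc, List.nil_append]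

/-- Four numbers that describe a gate whose labels are numbers. -/
def natEncode : Gate ℕ → List ℕ
  | .X q => [0, q, 0, 0]
  | .H q => [1, q, 0, 0]
  | .T q => [2, q, 0, 0]
  | .CNOT a t => [3, a, t, 0]
  | .TOFFOLI a b t => [4, a, b, t]

lemma length_natEncode (g : Gate ℕ) : (natEncode g).length = 4 := by cases g <;> rfl

lemma length_flatMap_natEncode (gs : List (Gate ℕ)) :
    (gs.flatMap natEncode).length = 4 * gs.length := by
  induction gs with
  | nil => rfl
  | cons g gs ih => rw [List.flatMap_cons, List.length_append, ih, length_natEncode,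
      List.length_cons]; ring

lemma encode_eq_natEncode {n : ℕ} (g : Gate (Fin n)) : g.encode = natEncode (g.map Fin.val) := by
  cases g <;> rfl

/-- The word that the reduction computes from a formula. -/
def targetWord (n D : ℕ) (lit : ℕ → ℕ → Bool × Bool) : List ℕ :=
  (n + 1 + D + D + 1) :: (sandwichList n D lit).length ::
    (List.replicate (n + 1 + D + D + 1) 0 ++ (sandwichList n D lit).flatMap natEncode)

lemma encode_sandwich_uniformCircuit {n : ℕ} (φ : CNF n) (D : ℕ) :
    (sandwich (φ.uniformCircuit D)).encode (fun _ => false) = targetWord n D φ.literals := by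
  have h := map_sandwich_uniformCircuit φ D
  have h1 : (sandwich (φ.uniformCircuit D)).length = (sandwichList n D φ.literals).length := by
    rw [← h, List.length_map]
  have h2 : (sandwich (φ.uniformCircuit D)).flatMap Gate.encode
      = (sandwichList n D φ.literals).flatMap natEncode := by
    rw [← h, List.flatMap_map]
    exact List.flatMap_congr fun g _ => encode_eq_natEncode g
  have h3 : ∀ N : ℕ, (List.finRange N).map (fun _ => false.toNat) = List.replicate N 0 := by
    intro N; simp [List.map_const']
  rw [Circuit.encode, targetWord, h1, h2, h3, show n + (2 * D + 1) + 1 = n + 1 + D + D + 1 by omega]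
  rfl

/-! ### Reading the literals of a formula from its encoding -/

lemma getElem?_flatMap_of_length {α β : Type} {f : α → List β} {L : ℕ} {l : List α}
    (hf : ∀ x ∈ l, (f x).length = L) {i j : ℕ} (hi : i < l.length) (hj : j < L) :
    (l.flatMap f)[L * i + j]? = (f l[i])[j]? := by
  induction l generalizing i with
  | nil => simp at hi
  | cons x l ih =>
    have hx := hf x (by simp)
    rw [List.flatMap_cons]
    cases i with
    | zero => rw [List.getElem?_append_left (by rw [hx]; omega)]; simp
    | succ i =>
      have : L * (i + 1) + j = L + (L * i + j) := by ring
      rw [this, List.getElem?_append_right (by rw [hx]; omega), hx, Nat.add_sub_cancel_left,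
        ih (fun y hy => hf y (List.mem_cons_of_mem _ hy)) (by simpa using hi)]
      simp

lemma length_clause_encode {n : ℕ} (C : Clause n) :
    ((List.finRange n).flatMap fun i =>
      [if (i, true) ∈ C then 1 else 0, if (i, false) ∈ C then 1 else 0]).length = 2 * n := by
  simp [List.length_flatMap, Nat.mul_comm]

lemma CNF.length_encode {n : ℕ} (φ : CNF n) : φ.encode.length = 2 + 2 * n * φ.length := by
  simp only [CNF.encode, List.length_cons, List.length_flatMap]
  simp [Nat.mul_comm]
  ring

lemma CNF.getD_encode {n : ℕ} (φ : CNF n) {i v : ℕ} (hi : i < φ.length) (hv : v < n) :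
    φ.encode.getD (2 + 2 * n * i + v + v) 0 = (φ.literals i v).1.toNat ∧
      φ.encode.getD (2 + 2 * n * i + v + v + 1) 0 = (φ.literals i v).2.toNat := by
  have key : ∀ j, j < 2 → φ.encode[2 + 2 * n * i + v + v + j]? =
      [if ((⟨v, hv⟩ : Fin n), true) ∈ φ[i] then 1 else 0,
        if ((⟨v, hv⟩ : Fin n), false) ∈ φ[i] then 1 else 0][j]? := by
    intro j hj
    have e : 2 + 2 * n * i + v + v + j = (2 * n * i + (2 * v + j)) + 1 + 1 := by ring
    rw [CNF.encode, e, List.getElem?_cons_succ, List.getElem?_cons_succ,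
      getElem?_flatMap_of_length (fun C _ => length_clause_encode C) hi (by omega),
      getElem?_flatMap_of_length (L := 2) (by simp) (by simpa using hv) hj]
    simp
  have h0 := key 0 (by norm_num)
  have h1 := key 1 (by norm_num)
  rw [add_zero] at h0
  simp only [List.getD_eq_getElem?_getD, h0, h1, CNF.literals, List.getElem?_eq_getElem hi, hv,
    dif_pos]
  constructor
  · by_cases h : ((⟨v, hv⟩ : Fin n), true) ∈ φ[i] <;> simp [h]
  · by_cases h : ((⟨v, hv⟩ : Fin n), false) ∈ φ[i] <;> simp [h]

/-! ### Subroutines of the reduction -/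

/-- Subtract `tmp2` from `tmp` and clear `tmp2`. -/
def subTmp : Prog := .repeat rTmp2 [.pred rTmp]

lemma runs_subTmp (s : Regs) (μ : ℕ → ℕ) :
    Runs subTmp (s, μ) ({ s with tmp := s.tmp - s.tmp2, tmp2 := 0 }, μ) (8 * s.tmp2 + 1) := by
  refine (Runs.repeat (fun i => ({ s with tmp := s.tmp - i, tmp2 := s.tmp2 - i }, μ))
    (N := s.tmp2) (B := 7) (by simp) (by simp) (fun i hi => ?_) (by simp)
    (fun i hi => runs_of_eval_eq rfl ?_ (by decide))).mono (by omega)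
  · simp; omega
  · simp; omega

/-- Add `tmp` to the register `x` and clear `tmp`. -/
def addTmp (x : ℕ) : Prog := .repeat rTmp [.succ x]

lemma Regs.eq_of_get_eq {s s' : Regs} (h : ∀ r < 39, s.get r = s'.get r) : s = s' := by
  have h' : ∀ r : ℕ, r < 39 → s.toList.getD r 0 = s'.toList.getD r 0 := h
  cases s; cases s'
  simp only [Regs.mk.injEq]
  refine ⟨h' 0 ?_, h' 1 ?_, h' 2 ?_, h' 3 ?_, h' 4 ?_, h' 5 ?_, h' 6 ?_, h' 7 ?_, h' 8 ?_, h' 9 ?_,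
    h' 10 ?_, h' 11 ?_, h' 12 ?_, h' 13 ?_, h' 14 ?_, h' 15 ?_, h' 16 ?_, h' 17 ?_, h' 18 ?_,
    h' 19 ?_, h' 20 ?_, h' 21 ?_, h' 22 ?_, h' 23 ?_, h' 24 ?_, h' 25 ?_, h' 26 ?_, h' 27 ?_,
    h' 28 ?_, h' 29 ?_, h' 30 ?_, h' 31 ?_, h' 32 ?_, h' 33 ?_, h' 34 ?_, h' 35 ?_, h' 36 ?_,
    h' 37 ?_, h' 38 ?_⟩ <;> norm_num

lemma runs_addTmp {x : ℕ} (hx : x < 36) (s : Regs) (μ : ℕ → ℕ) :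
    Runs (addTmp x) (s, μ) ((s.set x (s.get x + s.tmp)).set rTmp 0, μ) (8 * s.tmp + 1) := by
  have hx' : x ≠ rTmp := by unfold rTmp; omega
  have ht : s.tmp = s.get rTmp := rfl
  have hg : ∀ (s : Regs) (r w q : ℕ), r < 39 → (s.set r w).get q = Function.update s.get r w q :=
    fun s r w q hr => by rw [Regs.update_get s hr]
  have hx39 : x < 39 := by omega
  have h36 : rTmp < 39 := by decide
  refine Runs.mono (B := s.tmp * (7 + 1) + 1) (Runs.repeat (r := rTmp) (l := [.succ x])
    (s₀ := (s, μ)) (s₁ := ((s.set x (s.get x + s.tmp)).set rTmp 0, μ))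
    (fun i => ((s.set x (s.get x + i)).set rTmp (s.get rTmp - i), μ)) (N := s.tmp)
    (Prod.ext (Regs.eq_of_get_eq fun r _ => ?_) rfl)
    (Prod.ext (Regs.eq_of_get_eq fun r _ => ?_) rfl) (fun i hi => ?_) ?_
    (fun i hi => runs_of_eval_eq ?_ (Prod.ext (Regs.eq_of_get_eq fun r _ => ?_) rfl) ?_))
    (by omega)
  · simp only [hg _ _ _ _ hx39, hg _ _ _ _ h36, Function.update_apply]
    split_ifs with h1 h2
    · rw [h1]; rfl
    · rw [h2]; rfl
    · rfl
  · rw [ht, Nat.sub_self]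
  · simp only [hg _ _ _ _ hx39, hg _ _ _ _ h36, Function.update_apply, if_true]; omega
  · simp only [hg _ _ _ _ hx39, hg _ _ _ _ h36, Function.update_apply, if_true]; omega
  · simp only [Prog.block, Prog.Straight, hx39, h36]; rfl
  · simp only [Prog.block, Prog.eval, hg _ _ _ _ hx39, hg _ _ _ _ h36, Function.update_apply]
    by_cases h1 : r = x
    · simp [h1, hx', Nat.add_assoc]
    · by_cases h2 : r = rTmp
      · simp [h2, hx'.symm, Nat.sub_sub]
      · simp [h1, h2]
  · simp only [Prog.block, Prog.cost]; omega

/-- Division of `dG` by three: the quotient goes to `quo`, three minus the remainder to `rem`, which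
counts down from `3` to `1` periodically. -/
def divThree : Prog :=
  .block [.const rRem 3,
    .repeat rDG [.pred rRem, .ite rRem .skip (.block [.const rRem 3, .succ rQuo])]]

lemma runs_divThree (s : Regs) (μ : ℕ → ℕ) (hq : s.quo = 0) :
    Runs divThree (s, μ) ({ s with dG := 0, quo := s.dG / 3, rem := 3 - s.dG % 3 }, μ)
      (20 * s.dG + 10) := by
  have h1 : Runs (.const rRem 3) (s, μ) ({ s with rem := 3 }, μ) 1 :=
    runs_of_eval_eq rfl rfl le_rfl
  refine (h1.cons ((Runs.repeat
    (fun i => ({ s with dG := s.dG - i, quo := i / 3, rem := 3 - i % 3 }, μ)) (N := s.dG) (B := 13)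
    (by simp [hq]) (by simp) (fun i hi => ?_) (by simp)
    (fun i hi => runs_of_eval_eq rfl ?_ (by decide))).cons (Runs.nil _))).mono (by omega)
  · simp; omega
  · simp only [Prog.block, Prog.eval, Regs.set, Regs.get, Regs.toList, List.getD_cons_succ,
      List.getD_cons_zero]
    split_ifs with h <;> simp only [Prod.mk.injEq, Regs.mk.injEq, and_true, true_and] <;> omega

/-- Processing one ternary digit `d` of a leaf number, when `rem` is `3 - d` and `quo` is the
number without this digit. -/
def processDigit : Prog :=
  .block [.copy rDG rQuo, .const rQuo 0, .pred rRem,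
    .ite rRem (.block [.pred rRem, .ite rRem (.const rRem 0) (.const rRem 1)]) .skip,
    .ite rRem (.block [.ite rDA .skip (.copy rDA rDW), .copy rTmp rDS])
      (.ite rDT .skip (.copy rDT rDW)),
    .const rRem 0]

lemma runs_processDigit (s : Regs) (μ : ℕ → ℕ) {d : ℕ} (hd : d < 3) (hr : s.rem = 3 - d)
    (ht : s.tmp = 0) :
    Runs processDigit (s, μ)
      ({ s with
          dG := s.quo, quo := 0, rem := 0
          dA := if d = 1 ∧ s.dA = 0 then s.dW else s.dA
          dT := if d ≠ 1 ∧ s.dT = 0 then s.dW else s.dT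
          tmp := if d = 1 then s.dS else 0 }, μ) 50 := by
  refine runs_of_eval_eq rfl ?_ (by decide)
  obtain ⟨⟩ := s
  simp only at hr ht
  subst hr ht
  interval_cases d
  all_goals
    simp [processDigit]
    try split_ifs <;> simp_all

/-- From the number `dG` of a leaf, its index, its control and its target are computed. The index is
scaled by `dS` and added to `dI`; `dW` is the first work wire, `dJ` the depth of the tree. -/
def decode : Prog :=
  .repeat rDJ [divThree, processDigit, addTmp rDI, .copy rTmp rDS, addTmp rDS, .succ rDW]

/-- The registers after `i` rounds of `decode`. -/
def decodeState (s : Regs) (i : ℕ) : Regs :=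
  { s with
    dG := s.dG / 3 ^ i, dS := s.dS * 2 ^ i, dW := s.dW + i, dJ := s.dJ - i
    dI := s.dI + s.dS * leafIndex s.dG i
    dA := leafControl s.dW s.dG i, dT := leafTarget s.dW s.dG i }

lemma runs_decode (s : Regs) (μ : ℕ → ℕ) (hq : s.quo = 0) (hr : s.rem = 0) (ht : s.tmp = 0)
    (hA : s.dA = 0) (hT : s.dT = 0) :
    Runs decode (s, μ)
      ({ s with
          dG := s.dG / 3 ^ s.dJ, dS := s.dS * 2 ^ s.dJ, dW := s.dW + s.dJ, dJ := 0
          dI := s.dI + s.dS * leafIndex s.dG s.dJ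
          dA := leafControl s.dW s.dG s.dJ, dT := leafTarget s.dW s.dG s.dJ }, μ)
      (s.dJ * (20 * s.dG + 16 * (s.dS * 2 ^ s.dJ) + 100) + 1) := by
  refine (Runs.repeat (fun i => (decodeState s i, μ))
    (N := s.dJ) (B := 20 * s.dG + 16 * (s.dS * 2 ^ s.dJ) + 99)
    (by obtain ⟨⟩ := s; simp_all [decodeState, leafIndex, leafControl, leafTarget])
    (by simp [decodeState]) (fun i hi => by simp [decodeState]; omega)
    (by simp [decodeState]) (fun i hi => ?_)).mono le_rfl
  have h1 : Runs (.pred rDJ) (decodeState s i, μ)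
      ({ decodeState s i with dJ := s.dJ - i - 1 }, μ) 1 := runs_of_eval_eq rfl rfl le_rfl
  have h2 := runs_divThree { decodeState s i with dJ := s.dJ - i - 1 } μ hq
  have h3 := runs_processDigit { decodeState s i with
    dJ := s.dJ - i - 1, dG := 0, quo := s.dG / 3 ^ i / 3, rem := 3 - s.dG / 3 ^ i % 3 } μ
    (Nat.mod_lt (s.dG / 3 ^ i) (by norm_num : 3 > 0)) rfl ht
  have h4 := runs_addTmp (x := rDI) (by decide) { decodeState s i with
    dJ := s.dJ - i - 1, dG := s.dG / 3 ^ i / 3, quo := 0, rem := 0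
    dA := leafControl s.dW s.dG (i + 1), dT := leafTarget s.dW s.dG (i + 1)
    tmp := if s.dG / 3 ^ i % 3 = 1 then s.dS * 2 ^ i else 0 } μ
  have h5 : Runs (.copy rTmp rDS) _ _ 1 := runs_of_eval_eq (s := ({ decodeState s i with
    dJ := s.dJ - i - 1, dG := s.dG / 3 ^ i / 3, quo := 0, rem := 0
    dA := leafControl s.dW s.dG (i + 1), dT := leafTarget s.dW s.dG (i + 1)
    dI := (s.dI + s.dS * leafIndex s.dG i) + if s.dG / 3 ^ i % 3 = 1 then s.dS * 2 ^ i else 0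
    tmp := 0 }, μ)) rfl rfl le_rfl
  have h6 := runs_addTmp (x := rDS) (by decide) { decodeState s i with
    dJ := s.dJ - i - 1, dG := s.dG / 3 ^ i / 3, quo := 0, rem := 0
    dA := leafControl s.dW s.dG (i + 1), dT := leafTarget s.dW s.dG (i + 1)
    dI := (s.dI + s.dS * leafIndex s.dG i) + if s.dG / 3 ^ i % 3 = 1 then s.dS * 2 ^ i else 0
    tmp := s.dS * 2 ^ i } μ
  have h7 : Runs (.succ rDW) _ (decodeState s (i + 1), μ) 1 :=
    runs_of_eval_eq (s := ({ decodeState s i with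
      dJ := s.dJ - i - 1, dG := s.dG / 3 ^ i / 3, quo := 0, rem := 0
      dA := leafControl s.dW s.dG (i + 1), dT := leafTarget s.dW s.dG (i + 1)
      dI := (s.dI + s.dS * leafIndex s.dG i) + if s.dG / 3 ^ i % 3 = 1 then s.dS * 2 ^ i else 0
      dS := s.dS * 2 ^ i + s.dS * 2 ^ i
      tmp := 0 }, μ)) rfl (by
        obtain ⟨⟩ := s
        simp only at hq hr ht
        subst hq hr ht
        simp [decodeState, leafIndex, pow_succ, Nat.div_div_eq_div_mul, Nat.add_assoc, mul_two,
          Nat.mul_add, Nat.sub_sub, mul_ite]) le_rfl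
  refine (h1.cons (h2.cons (h3.cons (h4.cons (h5.cons (h6.cons (h7.cons (Runs.nil _)))))))).mono ?_
  have e1 : s.dG / 3 ^ i ≤ s.dG := Nat.div_le_self _ _
  have e2 : s.dS * 2 ^ i ≤ s.dS * 2 ^ s.dJ :=
    Nat.mul_le_mul_left _ (Nat.pow_le_pow_right (by norm_num) hi.le)
  have e3 : (if s.dG / 3 ^ i % 3 = 1 then s.dS * 2 ^ i else 0) ≤ s.dS * 2 ^ s.dJ := by
    split_ifs
    exacts [e2, Nat.zero_le _]
  simp only [decodeState]
  omega

/-! ### Writing gates -/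

/-- A memory that holds the word `pre`, followed by the encodings of the gates `gs`. -/
def genMem (pre : List ℕ) (gs : List (Gate ℕ)) : ℕ → ℕ :=
  fun i => (pre ++ gs.flatMap natEncode).getD i 0

/-- The store after the gates `gs` have been written behind the word `pre`. -/
def emitted (s : Regs) (pre : List ℕ) (gs : List (Gate ℕ)) : Store :=
  ({ s with wp := pre.length + 4 * gs.length, cnt := gs.length }, genMem pre gs)

lemma update_getD_length (l : List ℕ) (v : ℕ) :
    Function.update (fun i => l.getD i 0) l.length v = fun i => (l ++ [v]).getD i 0 := by
  funext i
  rcases lt_trichotomy i l.length with h | h | h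
  · rw [Function.update_of_ne h.ne]
    simp [List.getD_eq_getElem?_getD, List.getElem?_append_left h]
  · subst h; simp
  · rw [Function.update_of_ne h.ne']
    simp only [List.getD_eq_getElem?_getD]
    rw [List.getElem?_eq_none h.le, List.getElem?_eq_none (by simp; omega)]

/-- Write the gate described by `e0`, …, `e3`, and clear these registers. -/
def emit : Prog :=
  .block [.store rWp rE0, .succ rWp, .store rWp rE1, .succ rWp, .store rWp rE2, .succ rWp,
    .store rWp rE3, .succ rWp, .succ rCnt, .const rE0 0, .const rE1 0, .const rE2 0, .const rE3 0]

lemma runs_emit (s : Regs) (pre : List ℕ) (gs : List (Gate ℕ)) {g : Gate ℕ}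
    (hg : natEncode g = [s.e0, s.e1, s.e2, s.e3]) :
    Runs emit (emitted s pre gs)
      (emitted { s with e0 := 0, e1 := 0, e2 := 0, e3 := 0 } pre (gs ++ [g])) 30 := by
  refine runs_of_eval_eq rfl ?_ (by decide)
  have hl : (pre ++ gs.flatMap natEncode).length = pre.length + 4 * gs.length := by
    rw [List.length_append, length_flatMap_natEncode]
  have hm : genMem pre (gs ++ [g]) = fun i =>
      ((((pre ++ gs.flatMap natEncode) ++ [s.e0]) ++ [s.e1] ++ [s.e2]) ++ [s.e3]).getD i 0 := by
    funext i
    simp only [genMem, List.flatMap_append, List.flatMap_cons, List.flatMap_nil, hg,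
      List.append_nil, List.append_assoc, List.cons_append, List.nil_append]
  have hm' : genMem pre (gs ++ [g]) = Function.update (Function.update (Function.update
      (Function.update (genMem pre gs) (pre.length + 4 * gs.length) s.e0)
      (pre.length + 4 * gs.length + 1) s.e1) (pre.length + 4 * gs.length + 1 + 1) s.e2)
      (pre.length + 4 * gs.length + 1 + 1 + 1) s.e3 := by
    rw [hm]
    simp only [← update_getD_length, List.length_append, List.length_singleton]
    rw [← List.length_append, hl]
    rfl
  simp only [emitted, hm']
  simp [emit]
  omega

/-- If `y` is not zero, copy it to `x`, and otherwise copy `z` to `x`. -/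
def select (x y z : ℕ) : Prog := .ite y (.copy x y) (.copy x z)

@[simp] lemma eval_select (x y z : ℕ) (s : Store) :
    (select x y z).eval s = (s.1.set x (orElse (s.1.get y) (s.1.get z)), s.2) := by
  by_cases h : s.1.get y = 0
  · rw [select, Prog.eval, if_neg (not_not.2 h), orElse, if_pos h]; rfl
  · rw [select, Prog.eval, if_pos h, orElse, if_neg h]; rfl

/-- Write the two gates for one variable of a clause. The codes of `CNOT` and `TOFFOLI` are `3` and
`4`. -/
def emitLiteral : Prog :=
  .block
    [.block [.const rE0 3, .copy rE1 rA', .ite rNeg (.copy rE1 rT') .skip, .copy rE2 rT'],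
    emit,
    .block [.ite rPos (.ite rNeg (.const rTmp 1) (.const rTmp 0))
        (.ite rNeg (.const rTmp 0) (.const rTmp 1)),
      .ite rTmp (.block [.const rE0 3, .copy rE1 rT', .copy rE2 rT'])
        (.block [.const rE0 4, .copy rE1 rA', .copy rE2 rV, .copy rE3 rT']),
      .const rTmp 0],
    emit]

lemma runs_emitLiteral (s : Regs) (pre : List ℕ) (gs : List (Gate ℕ)) (p : Bool × Bool)
    (hpos : s.pos = p.1.toNat) (hneg : s.neg = p.2.toNat) (h3 : s.e3 = 0) :
    Runs emitLiteral (emitted s pre gs)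
      (emitted { s with e0 := 0, e1 := 0, e2 := 0, e3 := 0, tmp := 0 } pre
        (gs ++ literalGates p s.v (some s.a') s.t')) 130 := by
  have h1 : Runs (.block [.const rE0 3, .copy rE1 rA', .ite rNeg (.copy rE1 rT') .skip,
      .copy rE2 rT']) (emitted s pre gs)
      (emitted { s with e0 := 3, e1 := if p.2 then s.t' else s.a', e2 := s.t' } pre gs) 20 := by
    refine runs_of_eval_eq rfl ?_ (by decide)
    cases hp : p.2 <;> simp [emitted, hneg, hp]
  have h2 := runs_emit { s with e0 := 3, e1 := if p.2 then s.t' else s.a', e2 := s.t' } pre gs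
    (g := if p.2 then .CNOT s.t' s.t' else cnotOpt (some s.a') s.t')
    (by cases p.2 <;> simp [natEncode, cnotOpt, h3])
  set gs' := gs ++ [if p.2 then .CNOT s.t' s.t' else cnotOpt (some s.a') s.t']
  have h4 : Runs (.block [.ite rPos (.ite rNeg (.const rTmp 1) (.const rTmp 0))
      (.ite rNeg (.const rTmp 0) (.const rTmp 1)),
    .ite rTmp (.block [.const rE0 3, .copy rE1 rT', .copy rE2 rT'])
      (.block [.const rE0 4, .copy rE1 rA', .copy rE2 rV, .copy rE3 rT']),
    .const rTmp 0]) (emitted { s with e0 := 0, e1 := 0, e2 := 0, e3 := 0 } pre gs')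
      (emitted { s with
        e0 := if p.1 = p.2 then 3 else 4, e1 := if p.1 = p.2 then s.t' else s.a'
        e2 := if p.1 = p.2 then s.t' else s.v, e3 := if p.1 = p.2 then 0 else s.t'
        tmp := 0 } pre gs') 40 := by
    refine runs_of_eval_eq rfl ?_ (by decide)
    cases hp : p.1 <;> cases hp' : p.2 <;> simp [emitted, hneg, hpos, hp, hp']
  have h5 := runs_emit { s with
        e0 := if p.1 = p.2 then 3 else 4, e1 := if p.1 = p.2 then s.t' else s.a'
        e2 := if p.1 = p.2 then s.t' else s.v, e3 := if p.1 = p.2 then 0 else s.t'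
        tmp := 0 } pre gs'
    (g := if p.1 = p.2 then .CNOT s.t' s.t' else toffoliOpt (some s.a') s.v s.t')
    (by by_cases h : p.1 = p.2 <;> simp [natEncode, toffoliOpt, h])
  refine ((h1.cons (h2.cons (h4.cons (h5.cons (Runs.nil _))))).of_eq ?_).mono (by omega)
  simp [gs', literalGates]

/-! ### The main loops of the reduction -/

/-- The registers while gates are written; all temporary registers are zero. The wires are numbered
as in `formulaList`. -/
def workState (len n D g gc h hc ptr a t val : ℕ) : Regs where
  len := len
  n := n
  depth := D
  pow := 3 ^ D
  out := n + 1 + D + D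
  b1 := n + 1
  b2 := n + 1 + D
  n2 := n + n
  wp := 0
  cnt := 0
  e0 := 0
  e1 := 0
  e2 := 0
  e3 := 0
  g := g
  gc := gc
  h := h
  hc := hc
  ptr := ptr
  a := a
  t := t
  val := val
  v := 0
  a' := 0
  t' := 0
  pos := 0
  neg := 0
  dG := 0
  dS := 0
  dW := 0
  dJ := 0
  dI := 0
  dA := 0
  dT := 0
  quo := 0
  rem := 0
  tmp := 0
  tmp2 := 0
  k := n + 1 + D + D + 1

/-- Write a Hadamard gate on each input wire. -/
def writeHadamards : Prog :=
  .block [.copy rGc rN,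
    .repeat rGc [.block [.const rE0 1, .copy rE1 rG], emit, .succ rG], .const rG 0]

lemma runs_writeHadamards (len n D : ℕ) (pre : List ℕ) (gs : List (Gate ℕ)) :
    Runs writeHadamards (emitted (workState len n D 0 0 0 0 0 0 0 0) pre gs)
      (emitted (workState len n D 0 0 0 0 0 0 0 0) pre (gs ++ (List.range n).map Gate.H))
      (60 * n + 10) := by
  have h1 : Runs (.copy rGc rN) (emitted (workState len n D 0 0 0 0 0 0 0 0) pre gs)
    (emitted (workState len n D 0 n 0 0 0 0 0 0) pre gs) 1 := runs_of_eval_eq rfl rfl le_rfl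
  have h2 : Runs (.repeat rGc [.block [.const rE0 1, .copy rE1 rG], emit, .succ rG])
      (emitted (workState len n D 0 n 0 0 0 0 0 0) pre gs)
      (emitted (workState len n D n 0 0 0 0 0 0 0) pre (gs ++ (List.range n).map Gate.H))
      (n * (50 + 1) + 1) := by
    refine Runs.repeat (fun i => emitted (workState len n D i (n - i) 0 0 0 0 0 0) pre
      (gs ++ (List.range i).map Gate.H)) (by simp) (by simp)
      (fun i hi => by simp [emitted, workState]; omega) (by simp [emitted, workState])
      fun i hi => ?_
    set s := workState len n D i (n - i - 1) 0 0 0 0 0 0 with hs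
    set gs' := gs ++ (List.range i).map Gate.H with hgs'
    have h1 : Runs (.pred rGc) (emitted (workState len n D i (n - i) 0 0 0 0 0 0) pre gs')
      (emitted s pre gs') 1 := runs_of_eval_eq rfl rfl le_rfl
    have h2 : Runs (.block [.const rE0 1, .copy rE1 rG]) (emitted s pre gs')
      (emitted { s with e0 := 1, e1 := i } pre gs') 10 := runs_of_eval_eq rfl rfl (by decide)
    have h3 := runs_emit { s with e0 := 1, e1 := i } pre gs' (g := .H i) rfl
    have h4 : Runs (.succ rG) (emitted s pre (gs' ++ [.H i])) (emitted
        (workState len n D (i + 1) (n - (i + 1)) 0 0 0 0 0 0) pre (gs' ++ [.H i])) 1 :=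
      runs_of_eval_eq rfl rfl le_rfl
    refine ((h1.cons (h2.cons (h3.cons (h4.cons (Runs.nil _))))).of_eq ?_).mono (by omega)
    rw [hgs', List.range_succ]
    simp
  have h3 : Runs (.const rG 0)
    (emitted (workState len n D n 0 0 0 0 0 0 0) pre (gs ++ (List.range n).map Gate.H))
    (emitted (workState len n D 0 0 0 0 0 0 0 0) pre (gs ++ (List.range n).map Gate.H)) 1 :=
    runs_of_eval_eq rfl rfl le_rfl
  exact (h1.cons (h2.cons (h3.cons (Runs.nil _)))).mono (by omega)

/-- Look up which literals of the variable `v` occur in the clause whose encoding starts at the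
address `ptr`. If `val` is zero, there is no such clause; if `tmp` is zero, there is no such
variable. -/
def readLiteral : Prog :=
  .ite rVal
    (.ite rTmp
      (.block [.block [.copy rTmp2 rPtr, .copy rTmp rV], .repeat rTmp [.succ rTmp2, .succ rTmp2],
        .block [.load rPos rTmp2, .succ rTmp2, .load rNeg rTmp2, .const rTmp2 0]])
      .skip)
    (.block [.const rPos 1, .const rNeg 1, .const rTmp 0])

lemma runs_readLiteral (s : Regs) (μ : ℕ → ℕ) (p : Bool × Bool) (h0 : s.pos = 0) (h1 : s.neg = 0)
    (h2 : s.tmp2 = 0) (hval : s.val = 0 → p = (true, true))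
    (htmp : s.val ≠ 0 → s.tmp = 0 → p = (false, false))
    (hread : s.val ≠ 0 → s.tmp ≠ 0 →
      μ (s.ptr + s.v + s.v) = p.1.toNat ∧ μ (s.ptr + s.v + s.v + 1) = p.2.toNat) :
    Runs readLiteral (s, μ) ({ s with pos := p.1.toNat, neg := p.2.toNat, tmp := 0 }, μ)
      (10 * s.v + 60) := by
  by_cases hv : s.val = 0
  · refine (Runs.ite_neg (r := rVal) (s := (s, μ)) hv
      (runs_of_eval_eq (B := 10) rfl ?_ (by decide))).mono (by omega)
    rw [hval hv]
    rfl
  · refine (Runs.ite_pos (r := rVal) (s := (s, μ)) (B := 10 * s.v + 50) hv ?_).mono (by omega)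
    by_cases ht : s.tmp = 0
    · refine (Runs.ite_neg (r := rTmp) (s := (s, μ)) ht
        (runs_of_eval_eq (B := 1) rfl ?_ (by decide))).mono (by omega)
      rw [htmp hv ht]
      obtain ⟨⟩ := s
      simp_all
    · obtain ⟨r1, r2⟩ := hread hv ht
      refine (Runs.ite_pos (r := rTmp) (s := (s, μ)) (B := 10 * s.v + 40) ht ?_).mono (by omega)
      have k1 : Runs (.block [.copy rTmp2 rPtr, .copy rTmp rV]) (s, μ)
        ({ s with tmp := s.v, tmp2 := s.ptr }, μ) 10 := runs_of_eval_eq rfl rfl (by decide)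
      have k2 : Runs (.repeat rTmp [.succ rTmp2, .succ rTmp2])
          ({ s with tmp := s.v, tmp2 := s.ptr }, μ)
          ({ s with tmp := 0, tmp2 := s.ptr + s.v + s.v }, μ) (s.v * (9 + 1) + 1) :=
        Runs.repeat (fun i => ({ s with tmp := s.v - i, tmp2 := s.ptr + i + i }, μ))
          (by simp) (by simp) (fun i hi => by simp; omega) (by simp)
          (fun i hi => runs_of_eval_eq rfl (by simp; omega) (by decide))
      have k3 : Runs (.block [.load rPos rTmp2, .succ rTmp2, .load rNeg rTmp2, .const rTmp2 0])
          ({ s with tmp := 0, tmp2 := s.ptr + s.v + s.v }, μ)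
          ({ s with pos := p.1.toNat, neg := p.2.toNat, tmp := 0 }, μ) 12 := by
        refine runs_of_eval_eq rfl ?_ (by decide)
        simp [r1, r2, h2]
      exact (k1.cons (k2.cons (k3.cons (Runs.nil _)))).mono (by omega)

/-- Write the gates of the leaf number `h` of the tree of a clause. Whether there is a variable of
the index of the leaf is told by the truncated difference of `n` and the index. -/
def writeLeaf : Prog :=
  .block
    [.block [.copy rDG rH, .const rDS 1, .copy rDW rB2, .copy rDJ rDepth],
    decode,
    .block [.copy rV rDI, select rA' rDA rA, select rT' rDT rT, .const rDG 0, .const rDS 0,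
      .const rDW 0, .const rDI 0, .const rDA 0, .const rDT 0, .copy rTmp rN, .copy rTmp2 rV],
    subTmp,
    readLiteral,
    emitLiteral,
    .block [.const rV 0, .const rA' 0, .const rT' 0, .const rPos 0, .const rNeg 0]]

/-- A bound for the running time of `writeLeaf`. -/
def leafCost (D : ℕ) : ℕ := D * (20 * 3 ^ D + 16 * 2 ^ D + 100) + 20 * 2 ^ D + 400

lemma genMem_of_lt {inp hdr : List ℕ} {gs : List (Gate ℕ)} {i : ℕ} (hi : i < inp.length) :
    genMem (inp ++ hdr) gs i = inp.getD i 0 := by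
  simp only [genMem, List.append_assoc, List.getD_eq_getElem?_getD, List.getElem?_append_left hi]

lemma runs_writeLeaf {n : ℕ} (φ : CNF n) {i : ℕ} (hdr : List ℕ) (gs : List (Gate ℕ))
    (D g gc hc a t : ℕ) {h : ℕ} (hh : h < 3 ^ D) {val : ℕ} (hval : val = 0 ↔ φ.length ≤ i) :
    Runs writeLeaf
      (emitted (workState φ.encode.length n D g gc h hc (2 + (n + n) * i) a t val)
        (φ.encode ++ hdr) gs)
      (emitted (workState φ.encode.length n D g gc h hc (2 + (n + n) * i) a t val)
        (φ.encode ++ hdr) (gs ++ literalGates (φ.literals i (leafIndex h D)) (leafIndex h D)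
          (some (orElse (leafControl (n + 1 + D) h D) a))
          (orElse (leafTarget (n + 1 + D) h D) t))) (leafCost D) := by
  set s := workState φ.encode.length n D g gc h hc (2 + (n + n) * i) a t val with hs
  set pre := φ.encode ++ hdr
  set v := leafIndex h D with hv
  set a' := orElse (leafControl (n + 1 + D) h D) a with ha'
  set t' := orElse (leafTarget (n + 1 + D) h D) t with ht'
  have hvlt : v < 2 ^ D := leafIndex_lt h D
  have h1 : Runs (.block [.copy rDG rH, .const rDS 1, .copy rDW rB2, .copy rDJ rDepth])
    (emitted s pre gs) (emitted { s with dG := h, dS := 1, dW := n + 1 + D, dJ := D } pre gs) 12 :=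
    runs_of_eval_eq rfl rfl (by decide)
  have h2 : Runs decode (emitted { s with dG := h, dS := 1, dW := n + 1 + D, dJ := D } pre gs)
      (emitted { s with
        dG := h / 3 ^ D, dS := 1 * 2 ^ D, dW := n + 1 + D + D, dJ := 0, dI := 0 + 1 * v
        dA := leafControl (n + 1 + D) h D, dT := leafTarget (n + 1 + D) h D } pre gs)
      (D * (20 * h + 16 * (1 * 2 ^ D) + 100) + 1) := runs_decode _ _ rfl rfl rfl rfl rfl
  have h3 : Runs (.block [.copy rV rDI, select rA' rDA rA, select rT' rDT rT, .const rDG 0,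
      .const rDS 0, .const rDW 0, .const rDI 0, .const rDA 0, .const rDT 0, .copy rTmp rN,
      .copy rTmp2 rV])
      (emitted { s with
        dG := h / 3 ^ D, dS := 1 * 2 ^ D, dW := n + 1 + D + D, dJ := 0, dI := 0 + 1 * v
        dA := leafControl (n + 1 + D) h D, dT := leafTarget (n + 1 + D) h D } pre gs)
      (emitted { s with v := v, a' := a', t' := t', tmp := n, tmp2 := v } pre gs) 40 := by
    refine runs_of_eval_eq rfl ?_ (by decide)
    simp [emitted, hs, workState, ha', ht']
  have h4 : Runs subTmp
      (emitted { s with v := v, a' := a', t' := t', tmp := n, tmp2 := v } pre gs)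
      (emitted { s with v := v, a' := a', t' := t', tmp := n - v } pre gs) (8 * v + 1) :=
    runs_subTmp _ _
  have h5 : Runs readLiteral (emitted { s with v := v, a' := a', t' := t', tmp := n - v } pre gs)
      (emitted { s with
        v := v, a' := a', t' := t'
        pos := (φ.literals i v).1.toNat, neg := (φ.literals i v).2.toNat, tmp := 0 } pre gs)
      (10 * v + 60) := by
    refine runs_readLiteral _ _ (φ.literals i v) rfl rfl rfl (fun h0 => ?_) (fun h0 h1 => ?_)
      (fun h0 h1 => ?_)
    · have : φ.length ≤ i := hval.1 h0
      simp [CNF.literals, List.getElem?_eq_none this]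
    · have h1 : n - v = 0 := h1
      have h0 : ¬ φ.length ≤ i := fun h => h0 (hval.2 h)
      rw [CNF.literals, List.getElem?_eq_getElem (by omega)]
      simp only
      rw [dif_neg (by omega)]
    · have h1 : n - v ≠ 0 := h1
      have h0 : ¬ φ.length ≤ i := fun h => h0 (hval.2 h)
      have hr := φ.getD_encode (i := i) (v := v) (by omega) (by omega)
      have hlen : 2 + 2 * n * i + v + v + 1 < φ.encode.length := by
        rw [CNF.length_encode]
        have : 2 * n * (i + 1) ≤ 2 * n * φ.length := Nat.mul_le_mul_left _ (by omega)
        rw [Nat.mul_add] at this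
        omega
      rw [← genMem_of_lt (hdr := hdr) (gs := gs) (by omega), ← genMem_of_lt (hdr := hdr) (gs := gs)
        hlen, two_mul n] at hr
      exact hr
  have h6 := runs_emitLiteral { s with
    v := v, a' := a', t' := t'
    pos := (φ.literals i v).1.toNat, neg := (φ.literals i v).2.toNat, tmp := 0 } pre gs
    (φ.literals i v) rfl rfl rfl
  set gs' := gs ++ literalGates (φ.literals i v) v (some a') t' with hgs'
  have h7 : Runs (.block [.const rV 0, .const rA' 0, .const rT' 0, .const rPos 0, .const rNeg 0])
    (emitted { s with
      v := v, a' := a', t' := t'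
      pos := (φ.literals i v).1.toNat, neg := (φ.literals i v).2.toNat } pre gs')
    (emitted s pre gs') 14 := runs_of_eval_eq rfl rfl (by decide)
  refine (h1.cons (h2.cons (h3.cons (h4.cons (h5.cons (h6.cons (h7.cons (Runs.nil _)))))))).mono ?_
  have e1 : D * (20 * h + 16 * (1 * 2 ^ D) + 100) ≤ D * (20 * 3 ^ D + 16 * 2 ^ D + 100) :=
    Nat.mul_le_mul_left _ (by omega)
  simp only [leafCost]
  omega

/-- Write the gates of the clause that belongs to the leaf number `g` of the tree of the
formula. The scale `2 * n` and the offset `2` make `decode` compute the address of the clause,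
and the truncated difference of the length of the input and this address tells whether
there is such a clause. -/
def writeClause : Prog :=
  .block
    [.block [.copy rDG rG, .copy rDS rN2, .copy rDW rB1, .copy rDJ rDepth, .const rDI 2],
    decode,
    .block [.copy rPtr rDI, select rA rDA rN, select rT rDT rOut, .const rDG 0, .const rDS 0,
      .const rDW 0, .const rDI 0, .const rDA 0, .const rDT 0, .const rE0 3, .copy rE1 rA,
      .copy rE2 rT],
    emit,
    .block [.copy rTmp rLen, .copy rTmp2 rPtr],
    subTmp,
    .block [.copy rVal rTmp, .const rTmp 0, .copy rHc rPow],
    .repeat rHc [writeLeaf, .succ rH],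
    .block [.const rH 0, .const rPtr 0, .const rA 0, .const rT 0, .const rVal 0]]

/-- A bound for the running time of `writeClause`. -/
def clauseCost (n D : ℕ) : ℕ :=
  D * (20 * 3 ^ D + 16 * ((n + n) * 2 ^ D) + 100) + 8 * ((n + n) * 2 ^ D)
    + 3 ^ D * (leafCost D + 10) + 400

/-- Without variables, clauses have empty encodings, and their number cannot be told from the length
of the input; hence the assumption `hn`. -/
lemma runs_writeClause {n : ℕ} (φ : CNF n) (hn : n = 0 → φ = []) (hdr : List ℕ)
    (gs : List (Gate ℕ)) (D gc : ℕ) {g : ℕ} (hg : g < 3 ^ D) :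
    Runs writeClause
      (emitted (workState φ.encode.length n D g gc 0 0 0 0 0 0) (φ.encode ++ hdr) gs)
      (emitted (workState φ.encode.length n D g gc 0 0 0 0 0 0) (φ.encode ++ hdr)
        (gs ++ clauseList n D (φ.literals (leafIndex g D)) (orElse (leafControl (n + 1) g D) n)
          (orElse (leafTarget (n + 1) g D) (n + 1 + D + D)))) (clauseCost n D) := by
  set len := φ.encode.length with hlen
  set pre := φ.encode ++ hdr
  set s := workState len n D g gc 0 0 0 0 0 0 with hs
  set i := leafIndex g D with hi
  set a := orElse (leafControl (n + 1) g D) n with ha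
  set t := orElse (leafTarget (n + 1) g D) (n + 1 + D + D) with ht
  have hilt : i < 2 ^ D := leafIndex_lt g D
  set val := len - (2 + (n + n) * i) with hval
  have hval0 : val = 0 ↔ φ.length ≤ i := by
    rw [hval, hlen, CNF.length_encode, two_mul]
    rcases Nat.eq_zero_or_pos n with h0 | h0
    · simp [h0, hn h0]
    · constructor
      · intro h
        have : (n + n) * φ.length ≤ (n + n) * i := by omega
        exact Nat.le_of_mul_le_mul_left this (by omega)
      · intro h
        have : (n + n) * φ.length ≤ (n + n) * i := Nat.mul_le_mul_left _ h
        omega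
  have h1 : Runs (.block [.copy rDG rG, .copy rDS rN2, .copy rDW rB1, .copy rDJ rDepth,
      .const rDI 2]) (emitted s pre gs)
      (emitted { s with dG := g, dS := n + n, dW := n + 1, dJ := D, dI := 2 } pre gs) 15 :=
    runs_of_eval_eq rfl rfl (by decide)
  have h2 : Runs decode
      (emitted { s with dG := g, dS := n + n, dW := n + 1, dJ := D, dI := 2 } pre gs)
      (emitted { s with
        dG := g / 3 ^ D, dS := (n + n) * 2 ^ D, dW := n + 1 + D, dJ := 0, dI := 2 + (n + n) * i
        dA := leafControl (n + 1) g D, dT := leafTarget (n + 1) g D } pre gs)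
      (D * (20 * g + 16 * ((n + n) * 2 ^ D) + 100) + 1) := runs_decode _ _ rfl rfl rfl rfl rfl
  have h3 : Runs (.block [.copy rPtr rDI, select rA rDA rN, select rT rDT rOut, .const rDG 0,
      .const rDS 0, .const rDW 0, .const rDI 0, .const rDA 0, .const rDT 0, .const rE0 3,
      .copy rE1 rA, .copy rE2 rT])
      (emitted { s with
        dG := g / 3 ^ D, dS := (n + n) * 2 ^ D, dW := n + 1 + D, dJ := 0, dI := 2 + (n + n) * i
        dA := leafControl (n + 1) g D, dT := leafTarget (n + 1) g D } pre gs)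
      (emitted { s with ptr := 2 + (n + n) * i, a := a, t := t, e0 := 3, e1 := a, e2 := t }
        pre gs) 40 := by
    refine runs_of_eval_eq rfl ?_ (by decide)
    simp [emitted, hs, workState, ha, ht]
  have h4 := runs_emit
    { s with ptr := 2 + (n + n) * i, a := a, t := t, e0 := 3, e1 := a, e2 := t } pre gs
    (g := .CNOT a t) rfl
  set gs' := gs ++ [.CNOT a t] with hgs'
  have h5 : Runs (.block [.copy rTmp rLen, .copy rTmp2 rPtr])
      (emitted { s with ptr := 2 + (n + n) * i, a := a, t := t } pre gs')
      (emitted { s with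
        ptr := 2 + (n + n) * i, a := a, t := t, tmp := len, tmp2 := 2 + (n + n) * i } pre gs') 10 :=
    runs_of_eval_eq rfl rfl (by decide)
  have h6 : Runs subTmp (emitted { s with
        ptr := 2 + (n + n) * i, a := a, t := t, tmp := len, tmp2 := 2 + (n + n) * i } pre gs')
      (emitted { s with ptr := 2 + (n + n) * i, a := a, t := t, tmp := val } pre gs')
      (8 * (2 + (n + n) * i) + 1) := runs_subTmp _ _
  have h7 : Runs (.block [.copy rVal rTmp, .const rTmp 0, .copy rHc rPow])
      (emitted { s with ptr := 2 + (n + n) * i, a := a, t := t, tmp := val } pre gs')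
      (emitted (workState len n D g gc 0 (3 ^ D) (2 + (n + n) * i) a t val) pre gs') 10 :=
    runs_of_eval_eq rfl rfl (by decide)
  set F : ℕ → List (Gate ℕ) := fun h => literalGates (φ.literals i (leafIndex h D)) (leafIndex h D)
    (some (orElse (leafControl (n + 1 + D) h D) a)) (orElse (leafTarget (n + 1 + D) h D) t) with hF
  have h8 : Runs (.repeat rHc [writeLeaf, .succ rH])
      (emitted (workState len n D g gc 0 (3 ^ D) (2 + (n + n) * i) a t val) pre gs')
      (emitted (workState len n D g gc (3 ^ D) 0 (2 + (n + n) * i) a t val) pre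
        (gs' ++ (List.range (3 ^ D)).flatMap F)) (3 ^ D * ((leafCost D + 6) + 1) + 1) := by
    refine Runs.repeat (fun h => emitted (workState len n D g gc h (3 ^ D - h) (2 + (n + n) * i)
      a t val) pre (gs' ++ (List.range h).flatMap F)) (by simp) (by simp)
      (fun h hh => by simp [emitted, workState]; omega) (by simp [emitted, workState])
      fun h hh => ?_
    set gs'' := gs' ++ (List.range h).flatMap F with hgs''
    have k1 : Runs (.pred rHc)
      (emitted (workState len n D g gc h (3 ^ D - h) (2 + (n + n) * i) a t val) pre gs'')
      (emitted (workState len n D g gc h (3 ^ D - h - 1) (2 + (n + n) * i) a t val) pre gs'') 1 :=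
      runs_of_eval_eq rfl rfl le_rfl
    have k2 := runs_writeLeaf φ hdr gs'' D g gc (3 ^ D - h - 1) a t hh hval0
    have k3 : Runs (.succ rH)
      (emitted (workState len n D g gc h (3 ^ D - h - 1) (2 + (n + n) * i) a t val) pre
        (gs'' ++ F h))
      (emitted (workState len n D g gc (h + 1) (3 ^ D - (h + 1)) (2 + (n + n) * i) a t val) pre
        (gs'' ++ F h)) 1 := runs_of_eval_eq rfl rfl le_rfl
    refine ((k1.cons (k2.cons (k3.cons (Runs.nil _)))).of_eq ?_).mono (by omega)
    rw [hgs'', List.range_succ]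
    simp
  have h9 : Runs (.block [.const rH 0, .const rPtr 0, .const rA 0, .const rT 0, .const rVal 0])
      (emitted (workState len n D g gc (3 ^ D) 0 (2 + (n + n) * i) a t val) pre
        (gs' ++ (List.range (3 ^ D)).flatMap F))
      (emitted s pre (gs' ++ (List.range (3 ^ D)).flatMap F)) 15 :=
    runs_of_eval_eq rfl rfl (by decide)
  refine ((h1.cons (h2.cons (h3.cons (h4.cons (h5.cons (h6.cons (h7.cons (h8.cons
    (h9.cons (Runs.nil _)))))))))).of_eq ?_).mono ?_
  · rw [hgs', clauseList]
    simp
    rfl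
  · have e1 : D * (20 * g + 16 * ((n + n) * 2 ^ D) + 100)
        ≤ D * (20 * 3 ^ D + 16 * ((n + n) * 2 ^ D) + 100) := Nat.mul_le_mul_left _ (by omega)
    have e2 : (n + n) * i ≤ (n + n) * 2 ^ D := Nat.mul_le_mul_left _ hilt.le
    have e3 : 3 ^ D * ((leafCost D + 6) + 1) ≤ 3 ^ D * (leafCost D + 10) :=
      Nat.mul_le_mul_left _ (by omega)
    simp only [clauseCost]
    omega

/-- Write the gates of the tree of the formula. -/
def writeFormula : Prog :=
  .block [.copy rGc rPow, .repeat rGc [writeClause, .succ rG], .const rG 0]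

lemma runs_writeFormula {n : ℕ} (φ : CNF n) (hn : n = 0 → φ = []) (hdr : List ℕ)
    (gs : List (Gate ℕ)) (D : ℕ) :
    Runs writeFormula
      (emitted (workState φ.encode.length n D 0 0 0 0 0 0 0 0) (φ.encode ++ hdr) gs)
      (emitted (workState φ.encode.length n D 0 0 0 0 0 0 0 0) (φ.encode ++ hdr)
        (gs ++ formulaList n D φ.literals)) (3 ^ D * (clauseCost n D + 10) + 10) := by
  set len := φ.encode.length with hlen
  set pre := φ.encode ++ hdr
  set F : ℕ → List (Gate ℕ) := fun g => clauseList n D (φ.literals (leafIndex g D))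
    (orElse (leafControl (n + 1) g D) n) (orElse (leafTarget (n + 1) g D) (n + 1 + D + D)) with hF
  have h1 : Runs (.copy rGc rPow) (emitted (workState len n D 0 0 0 0 0 0 0 0) pre gs)
    (emitted (workState len n D 0 (3 ^ D) 0 0 0 0 0 0) pre gs) 1 := runs_of_eval_eq rfl rfl le_rfl
  have h2 : Runs (.repeat rGc [writeClause, .succ rG])
      (emitted (workState len n D 0 (3 ^ D) 0 0 0 0 0 0) pre gs)
      (emitted (workState len n D (3 ^ D) 0 0 0 0 0 0 0) pre
        (gs ++ (List.range (3 ^ D)).flatMap F)) (3 ^ D * ((clauseCost n D + 6) + 1) + 1) := by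
    refine Runs.repeat (fun g => emitted (workState len n D g (3 ^ D - g) 0 0 0 0 0 0) pre
      (gs ++ (List.range g).flatMap F)) (by simp) (by simp)
      (fun h hh => by simp [emitted, workState]; omega) (by simp [emitted, workState])
      fun g hg => ?_
    set gs' := gs ++ (List.range g).flatMap F with hgs'
    have k1 : Runs (.pred rGc)
      (emitted (workState len n D g (3 ^ D - g) 0 0 0 0 0 0) pre gs')
      (emitted (workState len n D g (3 ^ D - g - 1) 0 0 0 0 0 0) pre gs') 1 :=
      runs_of_eval_eq rfl rfl le_rfl
    have k2 := runs_writeClause φ hn hdr gs' D (3 ^ D - g - 1) hg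
    have k3 : Runs (.succ rG)
      (emitted (workState len n D g (3 ^ D - g - 1) 0 0 0 0 0 0) pre (gs' ++ F g))
      (emitted (workState len n D (g + 1) (3 ^ D - (g + 1)) 0 0 0 0 0 0) pre
        (gs' ++ F g)) 1 := runs_of_eval_eq rfl rfl le_rfl
    refine ((k1.cons (k2.cons (k3.cons (Runs.nil _)))).of_eq ?_).mono (by omega)
    rw [hgs', List.range_succ]
    simp
  have h3 : Runs (.const rG 0)
    (emitted (workState len n D (3 ^ D) 0 0 0 0 0 0 0) pre (gs ++ (List.range (3 ^ D)).flatMap F))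
    (emitted (workState len n D 0 0 0 0 0 0 0 0) pre (gs ++ (List.range (3 ^ D)).flatMap F)) 1 :=
    runs_of_eval_eq rfl rfl le_rfl
  refine (h1.cons (h2.cons (h3.cons (Runs.nil _)))).mono ?_
  have e3 : 3 ^ D * ((clauseCost n D + 6) + 1) ≤ 3 ^ D * (clauseCost n D + 10) :=
    Nat.mul_le_mul_left _ (by omega)
  omega

/-- Write an `X` gate on the wire whose number is in the register `r`. -/
def writeX (r : ℕ) : Prog := .block [.copy rE1 r, emit]

lemma runs_writeX (len n D : ℕ) (pre : List ℕ) (gs : List (Gate ℕ)) :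
    Runs (writeX rN) (emitted (workState len n D 0 0 0 0 0 0 0 0) pre gs)
      (emitted (workState len n D 0 0 0 0 0 0 0 0) pre (gs ++ [.X n])) 40 ∧
    Runs (writeX rOut) (emitted (workState len n D 0 0 0 0 0 0 0 0) pre gs)
      (emitted (workState len n D 0 0 0 0 0 0 0 0) pre (gs ++ [.X (n + 1 + D + D)])) 40 := by
  set s := workState len n D 0 0 0 0 0 0 0 0
  have h1 : Runs (.copy rE1 rN) (emitted s pre gs) (emitted { s with e1 := n } pre gs) 1 :=
    runs_of_eval_eq rfl rfl le_rfl
  have h2 := runs_emit { s with e1 := n } pre gs (g := .X n) rfl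
  have h3 : Runs (.copy rE1 rOut) (emitted s pre gs)
    (emitted { s with e1 := n + 1 + D + D } pre gs) 1 := runs_of_eval_eq rfl rfl le_rfl
  have h4 := runs_emit { s with e1 := n + 1 + D + D } pre gs (g := .X (n + 1 + D + D)) rfl
  exact ⟨(h1.cons (h2.cons (Runs.nil _))).mono (by omega),
    (h3.cons (h4.cons (Runs.nil _))).mono (by omega)⟩

/-- Write all gates of the circuit of the reduction. -/
def writeSandwich : Prog :=
  .block [writeHadamards, writeX rN, writeFormula, writeX rN, writeHadamards, writeX rOut]

lemma runs_writeSandwich {n : ℕ} (φ : CNF n) (hn : n = 0 → φ = []) (hdr : List ℕ) (D : ℕ) :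
    Runs writeSandwich
      (emitted (workState φ.encode.length n D 0 0 0 0 0 0 0 0) (φ.encode ++ hdr) [])
      (emitted (workState φ.encode.length n D 0 0 0 0 0 0 0 0) (φ.encode ++ hdr)
        (sandwichList n D φ.literals))
      (120 * n + 3 ^ D * (clauseCost n D + 10) + 200) := by
  have h1 := runs_writeHadamards φ.encode.length n D (φ.encode ++ hdr) []
  have h2 := (runs_writeX φ.encode.length n D (φ.encode ++ hdr)
    ([] ++ (List.range n).map Gate.H)).1
  have h3 := runs_writeFormula φ hn hdr ([] ++ (List.range n).map Gate.H ++ [Gate.X n]) D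
  have h4 := (runs_writeX φ.encode.length n D (φ.encode ++ hdr)
    ([] ++ (List.range n).map Gate.H ++ [Gate.X n] ++ formulaList n D φ.literals)).1
  have h5 := runs_writeHadamards φ.encode.length n D (φ.encode ++ hdr)
    ([] ++ (List.range n).map Gate.H ++ [Gate.X n] ++ formulaList n D φ.literals ++ [Gate.X n])
  have h6 := (runs_writeX φ.encode.length n D (φ.encode ++ hdr)
    ([] ++ (List.range n).map Gate.H ++ [Gate.X n] ++ formulaList n D φ.literals ++ [Gate.X n]
      ++ (List.range n).map Gate.H)).2
  exact (h1.cons (h2.cons (h3.cons (h4.cons (h5.cons (h6.cons (Runs.nil _))))))).mono (by omega)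

/-! ### Set-up and clean-up of the reduction -/

/-- The registers while the depth of the trees is computed, and at the beginning and the end of the
reduction. -/
def setupState (len n depth pow dG : ℕ) : Regs where
  len := len
  n := n
  depth := depth
  pow := pow
  out := 0
  b1 := 0
  b2 := 0
  n2 := 0
  wp := 0
  cnt := 0
  e0 := 0
  e1 := 0
  e2 := 0
  e3 := 0
  g := 0
  gc := 0
  h := 0
  hc := 0
  ptr := 0
  a := 0
  t := 0
  val := 0
  v := 0
  a' := 0
  t' := 0
  pos := 0
  neg := 0
  dG := dG
  dS := 0
  dW := 0
  dJ := 0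
  dI := 0
  dA := 0
  dT := 0
  quo := 0
  rem := 0
  tmp := 0
  tmp2 := 0
  k := 0

/-- Halve `tmp`; the quotient goes to `quo`. -/
def halve : Prog := .repeat rTmp [.ite rTmp (.block [.pred rTmp, .succ rQuo]) .skip]

lemma runs_halve (s : Regs) (μ : ℕ → ℕ) (hq : s.quo = 0) :
    Runs halve (s, μ) ({ s with tmp := 0, quo := s.tmp / 2 }, μ) (15 * s.tmp + 20) := by
  refine (Runs.repeat (fun i => ({ s with tmp := s.tmp - 2 * i, quo := min i (s.tmp / 2) }, μ))
    (N := (s.tmp + 1) / 2) (B := 14) (by obtain ⟨⟩ := s; simp_all) ?_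
    (fun i hi => by simp; omega) (by simp; omega)
    (fun i hi => runs_of_eval_eq rfl ?_ (by decide))).mono (by omega)
  · simp only [Prod.mk.injEq, Regs.mk.injEq, and_true, true_and]
    omega
  · simp only [Prog.block, Prog.eval, Regs.set, Regs.get, Regs.toList, List.getD_cons_succ,
      List.getD_cons_zero]
    split_ifs with h <;> simp only [Prod.mk.injEq, Regs.mk.injEq, and_true, true_and] <;> omega

/-- Compute the bit length of `dG` and the power of three with this exponent. -/
def computeDepth : Prog :=
  .loop rDG (.block [.copy rTmp rDG, halve,
    .block [.copy rDG rQuo, .const rQuo 0, .succ rDepth, .copy rTmp rPow, .copy rTmp2 rPow],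
    addTmp rPow, .copy rTmp rTmp2, addTmp rPow, .const rTmp2 0])

lemma runs_computeDepth (len n : ℕ) (μ : ℕ → ℕ) :
    Runs computeDepth (setupState len n 0 1 len, μ)
      (setupState len n len.size (3 ^ len.size) 0, μ)
      (len.size * (15 * len + 16 * 3 ^ len.size + 100) + 1) := by
  have h := Runs.loop (r := rDG) (P := .block [.copy rTmp rDG, halve,
    .block [.copy rDG rQuo, .const rQuo 0, .succ rDepth, .copy rTmp rPow, .copy rTmp2 rPow],
    addTmp rPow, .copy rTmp rTmp2, addTmp rPow, .const rTmp2 0])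
    (fun i => (setupState len n i (3 ^ i) (len / 2 ^ i), μ)) (N := len.size)
    (B := 15 * len + 16 * 3 ^ len.size + 99) (fun i hi => ?_) ?_ (fun i hi => ?_)
  · have h1 : len / 2 ^ len.size = 0 := Nat.div_eq_of_lt (Nat.lt_size_self len)
    simp only [pow_zero, Nat.div_one, h1] at h
    exact h
  · have : 0 < len / 2 ^ i := Nat.div_pos (Nat.lt_size.1 hi) (by positivity)
    exact this.ne'
  · exact Nat.div_eq_of_lt (Nat.lt_size_self len)
  · set s := setupState len n i (3 ^ i) (len / 2 ^ i) with hs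
    have h1 : Runs (.copy rTmp rDG) (s, μ) ({ s with tmp := len / 2 ^ i }, μ) 1 :=
      runs_of_eval_eq rfl rfl le_rfl
    have h2 := runs_halve { s with tmp := len / 2 ^ i } μ rfl
    have h3 : Runs (.block [.copy rDG rQuo, .const rQuo 0, .succ rDepth, .copy rTmp rPow,
        .copy rTmp2 rPow]) ({ s with tmp := 0, quo := len / 2 ^ i / 2 }, μ)
        ({ s with dG := len / 2 ^ i / 2, depth := i + 1, tmp := 3 ^ i, tmp2 := 3 ^ i }, μ) 15 :=
      runs_of_eval_eq rfl rfl (by decide)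
    have h4 : Runs (addTmp rPow)
        ({ s with dG := len / 2 ^ i / 2, depth := i + 1, tmp := 3 ^ i, tmp2 := 3 ^ i }, μ)
        ({ s with dG := len / 2 ^ i / 2, depth := i + 1, pow := 3 ^ i + 3 ^ i, tmp2 := 3 ^ i }, μ)
        (8 * 3 ^ i + 1) := runs_addTmp (by decide) _ _
    have h5 : Runs (.copy rTmp rTmp2)
        ({ s with dG := len / 2 ^ i / 2, depth := i + 1, pow := 3 ^ i + 3 ^ i, tmp2 := 3 ^ i }, μ)
        ({ s with
          dG := len / 2 ^ i / 2, depth := i + 1, pow := 3 ^ i + 3 ^ i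
          tmp := 3 ^ i, tmp2 := 3 ^ i }, μ) 1 := runs_of_eval_eq rfl rfl le_rfl
    have h6 : Runs (addTmp rPow)
        ({ s with
          dG := len / 2 ^ i / 2, depth := i + 1, pow := 3 ^ i + 3 ^ i
          tmp := 3 ^ i, tmp2 := 3 ^ i }, μ)
        ({ s with
          dG := len / 2 ^ i / 2, depth := i + 1, pow := 3 ^ i + 3 ^ i + 3 ^ i, tmp2 := 3 ^ i }, μ)
        (8 * 3 ^ i + 1) := runs_addTmp (by decide) _ _
    have h7 : Runs (.const rTmp2 0)
        ({ s with
          dG := len / 2 ^ i / 2, depth := i + 1, pow := 3 ^ i + 3 ^ i + 3 ^ i, tmp2 := 3 ^ i }, μ)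
        (setupState len n (i + 1) (3 ^ i + 3 ^ i + 3 ^ i) (len / 2 ^ i / 2), μ) 1 :=
      runs_of_eval_eq rfl rfl le_rfl
    refine ((h1.cons (h2.cons (h3.cons (h4.cons (h5.cons (h6.cons (h7.cons
      (Runs.nil _)))))))).of_eq ?_).mono ?_
    · rw [show 3 ^ i + 3 ^ i + 3 ^ i = 3 ^ (i + 1) by ring, Nat.div_div_eq_div_mul, ← pow_succ]
    · have e1 : len / 2 ^ i ≤ len := Nat.div_le_self _ _
      have e2 : 3 ^ i ≤ 3 ^ len.size := Nat.pow_le_pow_right (by norm_num) hi.le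
      change 1 + (15 * (len / 2 ^ i) + 20 + _ + 1) + 1 ≤ _
      omega

/-- Read the number of variables, compute the depth of the trees and the numbers of the wires, and
write the beginning of the target word behind the formula. The number of gates is left open, and
the zeros of the basis state need not be written. -/
def setup : Prog :=
  .block
    [.block [.load rN rN, .const rPow 1, .copy rDG rLen],
    computeDepth,
    .block [.copy rOut rN, .succ rOut, .copy rB1 rOut, .copy rTmp rDepth],
    addTmp rOut,
    .block [.copy rB2 rOut, .copy rTmp rDepth],
    addTmp rOut,
    .block [.copy rK rOut, .succ rK, .copy rN2 rN, .copy rTmp rN],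
    addTmp rN2,
    .block [.copy rWp rLen, .store rWp rK, .succ rWp, .succ rWp, .copy rTmp rK],
    addTmp rWp]

/-- The beginning of the target word, with the number of gates left open. -/
def header (n D : ℕ) : List ℕ :=
  (n + 1 + D + D + 1) :: 0 :: List.replicate (n + 1 + D + D + 1) 0

lemma runs_setup (inp : List ℕ) {n : ℕ} (hn : inp.getD 0 0 = n) :
    Runs setup (setupState inp.length 0 0 0 0, fun i => inp.getD i 0)
      (emitted (workState inp.length n inp.length.size 0 0 0 0 0 0 0 0)
        (inp ++ header n inp.length.size) [])
      (inp.length.size * (15 * inp.length + 16 * 3 ^ inp.length.size + 200) + 20 * n + 300) := by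
  set len := inp.length with hlen
  set D := len.size with hD
  set μ : ℕ → ℕ := fun i => inp.getD i 0 with hμ
  have h1 : Runs (.block [.load rN rN, .const rPow 1, .copy rDG rLen])
      (setupState len 0 0 0 0, μ) (setupState len n 0 1 len, μ) 10 :=
    runs_of_eval_eq rfl (by simp only [Prog.block, Prog.eval]; rw [← hn]; rfl) (by decide)
  have h2 : Runs computeDepth (setupState len n 0 1 len, μ) (setupState len n D (3 ^ D) 0, μ)
    (D * (15 * len + 16 * 3 ^ D + 100) + 1) := runs_computeDepth len n μ
  set s := setupState len n D (3 ^ D) 0 with hs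
  have h3 : Runs (.block [.copy rOut rN, .succ rOut, .copy rB1 rOut, .copy rTmp rDepth]) (s, μ)
      ({ s with out := n + 1, b1 := n + 1, tmp := D }, μ) 12 := runs_of_eval_eq rfl rfl (by decide)
  have h4 : Runs (addTmp rOut) ({ s with out := n + 1, b1 := n + 1, tmp := D }, μ)
      ({ s with out := n + 1 + D, b1 := n + 1 }, μ) (8 * D + 1) := runs_addTmp (by decide) _ _
  have h5 : Runs (.block [.copy rB2 rOut, .copy rTmp rDepth])
      ({ s with out := n + 1 + D, b1 := n + 1 }, μ)
      ({ s with out := n + 1 + D, b1 := n + 1, b2 := n + 1 + D, tmp := D }, μ) 10 :=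
    runs_of_eval_eq rfl rfl (by decide)
  have h6 : Runs (addTmp rOut)
      ({ s with out := n + 1 + D, b1 := n + 1, b2 := n + 1 + D, tmp := D }, μ)
      ({ s with out := n + 1 + D + D, b1 := n + 1, b2 := n + 1 + D }, μ) (8 * D + 1) :=
    runs_addTmp (by decide) _ _
  have h7 : Runs (.block [.copy rK rOut, .succ rK, .copy rN2 rN, .copy rTmp rN])
      ({ s with out := n + 1 + D + D, b1 := n + 1, b2 := n + 1 + D }, μ)
      ({ s with
        out := n + 1 + D + D, b1 := n + 1, b2 := n + 1 + D, k := n + 1 + D + D + 1, n2 := n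
        tmp := n }, μ) 12 := runs_of_eval_eq rfl rfl (by decide)
  have h8 : Runs (addTmp rN2)
      ({ s with
        out := n + 1 + D + D, b1 := n + 1, b2 := n + 1 + D, k := n + 1 + D + D + 1, n2 := n
        tmp := n }, μ)
      (workState len n D 0 0 0 0 0 0 0 0, μ) (8 * n + 1) := runs_addTmp (by decide) _ _
  set s' := workState len n D 0 0 0 0 0 0 0 0 with hs'
  set k := n + 1 + D + D + 1 with hk
  have h9 : Runs (.block [.copy rWp rLen, .store rWp rK, .succ rWp, .succ rWp, .copy rTmp rK])
      (s', μ) ({ s' with wp := len + 1 + 1, tmp := k }, Function.update μ len k) 15 :=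
    runs_of_eval_eq rfl rfl (by decide)
  have h10 : Runs (addTmp rWp)
      ({ s' with wp := len + 1 + 1, tmp := k }, Function.update μ len k)
      ({ s' with wp := len + 1 + 1 + k }, Function.update μ len k) (8 * k + 1) :=
    runs_addTmp (by decide) _ _
  refine ((h1.cons (h2.cons (h3.cons (h4.cons (h5.cons (h6.cons (h7.cons (h8.cons (h9.cons
    (h10.cons (Runs.nil _))))))))))).of_eq (Prod.ext ?_ ?_)).mono ?_
  · simp only [emitted, header, hs', workState, Regs.mk.injEq, and_true, true_and,
      List.length_append, List.length_cons, List.length_replicate, List.length_nil]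
    omega
  · simp only [emitted, hμ, hlen, update_getD_length]
    funext i
    simp only [genMem, header, List.flatMap_nil, List.append_nil, List.getD_eq_getElem?_getD]
    rcases lt_or_ge i (inp ++ [k]).length with hi | hi
    · have : inp ++ k :: 0 :: List.replicate k 0 = (inp ++ [k]) ++ 0 :: List.replicate k 0 := by
        simp
      rw [this, List.getElem?_append_left hi]
    · have : inp ++ k :: 0 :: List.replicate k 0 = (inp ++ [k]) ++ List.replicate (k + 1) 0 := by
        simp [List.replicate_succ]
      rw [this, List.getElem?_append_right hi, List.getElem?_eq_none hi, List.getElem?_replicate]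
      split_ifs <;> rfl
  · have e0 : D * (15 * len + 16 * 3 ^ D + 200) = D * (15 * len + 16 * 3 ^ D + 100) + 100 * D := by
      ring
    omega

/-- Move the word behind the formula to the beginning of the memory, erase the rest, write the
number of gates to its place, and clear all registers apart from `len`, which becomes the length of
the word, and `n`: the algorithm that runs next expects all other cells to be zero. -/
def finish : Prog :=
  .block
    [.block [.copy rTmp rWp, .copy rTmp2 rLen],
    subTmp,
    .block [.copy rGc rTmp, .copy rH rTmp, .copy rDS rLen, .const rTmp 0],
    .repeat rGc [.load rTmp rDS, .store rG rTmp, .const rTmp 0, .succ rDS, .succ rG],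
    .copy rGc rLen,
    .repeat rGc [.store rG rTmp, .succ rG],
    .block [.const rG 1, .store rG rCnt, .copy rLen rH],
    .block [.const rDepth 0, .const rPow 0, .const rOut 0, .const rB1 0, .const rB2 0, .const rN2 0,
      .const rWp 0, .const rCnt 0, .const rK 0, .const rG 0, .const rH 0, .const rDS 0]]

lemma runs_finish (inp : List ℕ) (n D : ℕ) (lit : ℕ → ℕ → Bool × Bool) :
    Runs finish (emitted (workState inp.length n D 0 0 0 0 0 0 0 0) (inp ++ header n D)
        (sandwichList n D lit))
      (setupState (targetWord n D lit).length n 0 0 0, fun i => (targetWord n D lit).getD i 0)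
      (20 * inp.length + 20 * (targetWord n D lit).length + 200) := by
  set B := inp.length with hB
  set gs := sandwichList n D lit with hgs
  set s := workState B n D 0 0 0 0 0 0 0 0 with hs
  set pre := inp ++ header n D with hpre
  set M := genMem pre gs with hM
  set W := pre.length + 4 * gs.length with hW
  set L := (targetWord n D lit).length with hL
  have hWL : W = B + L := by
    simp only [hW, hL, hpre, targetWord, header, List.length_append, List.length_cons,
      List.length_replicate, length_flatMap_natEncode, ← hgs]
    omega
  set s₁ : Regs := { s with wp := W, cnt := gs.length } with hs₁
  have h1 : Runs (.block [.copy rTmp rWp, .copy rTmp2 rLen]) (s₁, M)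
    ({ s₁ with tmp := W, tmp2 := B }, M) 10 := runs_of_eval_eq rfl rfl (by decide)
  have h2 : Runs subTmp ({ s₁ with tmp := W, tmp2 := B }, M) ({ s₁ with tmp := L }, M)
      (8 * B + 1) := by
    have := runs_subTmp { s₁ with tmp := W, tmp2 := B } M
    rwa [show W - B = L by omega] at this
  have h3 : Runs (.block [.copy rGc rTmp, .copy rH rTmp, .copy rDS rLen, .const rTmp 0])
    ({ s₁ with tmp := L }, M) ({ s₁ with gc := L, h := L, dS := B }, M) 12 :=
    runs_of_eval_eq rfl rfl (by decide)
  -- `M₁ i` is the memory after `i` cells have been moved; as the source lies to the right, no cell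
  -- is overwritten before it has been moved.
  set M₁ : ℕ → ℕ → ℕ := fun i a => if a < i then M (B + a) else M a with hM₁
  have h4 : Runs (.repeat rGc [.load rTmp rDS, .store rG rTmp, .const rTmp 0, .succ rDS, .succ rG])
      ({ s₁ with gc := L, h := L, dS := B }, M)
      ({ s₁ with g := L, h := L, dS := B + L }, M₁ L) (L * (15 + 1) + 1) := by
    refine Runs.repeat (fun i => ({ s₁ with g := i, gc := L - i, h := L, dS := B + i }, M₁ i))
      ?_ (by simp [hs₁, hs, workState]) (fun i hi => by simp; omega) (by simp)
      (fun i hi => runs_of_eval_eq rfl (Prod.ext rfl ?_) (by decide))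
    · simp [hM₁, hs₁, hs, workState]
    · change Function.update (M₁ i) i (M₁ i (B + i)) = M₁ (i + 1)
      funext a
      simp only [Function.update_apply, hM₁]
      by_cases h1 : a = i
      · subst h1; simp
      · rw [if_neg h1]
        exact if_congr (by omega) rfl rfl
  have h5 : Runs (.copy rGc rLen) ({ s₁ with g := L, h := L, dS := B + L }, M₁ L)
    ({ s₁ with g := L, gc := B, h := L, dS := B + L }, M₁ L) 1 := runs_of_eval_eq rfl rfl le_rfl
  -- `M₂ i` is the memory after `i` cells behind the moved word have been erased.
  set M₂ : ℕ → ℕ → ℕ := fun i a => if a < L then M (B + a) else if a < L + i then 0 else M a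
    with hM₂
  have h6 : Runs (.repeat rGc [.store rG rTmp, .succ rG])
      ({ s₁ with g := L, gc := B, h := L, dS := B + L }, M₁ L)
      ({ s₁ with g := L + B, h := L, dS := B + L }, M₂ B) (B * (10 + 1) + 1) := by
    refine Runs.repeat (fun i => ({ s₁ with g := L + i, gc := B - i, h := L, dS := B + L }, M₂ i))
      (Prod.ext rfl ?_) (by simp [hs₁, hs, workState]) (fun i hi => by simp; omega) (by simp)
      (fun i hi => runs_of_eval_eq rfl (Prod.ext rfl ?_) (by decide))
    · funext a
      simp only [hM₁, hM₂]
      split_ifs <;> first | rfl | omega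
    · change Function.update (M₂ i) (L + i) 0 = M₂ (i + 1)
      funext a
      simp only [Function.update_apply, hM₂]
      split_ifs <;> first | rfl | omega
  have h7 : Runs (.block [.const rG 1, .store rG rCnt, .copy rLen rH])
      ({ s₁ with g := L + B, h := L, dS := B + L }, M₂ B)
      ({ s₁ with len := L, g := 1, h := L, dS := B + L }, Function.update (M₂ B) 1 gs.length) 12 :=
    runs_of_eval_eq rfl rfl (by decide)
  have h8 : Runs (.block [.const rDepth 0, .const rPow 0, .const rOut 0, .const rB1 0,
      .const rB2 0, .const rN2 0, .const rWp 0, .const rCnt 0, .const rK 0, .const rG 0,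
      .const rH 0, .const rDS 0])
      ({ s₁ with len := L, g := 1, h := L, dS := B + L }, Function.update (M₂ B) 1 gs.length)
      (setupState L n 0 0 0, Function.update (M₂ B) 1 gs.length) 40 :=
    runs_of_eval_eq rfl rfl (by decide)
  refine ((h1.cons (h2.cons (h3.cons (h4.cons (h5.cons (h6.cons (h7.cons (h8.cons
    (Runs.nil _))))))))).of_eq ?_).mono ?_
  swap
  · omega
  refine Prod.ext rfl ?_
  have hMadd : ∀ a, M (B + a) = (header n D ++ gs.flatMap natEncode).getD a 0 := fun a => by
    simp only [hM, genMem, hpre, List.append_assoc, List.getD_eq_getElem?_getD]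
    rw [List.getElem?_append_right (by omega)]
    congr 2
    omega
  funext a
  change Function.update (M₂ B) 1 gs.length a = (targetWord n D lit).getD a 0
  rw [Function.update_apply]
  split_ifs with ha
  · subst ha
    rfl
  · have h : M₂ B a = (header n D ++ gs.flatMap natEncode).getD a 0 := by
      simp only [hM₂, ← hMadd]
      split_ifs with h1 h2
      · rfl
      · rw [hMadd]
        simp only [List.getD_eq_getElem?_getD]
        rw [List.getElem?_eq_none]
        · rfl
        · have hL2 : (header n D ++ gs.flatMap natEncode).length = L := by
            simp only [hL, targetWord, header, List.length_append, List.length_cons, ← hgs]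
            omega
          omega
      · have : ∀ b, W ≤ b → M b = 0 := fun b hb => by
          simp only [hM, genMem, List.getD_eq_getElem?_getD]
          rw [List.getElem?_eq_none]
          · rfl
          · rw [List.length_append, length_flatMap_natEncode]
            exact hb
        rw [this a (by omega), this (B + a) (by omega)]
    rw [h]
    rcases a with - | - | a
    · rfl
    · exact absurd rfl ha
    · simp only [header, targetWord, List.cons_append, List.getD_cons_succ, ← hgs]

/-- The program that replaces the encoding of a formula by the encoding of its circuit. -/
def reduction : Prog := .block [setup, writeSandwich, finish]

/-- A bound for the running time of `reduction`, for formulas in `n` variables with an encoding of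
length `len`; `D` is the bit length of `len`. -/
def reductionCost (len n D : ℕ) (lit : ℕ → ℕ → Bool × Bool) : ℕ :=
  D * (15 * len + 16 * 3 ^ D + 200) + 140 * n + 3 ^ D * (clauseCost n D + 10)
    + 20 * len + 20 * (targetWord n D lit).length + 710

lemma runs_reduction {n : ℕ} (φ : CNF n) (hn : n = 0 → φ = []) :
    Runs reduction (setupState φ.encode.length 0 0 0 0, fun i => φ.encode.getD i 0)
      (setupState (targetWord n φ.encode.length.size φ.literals).length n 0 0 0,
        fun i => (targetWord n φ.encode.length.size φ.literals).getD i 0)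
      (reductionCost φ.encode.length n φ.encode.length.size φ.literals) := by
  have h1 := runs_setup φ.encode (n := n) rfl
  have h2 := runs_writeSandwich φ hn (header n φ.encode.length.size) φ.encode.length.size
  have h3 := runs_finish φ.encode n φ.encode.length.size φ.literals
  refine (h1.cons (h2.cons (h3.cons (Runs.nil _)))).mono ?_
  simp only [reductionCost]
  omega

/-! ### Evaluating the answer of a strong simulation -/

/-- The problem of computing `ans φ` for formulas `φ` with at most `c * n ^ 2` clauses. -/
def cnfProblem (ans : ∀ n : ℕ, CNF n → List ℕ) (c : ℝ) : Problem where
  Inst := Σ n : ℕ, { φ : CNF n // (φ.length : ℝ) ≤ c * (n : ℝ) ^ 2 }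
  param I := I.1
  encode I := I.2.1.encode
  answer I := ans I.1 I.2.1

/-- In at most `T` steps, the program `Q` turns the answer to the strong simulation problem with
`p`-bit precision on a circuit of amplitude `|φ| / 2 ^ n` into `ans φ`, if the register `R` holds
`n`; and it halts in any case. -/
def Evaluates (Q : Prog) (R T : ℕ) (p : ℕ → ℕ) (ans : ∀ n : ℕ, CNF n → List ℕ) : Prop :=
  ∀ (n k : ℕ) (φ : CNF n), n < k → ∀ ρ μ ψ, ∃ t ≤ T, ∃ d : Config,
    Reach t ⟨[Q], ρ, μ, ψ⟩ d ∧ d.todo = [] ∧ d.state = ψ ∧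
      (ρ R = n → (⟨[], ρ, μ, ψ⟩ : Config).output
          = digits (p k) ⌊(2 : ℝ) ^ (p k - 1) * ((φ.count : ℝ) / 2 ^ n)⌋₊ →
        d.output = ans n φ)

lemma eq_of_map_range_eq {l m : ℕ} {f g : ℕ → ℕ}
    (h : (List.range l).map f = (List.range m).map g) : ∀ i < m, f i = g i := by
  obtain rfl : l = m := by simpa using congrArg List.length h
  exact fun i hi => List.map_inj_left.1 h i (List.mem_range.2 hi)

/-- With `k + 1` digits the amplitude is given exactly, and its first `n + 1` digits are those of
`|φ|`. -/
lemma evaluates_count {R : ℕ} :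
    Evaluates (.seq (.copy 0 R) (.succ 0)) R 3 (fun k => k + 1)
      (fun n φ => digits (n + 1) φ.count) := by
  intro n k φ hk ρ μ ψ
  refine ⟨3, le_rfl, _, ⟨_, rfl, _, rfl, _, rfl, rfl⟩, rfl, rfl, fun hR hout => ?_⟩
  have hfloor : ⌊(2 : ℝ) ^ (k + 1 - 1) * ((φ.count : ℝ) / 2 ^ n)⌋₊ = φ.count * 2 ^ (k - n) := by
    have : (2 : ℝ) ^ (k + 1 - 1) * ((φ.count : ℝ) / 2 ^ n) = ((φ.count * 2 ^ (k - n) : ℕ) : ℝ) := by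
      rw [show k + 1 - 1 = (k - n) + n by omega, pow_add]
      push_cast
      field_simp
    rw [this, Nat.floor_natCast]
  rw [hfloor] at hout
  have h : ∀ i < k + 1, μ i = φ.count * 2 ^ (k - n) / 2 ^ (k + 1 - 1 - i) % 2 :=
    eq_of_map_range_eq hout
  simp only [Config.output, Function.update_self, hR, digits]
  refine List.map_congr_left fun i hi => ?_
  rw [List.mem_range] at hi
  rw [h i (by omega), show k + 1 - 1 - i = (n + 1 - 1 - i) + (k - n) by omega, pow_add,
    Nat.mul_div_mul_right _ _ (by positivity)]

lemma CNF.count_le {n : ℕ} (φ : CNF n) : φ.count ≤ 2 ^ n :=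
  (Finset.card_filter_le _ _).trans (by simp)

/-- Make the disjunction of the bits in the first two cells the output. Register `1`, which holds
the first bit, also serves as the address `0` of the cell to be overwritten if this bit is zero. -/
def disjunction : Prog :=
  .block [.const 1 0, .load 1 1, .const 2 1, .load 2 2, .ite 1 .skip (.store 1 2), .const 0 1]

/-- With two digits the amplitude is at least `1/2` if and only if one of them is `1`. -/
lemma evaluates_majority {R : ℕ} :
    Evaluates disjunction R 14 (fun _ => 2)
      (fun n φ => [if 2 ^ n ≤ 2 * φ.count then 1 else 0]) := by
  intro n k φ hk ρ μ ψ
  have hfloor : ⌊(2 : ℝ) ^ (2 - 1) * ((φ.count : ℝ) / 2 ^ n)⌋₊ = 2 * φ.count / 2 ^ n := by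
    rw [← Nat.floor_div_eq_div (K := ℝ)]
    congr 1
    push_cast
    ring
  have hle : 2 * φ.count / 2 ^ n ≤ 2 :=
    Nat.div_le_of_le_mul (by have := φ.count_le; omega)
  have hpos : 2 ^ n ≤ 2 * φ.count ↔ 1 ≤ 2 * φ.count / 2 ^ n := by
    rw [Nat.le_div_iff_mul_le (by positivity), one_mul]
  have key : (⟨[], ρ, μ, ψ⟩ : Config).output
      = digits 2 ⌊(2 : ℝ) ^ (2 - 1) * ((φ.count : ℝ) / 2 ^ n)⌋₊ →
      (if μ 0 ≠ 0 then μ 0 else μ 1) = if 2 ^ n ≤ 2 * φ.count then 1 else 0 := by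
    intro hout
    rw [hfloor] at hout
    have h : ∀ i < 2, μ i = 2 * φ.count / 2 ^ n / 2 ^ (2 - 1 - i) % 2 := eq_of_map_range_eq hout
    rw [h 0 (by omega), h 1 (by omega)]
    simp only [hpos]
    -- The possible answers are `0.0`, `0.1` and `1.0`.
    generalize 2 * φ.count / 2 ^ n = N at hle
    interval_cases N <;> rfl
  by_cases h0 : μ 0 = 0
  · refine ⟨14, le_rfl, ⟨[], Function.update (Function.update (Function.update (Function.update
      (Function.update ρ 1 0) 1 0) 2 1) 2 (μ 1)) 0 1, Function.update μ 0 (μ 1), ψ⟩, ?_, rfl, rfl,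
      fun _ hout => ?_⟩
    · simp [disjunction, Reach, Config.step, h0]
    · change _ = [if 2 ^ n ≤ 2 * φ.count then 1 else 0]
      rw [← key hout]
      simp [Config.output, h0, List.range_succ]
  · refine ⟨14, le_rfl, ⟨[], Function.update (Function.update (Function.update (Function.update
      (Function.update ρ 1 0) 1 (μ 0)) 2 1) 2 (μ 1)) 0 1, μ, ψ⟩, ?_, rfl, rfl,
      fun _ hout => ?_⟩
    · simp [disjunction, Reach, Config.step, h0]
    · change _ = [if 2 ^ n ≤ 2 * φ.count then 1 else 0]
      rw [← key hout]
      simp [Config.output, h0, List.range_succ]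

/-! ### Reducing formulas to circuits -/

/-- The reduction, after which the number of variables is moved to the register `R`. -/
def reductionKeeping (R : ℕ) : Prog := .block [reduction, .copy R rN, .const rN 0]

/-- The reduction ends in the configuration in which `P` starts on the encoding of the circuit, but
for the register `R`. -/
lemma reach_reductionKeeping {n : ℕ} (φ : CNF n) (hn : n = 0 → φ = []) {R : ℕ} (hR : 39 ≤ R)
    (P : Prog) :
    ∃ u ≤ reductionCost φ.encode.length n φ.encode.length.size φ.literals + 6, ∀ k,
      Reach u ⟨reductionKeeping R :: k, (P.start φ.encode).reg, (P.start φ.encode).mem,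
          (P.start φ.encode).state⟩
        ⟨k, Function.update
            (P.start (targetWord n φ.encode.length.size φ.literals)).reg R n,
          (P.start (targetWord n φ.encode.length.size φ.literals)).mem,
          (P.start (targetWord n φ.encode.length.size φ.literals)).state⟩ := by
  obtain ⟨u, hu, h⟩ := runs_reduction φ hn
  set w := targetWord n φ.encode.length.size φ.literals
  have hreg : ∀ l i, (setupState l i 0 0 0).get
      = Function.update (Function.update (fun _ => 0) 0 l) 1 i := by
    intro l i
    funext r
    rcases r with - | - | r
    · rfl
    · rfl
    · have h : (Function.update (Function.update (fun _ => 0) 0 l) 1 i : ℕ → ℕ) (r + 2) = 0 := by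
        simp
      rw [h]
      rcases lt_or_ge r 37 with hr | hr
      · interval_cases r <;> rfl
      · rw [Regs.get, List.getD_eq_default]
        simpa using hr
  have h0 : (P.start φ.encode).reg = (setupState φ.encode.length 0 0 0 0).get := by
    rw [hreg, Prog.start]
    funext r
    rcases r with - | - | r <;> simp
  have h1 : Function.update (Function.update (setupState w.length n 0 0 0).get R
      ((setupState w.length n 0 0 0).get rN)) rN 0 = Function.update (P.start w).reg R n := by
    rw [hreg, Function.update_comm (show R ≠ 1 by omega), Prog.start]
    congr 1
    funext r
    rcases r with - | - | r <;> simp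
  refine ⟨1 + u + 5, by omega, fun k => ?_⟩
  rw [h0, ← h1]
  exact ((Reach.of_step rfl).trans (h _ _)).trans ⟨_, rfl, _, rfl, _, rfl, _, rfl, _, rfl, rfl⟩

/-! ### Polynomial bounds -/

/-- In this and the following bounds `B` is any number that dominates `n`, the length of the input,
`D` and `2 ^ D`; lower powers of `B` are absorbed by the highest one. -/
lemma leafCost_le {B D : ℕ} (h1 : 1 ≤ B) (h2 : 2 ^ D ≤ B) (h3 : 3 ^ D ≤ B ^ 2) (hD : D ≤ B) :
    leafCost D ≤ 556 * B ^ 3 := by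
  calc leafCost D = D * (20 * 3 ^ D + 16 * 2 ^ D + 100) + 20 * 2 ^ D + 400 := rfl
    _ ≤ B * (20 * B ^ 2 + 16 * B + 100) + 20 * B + 400 := by gcongr
    _ = 20 * B ^ 3 + 16 * B ^ 2 + 120 * B + 400 := by ring
    _ ≤ 20 * B ^ 3 + 16 * B ^ 3 + 120 * B ^ 3 + 400 * B ^ 3 := by
      gcongr
      · omega
      · exact Nat.le_self_pow (by omega) _
      · exact Nat.le_mul_of_pos_right _ (by positivity)
    _ = 556 * B ^ 3 := by ring

lemma clauseCost_le {B n D : ℕ} (h1 : 1 ≤ B) (hn : n ≤ B) (h2 : 2 ^ D ≤ B) (h3 : 3 ^ D ≤ B ^ 2)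
    (hD : D ≤ B) : clauseCost n D ≤ 1134 * B ^ 5 := by
  have hp : ∀ i ≤ 5, B ^ i ≤ B ^ 5 := fun i hi => Nat.pow_le_pow_right h1 hi
  have e0 := hp 0 (by omega)
  have e1 := hp 1 (by omega)
  have e2 := hp 2 (by omega)
  have e3 := hp 3 (by omega)
  rw [pow_one] at e1
  calc clauseCost n D = D * (20 * 3 ^ D + 16 * ((n + n) * 2 ^ D) + 100) + 8 * ((n + n) * 2 ^ D)
        + 3 ^ D * (leafCost D + 10) + 400 := rfl
    _ ≤ B * (20 * B ^ 2 + 16 * ((B + B) * B) + 100) + 8 * ((B + B) * B)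
        + B ^ 2 * (556 * B ^ 3 + 10) + 400 := by
      gcongr
      exact leafCost_le h1 h2 h3 hD
    _ = 556 * B ^ 5 + 52 * B ^ 3 + 26 * B ^ 2 + 100 * B + 400 * B ^ 0 := by ring
    _ ≤ 1134 * B ^ 5 := by omega

lemma length_sandwichList_le {B n D : ℕ} (φ : CNF n) (h1 : 1 ≤ B) (hn : n ≤ B)
    (h3 : 3 ^ D ≤ B ^ 2) : (sandwichList n D φ.literals).length ≤ 8 * B ^ 4 := by
  have hp : ∀ i ≤ 4, B ^ i ≤ B ^ 4 := fun i hi => Nat.pow_le_pow_right h1 hi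
  have e0 := hp 0 (by omega)
  have e1 := hp 1 (by omega)
  rw [pow_one] at e1
  have h4 : 3 ^ (D + D) ≤ B ^ 4 := by
    calc 3 ^ (D + D) = 3 ^ D * 3 ^ D := pow_add _ _ _
      _ ≤ B ^ 2 * B ^ 2 := by gcongr
      _ = B ^ 4 := by ring
  have h5 : (formulaList n D φ.literals).length ≤ 3 * 3 ^ (D + D) := by
    rw [← formulaGates_eq_formulaList]
    exact length_formulaGates_le _ _ _ _ _ _ _ _
  simp only [sandwichList, List.length_append, List.length_map, List.length_range,
    List.length_singleton]
  omega

lemma reductionCost_le {B n D len : ℕ} (φ : CNF n) (h1 : 1 ≤ B) (hn : n ≤ B) (hlen : len ≤ B)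
    (h2 : 2 ^ D ≤ B) (h3 : 3 ^ D ≤ B ^ 2) (hD : D ≤ B) :
    reductionCost len n D φ.literals ≤ 4000 * B ^ 7 := by
  have hp : ∀ i ≤ 7, B ^ i ≤ B ^ 7 := fun i hi => Nat.pow_le_pow_right h1 hi
  have e0 := hp 0 (by omega)
  have e1 := hp 1 (by omega)
  have e2 := hp 2 (by omega)
  have e3 := hp 3 (by omega)
  have e4 := hp 4 (by omega)
  rw [pow_one] at e1
  have ht : (targetWord n D φ.literals).length ≤ 32 * B ^ 4 + 3 * B + 4 := by
    have := length_sandwichList_le φ h1 hn h3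
    simp only [targetWord, List.length_append, List.length_cons, List.length_replicate,
      length_flatMap_natEncode]
    omega
  calc reductionCost len n D φ.literals
      = D * (15 * len + 16 * 3 ^ D + 200) + 140 * n + 3 ^ D * (clauseCost n D + 10)
        + 20 * len + 20 * (targetWord n D φ.literals).length + 710 := rfl
    _ ≤ B * (15 * B + 16 * B ^ 2 + 200) + 140 * B + B ^ 2 * (1134 * B ^ 5 + 10)
        + 20 * B + 20 * (32 * B ^ 4 + 3 * B + 4) + 710 := by
      gcongr
      exact clauseCost_le h1 hn h2 h3 hD
    _ = 1134 * B ^ 7 + 640 * B ^ 4 + 16 * B ^ 3 + 25 * B ^ 2 + 420 * B + 790 * B ^ 0 := by ring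
    _ ≤ 4000 * B ^ 7 := by omega

/-- The number `B = (4 + 4 * c) * (n + 1) ^ 3` bounds all quantities of
the reduction that are linear in the length of the encoding of a formula with at most
`c * n ^ 2` clauses. -/
lemma encode_bounds {c n : ℕ} (φ : CNF n) (hφ : φ.length ≤ c * n ^ 2) {B D : ℕ}
    (hB : B = (4 + 4 * c) * (n + 1) ^ 3) (hD : D = φ.encode.length.size) :
    1 ≤ B ∧ n ≤ B ∧ φ.encode.length ≤ B ∧ 2 ^ D ≤ B ∧ 3 ^ D ≤ B ^ 2 ∧ D ≤ B ∧
      φ.length ≤ 2 ^ D ∧ (φ ≠ [] → n ≤ 2 ^ D) := by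
  have hlen := φ.length_encode
  have hlt : φ.encode.length < 2 ^ D := hD ▸ Nat.lt_size_self _
  have hlen' : 2 * φ.encode.length ≤ B := by
    rw [hlen, hB]
    have h1 : n * φ.length ≤ c * (n + 1) ^ 3 :=
      calc n * φ.length ≤ n * (c * n ^ 2) := by gcongr
        _ = c * n ^ 3 := by ring
        _ ≤ c * (n + 1) ^ 3 := by gcongr; omega
    have h2 : 1 ≤ (n + 1) ^ 3 := Nat.one_le_pow _ _ (by omega)
    calc 2 * (2 + 2 * n * φ.length) = 4 * 1 + 4 * (n * φ.length) := by ring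
      _ ≤ 4 * (n + 1) ^ 3 + 4 * (c * (n + 1) ^ 3) := by gcongr
      _ = (4 + 4 * c) * (n + 1) ^ 3 := by ring
  have hn : n ≤ B := by
    rw [hB]
    have h2 : n + 1 ≤ (n + 1) ^ 3 := Nat.le_self_pow (by omega) _
    nlinarith
  have h2D : 2 ^ D ≤ B := by
    have h0 : 2 ≤ φ.encode.length := by omega
    have : 0 < D := hD ▸ Nat.size_pos.2 (by omega)
    obtain ⟨E, rfl⟩ : ∃ E, D = E + 1 := ⟨D - 1, by omega⟩
    have : 2 ^ E ≤ φ.encode.length := Nat.lt_size.1 (by omega)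
    rw [pow_succ]
    omega
  refine ⟨by omega, hn, by omega, h2D, ?_, Nat.lt_two_pow_self.le.trans h2D, ?_, fun h => ?_⟩
  · calc 3 ^ D ≤ 4 ^ D := Nat.pow_le_pow_left (by omega) _
      _ = (2 ^ D) ^ 2 := by rw [← pow_mul, mul_comm D 2, pow_mul]; norm_num
      _ ≤ B ^ 2 := by gcongr
  · rcases Nat.eq_zero_or_pos n with rfl | hn
    · have : φ.length = 0 := by simpa using hφ
      omega
    · have := Nat.le_mul_of_pos_left φ.length hn
      rw [Nat.mul_assoc] at hlen
      omega
  · have h := Nat.le_mul_of_pos_right n (List.length_pos_iff.2 h)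
    rw [Nat.mul_assoc] at hlen
    omega

/-- A power of `n + 1` is at most exponential in `n`, however small the exponent. -/
lemma exists_pow_le_rpow (e : ℕ) {η : ℝ} (hη : 0 < η) :
    ∃ C : ℝ, 0 ≤ C ∧ ∀ n : ℕ, ((n : ℝ) + 1) ^ e ≤ C * (2 : ℝ) ^ ((n : ℝ) * η) := by
  have hl : 0 < η * Real.log 2 := mul_pos hη (Real.log_pos one_lt_two)
  have h := isLittleO_pow_exp_pos_mul_atTop e hl
  have h' := h.isBigO.comp_tendsto
    (tendsto_natCast_atTop_atTop (R := ℝ) |>.comp (Filter.tendsto_add_atTop_nat 1))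
  obtain ⟨C, hC, hb⟩ := Asymptotics.bound_of_isBigO_nat_atTop h'
  refine ⟨C * Real.exp (η * Real.log 2), by positivity, fun n => ?_⟩
  have := hb (x := n) (Real.exp_pos _).ne'
  simp only [Function.comp_apply, Nat.cast_add, Nat.cast_one, norm_pow, Real.norm_eq_abs,
    Real.abs_exp] at this
  rw [abs_of_nonneg (by positivity)] at this
  refine this.trans (le_of_eq ?_)
  rw [Real.rpow_def_of_pos two_pos, mul_assoc C, ← Real.exp_add]
  congr 2
  ring

/-! ### From formulas to strong simulation -/

/-- The circuits of the reduction have polynomially many gates. -/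
lemma length_sandwich_uniformCircuit_le {c n : ℕ} (φ : CNF n) (hφ : φ.length ≤ c * n ^ 2) :
    (sandwich (φ.uniformCircuit φ.encode.length.size)).length
      ≤ (8 * (4 + 4 * c) ^ 4 + 12)
        * (n + (2 * φ.encode.length.size + 1) + 1) ^ (8 * (4 + 4 * c) ^ 4 + 12) := by
  obtain ⟨h1, hn, -, -, h3, -⟩ := encode_bounds φ hφ rfl rfl
  have h := length_sandwichList_le φ h1 hn h3
  rw [← map_sandwich_uniformCircuit, List.length_map] at h
  refine h.trans ?_
  -- The constant is chosen to be at least `12`, the degree of the bound for the number of gates.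
  calc 8 * ((4 + 4 * c) * (n + 1) ^ 3) ^ 4 = (8 * (4 + 4 * c) ^ 4) * (n + 1) ^ 12 := by ring
    _ ≤ (8 * (4 + 4 * c) ^ 4 + 12) * (n + 1) ^ (8 * (4 + 4 * c) ^ 4 + 12) := by
      gcongr <;> omega
    _ ≤ _ := by gcongr; omega

lemma two_rpow_wires_le {n D B : ℕ} {δ : ℝ} (hδ : 0 < δ) (h2 : 2 ^ D ≤ B) :
    (2 : ℝ) ^ (((n + (2 * D + 1) + 1 : ℕ) : ℝ) * (1 - δ))
      ≤ 4 * (B : ℝ) ^ 2 * (2 : ℝ) ^ ((n : ℝ) * (1 - δ)) := by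
  have h2' : (2 : ℝ) ^ D ≤ B := by exact_mod_cast h2
  calc (2 : ℝ) ^ (((n + (2 * D + 1) + 1 : ℕ) : ℝ) * (1 - δ))
      ≤ (2 : ℝ) ^ (((2 * D + 2 : ℕ) : ℝ) + (n : ℝ) * (1 - δ)) := by
        refine Real.rpow_le_rpow_of_exponent_le one_le_two ?_
        push_cast
        have := mul_nonneg (Nat.cast_nonneg (α := ℝ) D) hδ.le
        nlinarith
    _ = 4 * ((2 : ℝ) ^ D) ^ 2 * (2 : ℝ) ^ ((n : ℝ) * (1 - δ)) := by
        rw [Real.rpow_add two_pos, Real.rpow_natCast]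
        ring
    _ ≤ _ := by gcongr

/-- If the simulation of circuits takes time `O(2 ^ (n * (1 - δ)))`, then the algorithm for formulas
runs in time `O(2 ^ (n * (1 - δ')))`. The polynomial factors are absorbed by `2 ^ (n * δ')`, as
`δ' ≤ δ - δ'`; and the time of the reduction itself, too, as `δ' ≤ 1 - δ'`. -/
lemma exists_time_bound (c T : ℕ) (K : ℝ) {δ δ' : ℝ} (hpos : 0 < δ') (h1 : 2 * δ' ≤ 1)
    (h2 : 2 * δ' ≤ δ) :
    ∃ K' : ℝ, ∀ n B D t : ℕ, B = (4 + 4 * c) * (n + 1) ^ 3 → 2 ^ D ≤ B →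
      (t : ℝ) ≤ K * (2 : ℝ) ^ (((n + (2 * D + 1) + 1 : ℕ) : ℝ) * (1 - δ)) →
      ((t + T + (4000 * B ^ 7 + 8) : ℕ) : ℝ) ≤ K' * (2 : ℝ) ^ ((n : ℝ) * (1 - δ')) := by
  have hδ : 0 < δ := by linarith
  obtain ⟨C, hC, hpow⟩ := exists_pow_le_rpow 21 hpos
  refine ⟨(4 * max K 0 + (T + 4008)) * ((4 + 4 * c) ^ 7 * C),
    fun n B D t hB hD ht => ?_⟩
  have hB1 : 1 ≤ B := Nat.one_le_two_pow.trans hD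
  have hBr : (1 : ℝ) ≤ B := by exact_mod_cast hB1
  set E := (2 : ℝ) ^ ((n : ℝ) * (1 - δ)) with hE
  set F := (2 : ℝ) ^ ((n : ℝ) * δ') with hF
  set G := (2 : ℝ) ^ ((n : ℝ) * (1 - δ')) with hG
  have hn : (0 : ℝ) ≤ n := n.cast_nonneg
  have hFE : F * E ≤ G := by
    rw [hF, hE, ← Real.rpow_add two_pos, hG]
    exact Real.rpow_le_rpow_of_exponent_le one_le_two (by nlinarith)
  have hFG : F ≤ G := Real.rpow_le_rpow_of_exponent_le one_le_two (by nlinarith)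
  have hE0 : 0 < E := by positivity
  have hBF : (B : ℝ) ^ 7 ≤ (4 + 4 * c) ^ 7 * C * F := by
    calc (B : ℝ) ^ 7 = (4 + 4 * c) ^ 7 * ((n : ℝ) + 1) ^ 21 := by
          rw [hB]; push_cast; ring
      _ ≤ (4 + 4 * c) ^ 7 * (C * F) := by gcongr; exact hpow n
      _ = _ := by ring
  have hC' : 0 ≤ (4 + 4 * (c : ℝ)) ^ 7 * C := by positivity
  have ht' : (t : ℝ) ≤ 4 * max K 0 * ((4 + 4 * c) ^ 7 * C) * G := by
    calc (t : ℝ) ≤ K * (2 : ℝ) ^ (((n + (2 * D + 1) + 1 : ℕ) : ℝ) * (1 - δ)) := ht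
      _ ≤ max K 0 * (4 * (B : ℝ) ^ 2 * E) := by
        gcongr
        · exact le_max_left _ _
        · exact two_rpow_wires_le hδ hD
      _ ≤ max K 0 * (4 * (B : ℝ) ^ 7 * E) := by gcongr; omega
      _ ≤ max K 0 * (4 * ((4 + 4 * c) ^ 7 * C * F) * E) := by gcongr
      _ = 4 * max K 0 * ((4 + 4 * c) ^ 7 * C) * (F * E) := by ring
      _ ≤ _ := by gcongr
  have hrest : ((T + (4000 * B ^ 7 + 8) : ℕ) : ℝ) ≤ (T + 4008) * ((4 + 4 * c) ^ 7 * C) * G := by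
    have hB7 : (1 : ℝ) ≤ (B : ℝ) ^ 7 := one_le_pow₀ hBr
    have hT : (0 : ℝ) ≤ T := T.cast_nonneg
    calc ((T + (4000 * B ^ 7 + 8) : ℕ) : ℝ) = T * 1 + (4000 * (B : ℝ) ^ 7 + 8 * 1) := by
          push_cast; ring
      _ ≤ T * (B : ℝ) ^ 7 + (4000 * (B : ℝ) ^ 7 + 8 * (B : ℝ) ^ 7) := by gcongr
      _ = (T + 4008) * (B : ℝ) ^ 7 := by ring
      _ ≤ (T + 4008) * ((4 + 4 * c) ^ 7 * C * G) := by
        gcongr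
        exact hBF.trans (by gcongr)
      _ = _ := by ring
  calc ((t + T + (4000 * B ^ 7 + 8) : ℕ) : ℝ) = t + ((T + (4000 * B ^ 7 + 8) : ℕ) : ℝ) := by
        push_cast; ring
    _ ≤ 4 * max K 0 * ((4 + 4 * c) ^ 7 * C) * G + (T + 4008) * ((4 + 4 * c) ^ 7 * C) * G := by
        gcongr
    _ = _ := by ring

/-- The reduction, an algorithm for strong simulation and the evaluation of its answer, put
together. -/
lemma computesWithin_reduction {c n T t : ℕ} (φ : CNF n) (hφ : φ.length ≤ c * n ^ 2)
    {p : ℕ → ℕ} {ans : ∀ n : ℕ, CNF n → List ℕ} {P Q : Prog} {R : ℕ} (hR : 39 ≤ R)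
    (hP : P.RegsLt R) (hQ : Evaluates Q R T p ans)
    (h : P.ComputesWithin t
      ((sandwich (φ.uniformCircuit φ.encode.length.size)).encode fun _ => false)
      (digits (p (n + (2 * φ.encode.length.size + 1) + 1))
        ⌊(2 : ℝ) ^ (p (n + (2 * φ.encode.length.size + 1) + 1) - 1)
          * ‖(sandwich (φ.uniformCircuit φ.encode.length.size)).amplitude fun _ => false‖⌋₊)) :
    (Prog.seq (reductionKeeping R) (.seq P Q)).ComputesWithin
      (t + T + (4000 * ((4 + 4 * c) * (n + 1) ^ 3) ^ 7 + 8)) φ.encode (ans n φ) := by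
  obtain ⟨h1, hn, hlen, h2, h3, hD, hm, hnD⟩ := encode_bounds φ hφ rfl rfl
  have hamp : (sandwich (φ.uniformCircuit φ.encode.length.size)).amplitude (fun _ => false)
      = (φ.count : ℂ) / 2 ^ n := amplitude_sandwich (φ.tidilyComputes_uniformCircuit hm hnD)
  have hnorm : ‖(sandwich (φ.uniformCircuit φ.encode.length.size)).amplitude fun _ => false‖
      = (φ.count : ℝ) / 2 ^ n := by
    rw [hamp]
    simp
  rw [hnorm, encode_sandwich_uniformCircuit] at h
  have h0 : n = 0 → φ = [] := by
    rintro rfl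
    exact List.length_eq_zero_iff.1 (by simpa using hφ)
  refine computesWithin_seq (by omega) hP ?_ (hQ n _ φ (by omega)) h
  obtain ⟨u, hu, hreach⟩ := reach_reductionKeeping φ h0 hR P
  refine ⟨u, hu.trans ?_, hreach⟩
  have := reductionCost_le φ h1 hn hlen h2 h3 hD
  omega

/-- If formulas are hard, then so is the strong simulation of circuits, for a precision from which
the answer for the formula can be recovered. -/
lemma strongSimulation_hard {p : ℕ → ℕ} {ans : ∀ n : ℕ, CNF n → List ℕ} {T : ℕ} {Q : ℕ → Prog}
    (hQ : ∀ R, Evaluates (Q R) R T p ans)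
    (hard : ∀ δ : ℝ, 0 < δ → ∃ c : ℝ, 0 < c ∧
      ¬ (cnfProblem ans c).SolvableInTime fun n => (2 : ℝ) ^ ((n : ℝ) * (1 - δ)))
    (δ : ℝ) (hδ : 0 < δ) :
    ∃ c : ℕ, ¬ (strongSimulation p c).SolvableInTime
      fun n => (2 : ℝ) ^ ((n : ℝ) * (1 - δ)) := by
  set δ' := min δ 1 / 2 with hδ'
  have h1 : 2 * δ' ≤ 1 := by rw [hδ']; linarith [min_le_right δ 1]
  have h2 : 2 * δ' ≤ δ := by rw [hδ']; linarith [min_le_left δ 1]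
  have hpos : 0 < δ' := by positivity
  obtain ⟨c, hc, hnot⟩ := hard δ' hpos
  -- The bound for the number of gates may depend only on `c`, which is fixed before the algorithm.
  refine ⟨8 * (4 + 4 * ⌈c⌉₊) ^ 4 + 12, fun ⟨P, K, hP⟩ => hnot ?_⟩
  obtain ⟨K', hK'⟩ := exists_time_bound ⌈c⌉₊ T K hpos h1 h2
  obtain ⟨R, hR⟩ := P.exists_regsLt
  refine ⟨.seq (reductionKeeping (R + 39)) (.seq P (Q (R + 39))), K', fun ⟨n, φ, hφ⟩ => ?_⟩
  have hφ' : φ.length ≤ ⌈c⌉₊ * n ^ 2 := by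
    have : (φ.length : ℝ) ≤ ⌈c⌉₊ * (n : ℝ) ^ 2 :=
      hφ.trans (mul_le_mul_of_nonneg_right (Nat.le_ceil c) (by positivity))
    exact_mod_cast this
  obtain ⟨t, ht, h⟩ := hP ⟨_, ⟨sandwich (φ.uniformCircuit φ.encode.length.size),
    length_sandwich_uniformCircuit_le φ hφ'⟩, fun _ => false⟩
  obtain ⟨-, -, -, hD, -⟩ := encode_bounds φ hφ' rfl rfl
  exact ⟨_, hK' n _ _ t rfl hD ht, computesWithin_reduction φ hφ' (by omega)
    (hR.mono (by omega)) (hQ _) h⟩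

end QFine

theorem mainTheorem6 :
    (QFine.SharpQSETH → ∀ δ : ℝ, 0 < δ → ∃ c : ℕ,
      ¬ (QFine.strongSimulation (fun n => n + 1) c).SolvableInTime
          fun n => (2 : ℝ) ^ ((n : ℝ) * (1 - δ))) ∧
    (QFine.MajorityQSETH → ∀ δ : ℝ, 0 < δ → ∃ c : ℕ,
      ¬ (QFine.strongSimulation (fun _ => 2) c).SolvableInTime
          fun n => (2 : ℝ) ^ ((n : ℝ) * (1 - δ))) ∧
    (∀ (n : ℕ) (φ : QFine.CNF n), ∃ (w : ℕ) (R : QFine.Circuit (n + w + 1)),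
      w + 1 ≤ max 1 (2 * (Nat.clog 2 n + Nat.clog 2 φ.length)) ∧
      R.length ≤ 8 * 3 ^ (Nat.clog 2 n + Nat.clog 2 φ.length) ∧
      QFine.TidilyComputes R φ.eval ∧
      (QFine.sandwich R).amplitude (fun _ => false) = (φ.count : ℂ) / 2 ^ n) := by
  refine ⟨fun h => QFine.strongSimulation_hard (fun _ => QFine.evaluates_count) h,
    fun h => QFine.strongSimulation_hard (Q := fun _ => QFine.disjunction)
      (fun _ => QFine.evaluates_majority) h, fun n φ => φ.exists_tidy_circuit⟩
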